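/- **Notation.** A graphon is a symmetric measurable function $f:[0,1]^2\to[0,1]$. For graphons $f,g$ let $d_\square(f,g)=\sup_{S,T}\left|\int_{S\times T}(f-g)\right|$, the supremum being over measurable $S,T\subseteq[0,1]$, and $\delta_\square(f,g)=\inf_\phi d_\square(f,g^\phi)$, where $\phi$ runs over the measure-preserving bijections of $[0,1]$ and $g^\phi(x,y)=g(\phi(x),\phi(y))$. Let $\widetilde{\mathcal W}$ be the set of graphons modulo $\delta_\square=0$, a metric space under $\delta_\square$, and $\tilde f$ the class of $f$. For a finite simple graph $H$ let $t(H,f)=\int_{[0,1]^{V(H)}}\prod_{ij\in E(H)}f(x_i,x_j)\,dx$; this depends only on $\tilde f$. Let $h_p(u)=u\log\frac up+(1-u)\log\frac{1-u}{1-p}$ for $p,u\in[0,1]$, with $0\log 0=0\log\frac00=0$ (so $h_p(u)=\infty$ iff $p=0\ne u$ or $p=1\neq u$). For a graphon $W_0$ put $I_{W_0}(f)=\frac12\int_{[0,1]^2}h_{W_0(x,y)}(f(x,y))\,dx\,dy$ and $\Omega=\{(x,y):W_0(x,y)\in(0,1)\}$; let $\mathcal W_\Omega$ be the set of graphons equal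 to $W_0$ almost everywhere outside $\Omega$, and $\widetilde{\mathcal W}_\Omega$ the set of their classes. The rate function on $\widetilde{\mathcal W}$ is $$J_{W_0}(\tilde f)=\sup_{\eta>0}\ \inf\{I_{W_0}(h): h \text{ a graphon},\ \delta_\square(\tilde f,\tilde h)\le\eta\}\quad\text{if }\tilde f\in\widetilde{\mathcal W}_\Omega,\qquad J_{W_0}(\tilde f)=\infty\quad\text{otherwise.}$$ For $\gamma\in(0,1)$ and $r\in[0,1]$ let $f_r^\gamma$ be the graphon equal to $0$ on $[0,\gamma]^2\cup(\gamma,1]^2$ and to $r$ elsewhere. Let $\widetilde{\mathcal B}^{(\gamma,1-\gamma)}$ be the set of classes of graphons that are constant on each of the four products of the intervals $[0,\gamma]$ and $(\gamma,1]$. For $W_0=f_p^\gamma$, we say that $t$ is in the symmetric regime for $W_0$ and $t(H,\cdot)$ if every minimizer of $$\min\{J_{W_0}(\tilde f):\tilde f\in\widetilde{\mathcal W},\ t(H,\tilde f)\ge t\}\qquad(*)$$ belongs to $\widetilde{\mathcal B}^{(\gamma,1-\gamma)}$. The convex minorant of a function on $[0,1]$ is the largest convex function on $[0,1]$ lying below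 it, and a point lies on it if it lies on its graph. **Theorem.** Let $0<p<1$ and $0<\gamma<1$, let $H$ be a finite non-empty bipartite $d$-regular simple graph with $d\ge1$, and let $W_0=f_p^\gamma$. Let $r\in[p,1]$ and $t_r^\gamma=t(H,f_r^\gamma)$. 1. If $(r^d,h_p(r))$ lies on the convex minorant of $[0,1]\ni x\mapsto h_p(x^{1/d})$, then $t_r^\gamma$ is in the symmetric regime for $W_0$ and $t(H,\cdot)$; moreover, $\tilde f_r^\gamma$ is the unique minimizer in $(*)$ with $t=t_r^\gamma$. 2. If $(r^d,h_p(r))$ does not lie on the convex minorant of $x\mapsto h_p(x^{1/d})$, then $t_r^\gamma$ is not in the symmetric regime for $W_0$ and $t(H,\cdot)$. -/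

import Mathlib

open MeasureTheory Set
open scoped ENNReal

noncomputable section

/-- A graphon: a symmetric Borel measurable function `[0,1]² → [0,1]` (real-valued, with values
in `[0,1]`). -/
structure Graphon where
  /-- The underlying function. -/
  toFun : unitInterval → unitInterval → ℝ
  symm' : ∀ x y, toFun x y = toFun y x
  mem_Icc' : ∀ x y, toFun x y ∈ Icc (0 : ℝ) 1
  measurable' : Measurable (Function.uncurry toFun)

namespace Graphon

instance : CoeFun Graphon (fun _ => unitInterval → unitInterval → ℝ) := ⟨Graphon.toFun⟩

/-- The cut distance `d_□(f,g) = sup_{S,T} |∫_{S×T} (f - g)|`, over measurable `S, T ⊆ [0,1]`. -/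
def cutDist (f g : Graphon) : ℝ :=
  sSup {c : ℝ | ∃ S T : Set unitInterval, MeasurableSet S ∧ MeasurableSet T ∧
    c = |∫ z in S ×ˢ T, (f z.1 z.2 - g z.1 z.2)|}

/-- The set of bijective measure-preserving maps `[0,1] → [0,1]` (a bijective Borel map of `[0,1]`
automatically has a Borel inverse). -/
abbrev MPBij : Type :=
  {φ : unitInterval ≃ᵐ unitInterval // MeasurePreserving φ volume volume}

instance : Nonempty MPBij := ⟨⟨MeasurableEquiv.refl _, MeasurePreserving.id _⟩⟩

/-- The graphon `f^φ (x,y) = f (φ x, φ y)`. -/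
def pullback (f : Graphon) (φ : MPBij) : Graphon where
  toFun x y := f (φ.1 x) (φ.1 y)
  symm' _ _ := f.symm' _ _
  mem_Icc' _ _ := f.mem_Icc' _ _
  measurable' := f.measurable'.comp
    ((φ.1.measurable.comp measurable_fst).prodMk (φ.1.measurable.comp measurable_snd))

/-- The cut metric `δ_□(f,g) = inf_φ d_□(f, g^φ)` (a pseudometric on graphons). -/
def cutMetric (f g : Graphon) : ℝ := ⨅ φ : MPBij, cutDist f (g.pullback φ)

theorem nonneg (f : Graphon) (x y : unitInterval) : 0 ≤ f x y := (f.mem_Icc' x y).1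

theorem le_one (f : Graphon) (x y : unitInterval) : f x y ≤ 1 := (f.mem_Icc' x y).2

theorem measurable_comp {α : Type*} [MeasurableSpace α] (f : Graphon) {u v : α → unitInterval}
    (hu : Measurable u) (hv : Measurable v) : Measurable fun a => f (u a) (v a) :=
  f.measurable'.comp (hu.prodMk hv)

theorem abs_sub_le_one (f g : Graphon) (x y : unitInterval) : |f x y - g x y| ≤ 1 := by
  have := f.nonneg x y; have := f.le_one x y; have := g.nonneg x y; have := g.le_one x y
  rw [abs_le]; constructor <;> linarith

theorem integrable_sub (f g : Graphon) :
    Integrable (fun z : unitInterval × unitInterval => f z.1 z.2 - g z.1 z.2) := by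
  refine Integrable.of_bound (C := 1) ?_ ?_
  · exact ((f.measurable_comp measurable_fst measurable_snd).sub
      (g.measurable_comp measurable_fst measurable_snd)).aestronglyMeasurable
  · exact Filter.Eventually.of_forall fun z => f.abs_sub_le_one g _ _

theorem abs_setIntegral_le_one (f g : Graphon) (S : Set (unitInterval × unitInterval)) :
    |∫ z in S, (f z.1 z.2 - g z.1 z.2)| ≤ 1 := by
  have h := norm_integral_le_of_norm_le_const (μ := volume.restrict S) (C := 1)
    (f := fun z : unitInterval × unitInterval => f z.1 z.2 - g z.1 z.2)
    (Filter.Eventually.of_forall fun z => f.abs_sub_le_one g _ _)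
  refine h.trans ?_
  rw [one_mul]
  exact ENNReal.toReal_le_of_le_ofReal zero_le_one (by simpa using prob_le_one)

theorem le_cutDist (f g : Graphon) {S T : Set unitInterval} (hS : MeasurableSet S)
    (hT : MeasurableSet T) : |∫ z in S ×ˢ T, (f z.1 z.2 - g z.1 z.2)| ≤ cutDist f g := by
  refine le_csSup ⟨1, ?_⟩ ⟨S, T, hS, hT, rfl⟩
  rintro c ⟨S, T, -, -, rfl⟩
  exact abs_setIntegral_le_one f g _

theorem cutDist_le {f g : Graphon} {c : ℝ}
    (h : ∀ S T : Set unitInterval, MeasurableSet S → MeasurableSet T →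
      |∫ z in S ×ˢ T, (f z.1 z.2 - g z.1 z.2)| ≤ c) : cutDist f g ≤ c := by
  refine csSup_le ⟨_, ∅, ∅, .empty, .empty, rfl⟩ ?_
  rintro _ ⟨S, T, hS, hT, rfl⟩
  exact h S T hS hT

theorem cutDist_nonneg (f g : Graphon) : 0 ≤ cutDist f g :=
  (abs_nonneg _).trans (le_cutDist f g .empty .empty)

theorem cutDist_self (f : Graphon) : cutDist f f = 0 :=
  le_antisymm (cutDist_le fun S T _ _ => by simp) (cutDist_nonneg f f)

theorem cutDist_comm (f g : Graphon) : cutDist f g = cutDist g f := by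
  have key : ∀ f g : Graphon, cutDist f g ≤ cutDist g f := fun f g =>
    cutDist_le fun S T hS hT => by
      refine le_trans (le_of_eq ?_) (le_cutDist g f hS hT)
      rw [← abs_neg, ← integral_neg]
      simp only [neg_sub]
  exact le_antisymm (key f g) (key g f)

theorem cutDist_triangle (f g h : Graphon) : cutDist f h ≤ cutDist f g + cutDist g h :=
  cutDist_le fun S T hS hT => by
    have : ∫ z in S ×ˢ T, (f z.1 z.2 - h z.1 z.2) =
        (∫ z in S ×ˢ T, (f z.1 z.2 - g z.1 z.2)) + ∫ z in S ×ˢ T, (g z.1 z.2 - h z.1 z.2) := by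
      rw [← integral_add (integrable_sub f g).integrableOn (integrable_sub g h).integrableOn]
      simp
    rw [this]
    exact (abs_add_le _ _).trans (add_le_add (le_cutDist f g hS hT) (le_cutDist g h hS hT))

/-- The inverse of a measure-preserving bijection. -/
def MPBij.inv (φ : MPBij) : MPBij := ⟨φ.1.symm, φ.2.symm φ.1⟩

/-- The composition `x ↦ ψ (φ x)` of measure-preserving bijections. -/
def MPBij.comp (ψ φ : MPBij) : MPBij := ⟨φ.1.trans ψ.1, ψ.2.comp φ.2⟩

theorem cutDist_pullback_le (f g : Graphon) (φ : MPBij) :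
    cutDist (f.pullback φ) (g.pullback φ) ≤ cutDist f g :=
  cutDist_le fun S T hS hT => by
    have hmp : MeasurePreserving (φ.1.prodCongr φ.1) volume volume := φ.2.prod φ.2
    have h := hmp.setIntegral_preimage_emb (φ.1.prodCongr φ.1).measurableEmbedding
      (fun z : unitInterval × unitInterval => f z.1 z.2 - g z.1 z.2)
      ((φ.1.symm ⁻¹' S) ×ˢ (φ.1.symm ⁻¹' T))
    have hpre : (φ.1.prodCongr φ.1) ⁻¹' ((φ.1.symm ⁻¹' S) ×ˢ (φ.1.symm ⁻¹' T)) = S ×ˢ T := by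
      ext z
      simp [MeasurableEquiv.prodCongr]
    rw [hpre] at h
    have h' : ∫ z in S ×ˢ T, (f.pullback φ z.1 z.2 - g.pullback φ z.1 z.2) =
        ∫ z in (φ.1.symm ⁻¹' S) ×ˢ (φ.1.symm ⁻¹' T), (f z.1 z.2 - g z.1 z.2) := h
    rw [h']
    exact le_cutDist f g (φ.1.symm.measurable hS) (φ.1.symm.measurable hT)

theorem pullback_pullback (f : Graphon) (ψ φ : MPBij) :
    (f.pullback ψ).pullback φ = f.pullback (ψ.comp φ) := rfl

theorem pullback_inv_pullback (f : Graphon) (φ : MPBij) : (f.pullback φ).pullback φ.inv = f := by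
  cases f
  simp [pullback, MPBij.inv]

theorem cutMetric_le (f g : Graphon) (φ : MPBij) : cutMetric f g ≤ cutDist f (g.pullback φ) :=
  ciInf_le ⟨0, by rintro _ ⟨φ, rfl⟩; exact cutDist_nonneg _ _⟩ φ

theorem cutMetric_self (f : Graphon) : cutMetric f f = 0 := by
  refine le_antisymm ?_ (le_ciInf fun φ => cutDist_nonneg _ _)
  exact (cutMetric_le f f ⟨MeasurableEquiv.refl _, MeasurePreserving.id _⟩).trans
    (le_of_eq (cutDist_self f))

theorem cutMetric_comm (f g : Graphon) : cutMetric f g = cutMetric g f := by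
  have key : ∀ f g : Graphon, cutMetric f g ≤ cutMetric g f := fun f g =>
    le_ciInf fun φ => by
      refine (cutMetric_le f g φ.inv).trans ?_
      have h := cutDist_pullback_le (f.pullback φ) g φ.inv
      rw [pullback_inv_pullback] at h
      rw [cutDist_comm g]
      exact h
  exact le_antisymm (key f g) (key g f)

theorem cutMetric_triangle (f g h : Graphon) : cutMetric f h ≤ cutMetric f g + cutMetric g h :=
  le_ciInf_add_ciInf fun φ ψ => by
    refine (cutMetric_le f h (ψ.comp φ)).trans ?_
    rw [← pullback_pullback]
    exact (cutDist_triangle f (g.pullback φ) _).trans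
      (add_le_add le_rfl (cutDist_pullback_le g (h.pullback ψ) φ))

instance : PseudoMetricSpace Graphon where
  dist := cutMetric
  dist_self := cutMetric_self
  dist_comm := cutMetric_comm
  dist_triangle := cutMetric_triangle

theorem dist_eq (f g : Graphon) : dist f g = cutMetric f g := rfl


theorem integral_indicator_lt (c : ℝ) (hc : c ∈ Icc (0 : ℝ) 1) :
    ∫ s : unitInterval, (if (s : ℝ) < c then (1 : ℝ) else 0) = c := by
  have h : (fun s : unitInterval => if (s : ℝ) < c then (1 : ℝ) else 0) =
      (Iio (⟨c, hc⟩ : unitInterval)).indicator 1 := by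
    ext s
    simp [indicator, ← Subtype.coe_lt_coe]
  rw [h, integral_indicator_one measurableSet_Iio]
  simp [Measure.real, ENNReal.toReal_ofReal hc.1]

/-- The cut distance controls integrals against product weights with values in `[0,1]`. -/
theorem abs_integral_weighted_le (f g : Graphon) {a b : unitInterval → ℝ} (ha : Measurable a)
    (hb : Measurable b) (ha' : ∀ u, a u ∈ Icc (0 : ℝ) 1) (hb' : ∀ u, b u ∈ Icc (0 : ℝ) 1) :
    |∫ z : unitInterval × unitInterval, (f z.1 z.2 - g z.1 z.2) * (a z.1 * b z.2)|
      ≤ cutDist f g := by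
  set k : (unitInterval × unitInterval) → (unitInterval × unitInterval) → ℝ := fun z w =>
    (f z.1 z.2 - g z.1 z.2) *
      ((if (w.1 : ℝ) < a z.1 then (1 : ℝ) else 0) * (if (w.2 : ℝ) < b z.2 then (1 : ℝ) else 0))
    with hk
  have hkm : Measurable (Function.uncurry k) := by
    have h1 : Measurable fun q : (unitInterval × unitInterval) × (unitInterval × unitInterval) =>
        f q.1.1 q.1.2 := f.measurable_comp (by fun_prop) (by fun_prop)
    have h2 : Measurable fun q : (unitInterval × unitInterval) × (unitInterval × unitInterval) =>
        g q.1.1 q.1.2 := g.measurable_comp (by fun_prop) (by fun_prop)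
    refine (h1.sub h2).mul (Measurable.mul ?_ ?_)
    · exact Measurable.ite (measurableSet_lt (by fun_prop) (by fun_prop)) measurable_const
        measurable_const
    · exact Measurable.ite (measurableSet_lt (by fun_prop) (by fun_prop)) measurable_const
        measurable_const
  have hkb : ∀ z w, |k z w| ≤ 1 := by
    intro z w
    have := f.abs_sub_le_one g z.1 z.2
    simp only [hk]
    split_ifs <;> simp [this]
  have hki : Integrable (Function.uncurry k) :=
    Integrable.of_bound hkm.aestronglyMeasurable 1 (Filter.Eventually.of_forall fun q => hkb _ _)
  have h1 : ∀ z : unitInterval × unitInterval,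
      (f z.1 z.2 - g z.1 z.2) * (a z.1 * b z.2) = ∫ w, k z w := by
    intro z
    simp only [hk]
    rw [integral_const_mul]
    congr 1
    have := integral_prod_mul (μ := (volume : Measure unitInterval))
      (ν := (volume : Measure unitInterval))
      (fun s : unitInterval => if (s : ℝ) < a z.1 then (1 : ℝ) else 0)
      (fun s : unitInterval => if (s : ℝ) < b z.2 then (1 : ℝ) else 0)
    rw [integral_indicator_lt _ (ha' _), integral_indicator_lt _ (hb' _)] at this
    exact this.symm
  simp_rw [h1]
  rw [integral_integral_swap hki]
  have h2 : ∀ w : unitInterval × unitInterval, ‖∫ z, k z w‖ ≤ cutDist f g := by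
    intro w
    have hS : MeasurableSet {u : unitInterval | (w.1 : ℝ) < a u} :=
      measurableSet_lt measurable_const ha
    have hT : MeasurableSet {u : unitInterval | (w.2 : ℝ) < b u} :=
      measurableSet_lt measurable_const hb
    have h3 : (fun z => k z w) =
        ({u : unitInterval | (w.1 : ℝ) < a u} ×ˢ {u : unitInterval | (w.2 : ℝ) < b u}).indicator
          (fun z => f z.1 z.2 - g z.1 z.2) := by
      ext z
      by_cases h1 : (w.1 : ℝ) < a z.1 <;> by_cases h2 : (w.2 : ℝ) < b z.2 <;>
        simp [hk, indicator, h1, h2]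
    rw [h3, integral_indicator (hS.prod hT)]
    exact le_cutDist f g hS hT
  have := norm_integral_le_of_norm_le_const (μ := (volume : Measure (unitInterval × unitInterval)))
    (Filter.Eventually.of_forall h2)
  simpa using this

section HomDensity

variable {V : Type*}

/-- The value `f (x_i, x_j)` at an edge `e = {i, j}` (well defined by the symmetry of `f`). -/
def edgeVal (f : Graphon) (x : V → unitInterval) (e : Sym2 V) : ℝ :=
  e.lift ⟨fun i j => f (x i) (x j), fun _ _ => f.symm' _ _⟩

@[simp] theorem edgeVal_mk (f : Graphon) (x : V → unitInterval) (i j : V) :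
    f.edgeVal x s(i, j) = f (x i) (x j) := rfl

theorem edgeVal_mem_Icc (f : Graphon) (x : V → unitInterval) (e : Sym2 V) :
    f.edgeVal x e ∈ Icc (0 : ℝ) 1 := by
  induction e with | _ i j => exact f.mem_Icc' _ _

theorem measurable_edgeVal (f : Graphon) (e : Sym2 V) :
    Measurable fun x : V → unitInterval => f.edgeVal x e := by
  induction e with | _ i j =>
    exact f.measurable_comp (measurable_pi_apply i) (measurable_pi_apply j)

variable [Fintype V] [DecidableEq V]

/-- The homomorphism density `t(H,f) = ∫ ∏_{ij ∈ E(H)} f(x_i, x_j) dx`. -/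
def homDensity (H : SimpleGraph V) [DecidableRel H.Adj] (f : Graphon) : ℝ :=
  ∫ x : V → unitInterval, ∏ e ∈ H.edgeFinset, f.edgeVal x e

theorem homDensity_pullback (H : SimpleGraph V) [DecidableRel H.Adj] (f : Graphon) (φ : MPBij) :
    homDensity H (f.pullback φ) = homDensity H f := by
  have hmp : MeasurePreserving (MeasurableEquiv.piCongrRight fun _ : V => φ.1) volume volume :=
    volume_preserving_pi fun _ => φ.2
  rw [homDensity, homDensity, ← hmp.integral_comp' (fun x => ∏ e ∈ H.edgeFinset, f.edgeVal x e)]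
  refine integral_congr_ae (Filter.Eventually.of_forall fun x => ?_)
  refine Finset.prod_congr rfl fun e _ => ?_
  induction e with | _ i j => rfl

theorem measurePreserving_update (i : V) :
    MeasurePreserving
      (fun q : (V → unitInterval) × unitInterval => Function.update q.1 i q.2) volume volume := by
  have hm : Measurable (fun q : (V → unitInterval) × unitInterval =>
      Function.update q.1 i q.2) := by
    refine measurable_pi_lambda _ fun k => ?_
    by_cases hk : k = i
    · subst hk; simpa using measurable_snd
    · simp only [Function.update_of_ne hk]
      fun_prop
  refine ⟨hm, ?_⟩
  refine Eq.symm (Measure.pi_eq fun S hS => ?_)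
  rw [Measure.map_apply hm (MeasurableSet.univ_pi hS)]
  have hpre : (fun q : (V → unitInterval) × unitInterval => Function.update q.1 i q.2) ⁻¹'
      (univ.pi S) = (univ.pi (Function.update S i univ)) ×ˢ (S i) := by
    ext q
    simp only [mem_preimage, mem_pi, mem_univ, true_imp_iff, mem_prod]
    constructor
    · intro h
      refine ⟨fun k => ?_, by simpa using h i⟩
      by_cases hk : k = i
      · subst hk; simp
      · simpa [Function.update_of_ne hk] using h k
    · rintro ⟨h1, h2⟩ k
      by_cases hk : k = i
      · subst hk; simpa using h2
      · simpa [Function.update_of_ne hk] using h1 k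
  rw [hpre, Measure.volume_eq_prod, Measure.prod_prod, volume_pi, Measure.pi_pi,
    ← Finset.mul_prod_erase Finset.univ _ (Finset.mem_univ i),
    ← Finset.mul_prod_erase Finset.univ (fun k => volume (S k)) (Finset.mem_univ i)]
  simp only [Function.update_self, measure_univ, one_mul]
  rw [mul_comm]
  congr 1
  refine Finset.prod_congr rfl fun k hk => ?_
  rw [Function.update_of_ne (Finset.ne_of_mem_erase hk)]

theorem integral_update (i : V) {F : (V → unitInterval) → ℝ} (hF : Measurable F)
    (hb : ∀ x, |F x| ≤ 1) :
    ∫ x, F x = ∫ x : V → unitInterval, ∫ u : unitInterval, F (Function.update x i u) := by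
  have hmp := measurePreserving_update (V := V) i
  have hi : Integrable (fun q : (V → unitInterval) × unitInterval =>
      F (Function.update q.1 i q.2)) :=
    Integrable.of_bound (hF.comp hmp.measurable).aestronglyMeasurable 1
      (Filter.Eventually.of_forall fun q => hb _)
  have h := integral_prod _ hi
  refine Eq.trans ?_ h
  conv_lhs => rw [← hmp.map_eq]
  exact integral_map hmp.measurable.aemeasurable hF.aestronglyMeasurable

theorem measurable_update_two (i j : V) :
    Measurable fun q : (V → unitInterval) × (unitInterval × unitInterval) =>
      Function.update (Function.update q.1 i q.2.1) j q.2.2 := by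
  refine measurable_pi_lambda _ fun k => ?_
  by_cases hj : k = j
  · subst hj; simp only [Function.update_self]; fun_prop
  · simp only [Function.update_of_ne hj]
    by_cases hk : k = i
    · subst hk; simp only [Function.update_self]; fun_prop
    · simp only [Function.update_of_ne hk]; fun_prop

theorem integral_update_two (i j : V) {F : (V → unitInterval) → ℝ} (hF : Measurable F)
    (hb : ∀ x, |F x| ≤ 1) :
    ∫ x, F x = ∫ x : V → unitInterval, ∫ z : unitInterval × unitInterval,
      F (Function.update (Function.update x i z.1) j z.2) := by
  have hm : ∀ x : V → unitInterval, Measurable fun z : unitInterval × unitInterval =>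
      F (Function.update (Function.update x i z.1) j z.2) := fun x =>
    hF.comp ((measurable_update_two i j).comp (measurable_const.prodMk measurable_id))
  rw [integral_update j hF hb]
  have hm' : Measurable fun x : V → unitInterval => ∫ v, F (Function.update x j v) :=
    ((hF.comp (measurePreserving_update (V := V) j).measurable).stronglyMeasurable.integral_prod_right
      (f := fun x v => F (Function.update x j v))).measurable
  rw [integral_update i hm']
  · refine integral_congr_ae (Filter.Eventually.of_forall fun x => ?_)
    refine (integral_prod _ (Integrable.of_bound (hm x).aestronglyMeasurable 1
      (Filter.Eventually.of_forall fun z => hb _))).symm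
  · intro x
    have := norm_integral_le_of_norm_le_const (μ := (volume : Measure unitInterval))
      (f := fun v => F (Function.update x j v)) (C := 1)
      (Filter.Eventually.of_forall fun v => hb _)
    simpa using this

/-- Once all coordinates other than `i` and `j` are fixed, `F` is a product of a function of the
coordinate `i` and a function of the coordinate `j`, both with values in `[0,1]`. -/
def Splits (i j : V) (F : (V → unitInterval) → ℝ) : Prop :=
  ∀ x : V → unitInterval, ∃ a b : unitInterval → ℝ, Measurable a ∧ Measurable b ∧
    (∀ u, a u ∈ Icc (0 : ℝ) 1) ∧ (∀ u, b u ∈ Icc (0 : ℝ) 1) ∧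
    ∀ u v, F (Function.update (Function.update x i u) j v) = a u * b v

theorem Splits.mul {i j : V} {F G : (V → unitInterval) → ℝ} (hF : Splits i j F)
    (hG : Splits i j G) : Splits i j (fun x => F x * G x) := by
  intro x
  obtain ⟨a, b, ha, hb, ha', hb', h⟩ := hF x
  obtain ⟨c, d, hc, hd, hc', hd', h'⟩ := hG x
  refine ⟨fun u => a u * c u, fun u => b u * d u, ha.mul hc, hb.mul hd,
    fun u => ⟨mul_nonneg (ha' u).1 (hc' u).1, mul_le_one₀ (ha' u).2 (hc' u).1 (hc' u).2⟩,
    fun u => ⟨mul_nonneg (hb' u).1 (hd' u).1, mul_le_one₀ (hb' u).2 (hd' u).1 (hd' u).2⟩,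
    fun u v => ?_⟩
  simp only [h, h']
  ring

theorem splits_edgeVal (f : Graphon) {i j : V} (e : Sym2 V) (he : e ≠ s(i, j))
    (hd : ¬ e.IsDiag) : Splits i j (fun x => f.edgeVal x e) := by
  intro x
  by_cases hj : j ∈ e
  · obtain ⟨k, rfl⟩ := hj
    have hkj : k ≠ j := fun h => hd (by simp [h])
    have hki : k ≠ i := fun h => he (by rw [h]; exact Sym2.eq_swap)
    refine ⟨fun _ => 1, fun v => f v (x k), measurable_const,
      f.measurable_comp measurable_id measurable_const, fun u => by simp,
      fun u => f.mem_Icc' _ _, fun u v => ?_⟩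
    simp [Function.update_of_ne hkj, Function.update_of_ne hki]
  · refine ⟨fun u => f.edgeVal (Function.update x i u) e, fun _ => 1,
      (f.measurable_edgeVal e).comp (measurable_update x), measurable_const,
      fun u => f.edgeVal_mem_Icc _ _, fun u => by simp, fun u v => ?_⟩
    induction e with | _ k l =>
      simp only [Sym2.mem_iff, not_or] at hj
      simp [Function.update_of_ne (Ne.symm hj.1), Function.update_of_ne (Ne.symm hj.2)]

theorem splits_prod (f : Graphon) {i j : V} (E : Finset (Sym2 V))
    (he : s(i, j) ∉ E) (hd : ∀ e ∈ E, ¬ e.IsDiag) :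
    Splits i j (fun x => ∏ e ∈ E, f.edgeVal x e) := by
  induction E using Finset.induction_on with
  | empty =>
    exact fun x => ⟨fun _ => 1, fun _ => 1, measurable_const, measurable_const,
      fun u => by simp, fun u => by simp, fun u v => by simp⟩
  | insert e E heE ih =>
    simp only [Finset.prod_insert heE]
    refine (splits_edgeVal f e (fun h => he (by simp [h])) (hd e (by simp))).mul
      (ih (fun h => he (by simp [h])) fun e' h' => hd e' (by simp [h']))

theorem abs_integral_edge_le (f g : Graphon) {i j : V} (hij : i ≠ j)
    {F : (V → unitInterval) → ℝ} (hF : Measurable F) (hF' : ∀ x, |F x| ≤ 1)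
    (hs : Splits i j F) :
    |∫ x : V → unitInterval, (f (x i) (x j) - g (x i) (x j)) * F x| ≤ cutDist f g := by
  have hm : Measurable fun x : V → unitInterval => (f (x i) (x j) - g (x i) (x j)) * F x :=
    ((f.measurable_comp (measurable_pi_apply i) (measurable_pi_apply j)).sub
      (g.measurable_comp (measurable_pi_apply i) (measurable_pi_apply j))).mul hF
  rw [integral_update_two i j hm fun x => by
    rw [abs_mul]
    exact mul_le_one₀ (f.abs_sub_le_one g _ _) (abs_nonneg _) (hF' x)]
  have key : ∀ x : V → unitInterval, ‖∫ z : unitInterval × unitInterval,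
      (fun x : V → unitInterval => (f (x i) (x j) - g (x i) (x j)) * F x)
        (Function.update (Function.update x i z.1) j z.2)‖ ≤ cutDist f g := by
    intro x
    obtain ⟨a, b, ha, hb, ha', hb', h⟩ := hs x
    simp only [h, Function.update_self, Function.update_of_ne hij]
    exact abs_integral_weighted_le f g ha hb ha' hb'
  have := norm_integral_le_of_norm_le_const (μ := (volume : Measure (V → unitInterval)))
    (Filter.Eventually.of_forall key)
  simpa using this

theorem measurable_prod_edgeVal (f : Graphon) (E : Finset (Sym2 V)) :
    Measurable fun x : V → unitInterval => ∏ e ∈ E, f.edgeVal x e :=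
  Finset.measurable_fun_prod _ fun e _ => f.measurable_edgeVal e

theorem prod_edgeVal_mem_Icc (f : Graphon) (E : Finset (Sym2 V)) (x : V → unitInterval) :
    ∏ e ∈ E, f.edgeVal x e ∈ Icc (0 : ℝ) 1 :=
  ⟨Finset.prod_nonneg fun e _ => (f.edgeVal_mem_Icc x e).1,
    Finset.prod_le_one (fun e _ => (f.edgeVal_mem_Icc x e).1) fun e _ => (f.edgeVal_mem_Icc x e).2⟩

theorem abs_integral_prod_sub_le (f g : Graphon) (E : Finset (Sym2 V)) :
    ∀ E' : Finset (Sym2 V), Disjoint E E' → (∀ e ∈ E, ¬ e.IsDiag) → (∀ e ∈ E', ¬ e.IsDiag) →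
    |∫ x : V → unitInterval, (∏ e ∈ E', g.edgeVal x e) *
      (∏ e ∈ E, f.edgeVal x e - ∏ e ∈ E, g.edgeVal x e)| ≤ E.card * cutDist f g := by
  have hint : ∀ (F : (V → unitInterval) → ℝ), Measurable F → (∀ x, |F x| ≤ 1) →
      Integrable F := fun F h h' =>
    Integrable.of_bound h.aestronglyMeasurable 1 (Filter.Eventually.of_forall h')
  induction E using Finset.induction_on with
  | empty => intro E' _ _ _; simp
  | insert e E he ih =>
    intro E' hdisj hE hE'
    rw [Finset.disjoint_insert_left] at hdisj
    have h1 := ih (insert e E')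
      (Finset.disjoint_insert_right.2 ⟨he, hdisj.2⟩) (fun e' h => hE e' (by simp [h]))
      (fun e' h => by
        rcases Finset.mem_insert.1 h with rfl | h
        · exact hE _ (by simp)
        · exact hE' _ h)
    have hed : ¬ e.IsDiag := hE e (by simp)
    have h2 : |∫ x : V → unitInterval, (f.edgeVal x e - g.edgeVal x e) *
        ((∏ e ∈ E', g.edgeVal x e) * ∏ e ∈ E, f.edgeVal x e)| ≤ cutDist f g := by
      induction e with | _ i j =>
        have hij : i ≠ j := by simpa using hed
        refine abs_integral_edge_le f g hij
          ((g.measurable_prod_edgeVal E').mul (f.measurable_prod_edgeVal E)) (fun x => ?_)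
          ((splits_prod g E' hdisj.1 hE').mul
            (splits_prod f E he fun e' h => hE e' (by simp [h])))
        have p := g.prod_edgeVal_mem_Icc E' x
        have q := f.prod_edgeVal_mem_Icc E x
        rw [abs_of_nonneg (mul_nonneg p.1 q.1)]
        exact mul_le_one₀ p.2 q.1 q.2
    have hsplit : ∀ x : V → unitInterval, (∏ e ∈ E', g.edgeVal x e) *
        (∏ e ∈ insert e E, f.edgeVal x e - ∏ e ∈ insert e E, g.edgeVal x e) =
        (f.edgeVal x e - g.edgeVal x e) *
          ((∏ e ∈ E', g.edgeVal x e) * ∏ e ∈ E, f.edgeVal x e) +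
        (∏ e ∈ insert e E', g.edgeVal x e) *
          (∏ e ∈ E, f.edgeVal x e - ∏ e ∈ E, g.edgeVal x e) := by
      intro x
      rw [Finset.prod_insert he, Finset.prod_insert he, Finset.prod_insert hdisj.1]
      ring
    simp_rw [hsplit]
    rw [integral_add, Finset.card_insert_of_notMem he]
    · refine (abs_add_le _ _).trans ?_
      push_cast
      linarith
    · refine hint _ (((f.measurable_edgeVal e).sub (g.measurable_edgeVal e)).mul
        ((g.measurable_prod_edgeVal E').mul (f.measurable_prod_edgeVal E))) fun x => ?_
      have p := g.prod_edgeVal_mem_Icc E' x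
      have q := f.prod_edgeVal_mem_Icc E x
      have r := f.edgeVal_mem_Icc x e
      have s := g.edgeVal_mem_Icc x e
      rw [abs_mul, abs_of_nonneg (mul_nonneg p.1 q.1)]
      refine mul_le_one₀ ?_ (mul_nonneg p.1 q.1) (mul_le_one₀ p.2 q.1 q.2)
      rw [abs_le]; constructor <;> linarith [r.1, r.2, s.1, s.2]
    · refine hint _ ((g.measurable_prod_edgeVal _).mul
        ((f.measurable_prod_edgeVal E).sub (g.measurable_prod_edgeVal E))) fun x => ?_
      have p := g.prod_edgeVal_mem_Icc (insert e E') x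
      have r := f.prod_edgeVal_mem_Icc E x
      have s := g.prod_edgeVal_mem_Icc E x
      rw [abs_mul, abs_of_nonneg p.1]
      refine mul_le_one₀ p.2 (abs_nonneg _) ?_
      rw [abs_le]; constructor <;> linarith [r.1, r.2, s.1, s.2]

theorem abs_homDensity_sub_le_cutDist (H : SimpleGraph V) [DecidableRel H.Adj] (f g : Graphon) :
    |homDensity H f - homDensity H g| ≤ H.edgeFinset.card * cutDist f g := by
  have h := abs_integral_prod_sub_le f g H.edgeFinset ∅ (Finset.disjoint_empty_right _)
    (fun e he => H.not_isDiag_of_mem_edgeFinset he) (by simp)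
  have hint : ∀ f : Graphon, Integrable fun x : V → unitInterval =>
      ∏ e ∈ H.edgeFinset, f.edgeVal x e := fun f =>
    Integrable.of_bound (f.measurable_prod_edgeVal _).aestronglyMeasurable 1
      (Filter.Eventually.of_forall fun x => by
        have := f.prod_edgeVal_mem_Icc H.edgeFinset x
        rw [Real.norm_eq_abs, abs_of_nonneg this.1]
        exact this.2)
  simp only [Finset.prod_empty, one_mul] at h
  rw [integral_sub (hint f) (hint g)] at h
  exact h

/-- The homomorphism density is Lipschitz for the cut metric. -/
theorem abs_homDensity_sub_le (H : SimpleGraph V) [DecidableRel H.Adj] (f g : Graphon) :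
    |homDensity H f - homDensity H g| ≤ H.edgeFinset.card * dist f g := by
  rw [dist_eq, cutMetric, Real.mul_iInf_of_nonneg (Nat.cast_nonneg _)]
  refine le_ciInf fun φ => ?_
  rw [← homDensity_pullback H g φ]
  exact abs_homDensity_sub_le_cutDist H f _

end HomDensity

/-- The binary relative entropy `u log (u/p) + (1-u) log ((1-u)/(1-p))`; Lean's conventions
`log 0 = 0` and `x / 0 = 0` give `0 log 0 = 0` and `0 log (0/0) = 0`. This is `h_p(u)` whenever
that is finite. -/
def binRelEntropy (p u : ℝ) : ℝ :=
  u * Real.log (u / p) + (1 - u) * Real.log ((1 - u) / (1 - p))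

theorem binRelEntropy_nonneg {p u : ℝ} (hp : p ∈ Icc (0 : ℝ) 1) (hu : u ∈ Icc (0 : ℝ) 1)
    (h0 : p = 0 → u = 0) (h1 : p = 1 → u = 1) : 0 ≤ binRelEntropy p u := by
  have key : ∀ a b : ℝ, 0 ≤ a → 0 ≤ b → (b = 0 → a = 0) → a - b ≤ a * Real.log (a / b) := by
    intro a b ha hb hab
    rcases ha.eq_or_lt with rfl | ha'
    · simpa using hb
    · have hb' : 0 < b := lt_of_le_of_ne hb fun h => ha'.ne' (hab h.symm)
      have := mul_le_mul_of_nonneg_left (Real.one_sub_inv_le_log_of_pos (div_pos ha' hb')) ha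
      rwa [inv_div, mul_sub, mul_one, mul_div_cancel₀ _ ha'.ne'] at this
  have i := key u p hu.1 hp.1 h0
  have j := key (1 - u) (1 - p) (by linarith [hu.2]) (by linarith [hp.2])
    fun h => by rw [h1 (by linarith)]; ring
  unfold binRelEntropy
  linarith

/-- The relative entropy `h_p(u) ∈ [0,∞]` for `p, u ∈ [0,1]`, which is infinite exactly if
`p = 0 ≠ u` or `p = 1 ≠ u`. -/
def relEntropy (p u : ℝ) : ℝ≥0∞ :=
  if (p = 0 ∧ u ≠ 0) ∨ (p = 1 ∧ u ≠ 1) then ∞ else ENNReal.ofReal (binRelEntropy p u)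

/-- The functional `I_{W₀}(f) = ½ ∫ h_{W₀(x,y)}(f(x,y)) dx dy`. -/
def relEntropyFunctional (W₀ f : Graphon) : ℝ≥0∞ :=
  (1 / 2) * ∫⁻ z : unitInterval × unitInterval, relEntropy (W₀ z.1 z.2) (f z.1 z.2)

/-- `Ω = {(x,y) : W₀(x,y) ∈ (0,1)}`. -/
def randomRegion (W₀ : Graphon) : Set (unitInterval × unitInterval) :=
  {z | W₀ z.1 z.2 ∈ Ioo (0 : ℝ) 1}

/-- `𝒲_Ω`: the graphons that agree with `W₀` almost everywhere outside `Ω`. -/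
def supportedGraphons (W₀ : Graphon) : Set Graphon :=
  {f | volume {z : unitInterval × unitInterval |
    z ∈ (randomRegion W₀)ᶜ ∧ f z.1 z.2 ≠ W₀ z.1 z.2} = 0}

/-- For `γ : Fin m → ℝ`, the `j`-th block `(∑_{i<j} γ_i, ∑_{i≤j} γ_i]` of `[0,1]`; the first block
also contains `0`. -/
def blockInterval {m : ℕ} (γ : Fin m → ℝ) (j : Fin m) : Set unitInterval :=
  {x | ((j : ℕ) = 0 ∨ ∑ i ∈ Finset.Iio j, γ i < (x : ℝ)) ∧ (x : ℝ) ≤ ∑ i ∈ Finset.Iic j, γ i}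

/-- `ℬ^γ`: the block graphons `f(x,y) = P_{k(x),k(y)}`, with `k(x)` the index of the block of
`x` and `P` a symmetric matrix with entries in `[0,1]`. -/
def blockGraphons {m : ℕ} (γ : Fin m → ℝ) : Set Graphon :=
  {f | ∃ P : Fin m → Fin m → ℝ, (∀ i j, P i j = P j i) ∧ (∀ i j, P i j ∈ Icc (0 : ℝ) 1) ∧
    ∀ i j, ∀ x ∈ blockInterval γ i, ∀ y ∈ blockInterval γ j, f x y = P i j}

/-- The bipartite graphon `f_r^γ`, equal to `0` on `[0,γ]² ∪ (γ,1]²` and to `r` elsewhere. -/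
def bipartiteGraphon (γ r : ℝ) (hr : r ∈ Icc (0 : ℝ) 1) : Graphon where
  toFun x y := if ((x : ℝ) ≤ γ ↔ (y : ℝ) ≤ γ) then 0 else r
  symm' x y := by simp only [iff_comm]
  mem_Icc' x y := by
    split_ifs
    · simp
    · exact hr
  measurable' := by
    refine Measurable.ite ?_ measurable_const measurable_const
    have h1 : MeasurableSet {z : unitInterval × unitInterval | (z.1 : ℝ) ≤ γ} :=
      measurableSet_le (by fun_prop) measurable_const
    have h2 : MeasurableSet {z : unitInterval × unitInterval | (z.2 : ℝ) ≤ γ} :=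
      measurableSet_le (by fun_prop) measurable_const
    exact h1.iff h2

end Graphon

/-- The space `𝒲̃` of graphons modulo cut metric zero, a metric space for `δ_□`. -/
abbrev GraphonSpace : Type := SeparationQuotient Graphon

namespace GraphonSpace

/-- The class `f̃` of a graphon. -/
abbrev mk (f : Graphon) : GraphonSpace := SeparationQuotient.mk f

theorem mk_eq_mk_iff (f g : Graphon) : mk f = mk g ↔ Graphon.cutMetric f g = 0 := by
  rw [SeparationQuotient.mk_eq_mk, Metric.inseparable_iff, Graphon.dist_eq]

/-- The homomorphism density `t(H, ·)` on `𝒲̃`. -/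
def homDensity {V : Type*} [Fintype V] [DecidableEq V] (H : SimpleGraph V) [DecidableRel H.Adj] :
    GraphonSpace → ℝ :=
  SeparationQuotient.lift (Graphon.homDensity H) fun f g hfg => by
    have h := Graphon.abs_homDensity_sub_le H f g
    rw [Metric.inseparable_iff.1 hfg, mul_zero] at h
    exact sub_eq_zero.1 (abs_eq_zero.1 (le_antisymm h (abs_nonneg _)))

/-- The set of classes `F` with `δ_□(F, g) = 0` for some `g ∈ A`; this turns `𝒲_Ω` into `𝒲̃_Ω` and
`ℬ^γ` into `ℬ̃^γ`. -/
def classesOf (A : Set Graphon) : Set GraphonSpace := {F | ∃ g ∈ A, dist F (mk g) = 0}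

open Classical in
/-- The rate function `J_{W₀}`: `sup_{η>0} inf {I_{W₀}(h) : δ_□(F,h) ≤ η}` on `𝒲̃_Ω`, and `∞`
elsewhere. -/
def rateFunction (W₀ : Graphon) (F : GraphonSpace) : ℝ≥0∞ :=
  if F ∈ classesOf (Graphon.supportedGraphons W₀) then
    ⨆ η : {η : ℝ // 0 < η}, ⨅ h : {h : Graphon // dist F (mk h) ≤ η},
      Graphon.relEntropyFunctional W₀ h
  else ∞

/-- `G` attains `min {J_{W₀}(F) : τ(F) ≥ t}`. -/
def IsMinimizer (W₀ : Graphon) (τ : GraphonSpace → ℝ) (t : ℝ) (G : GraphonSpace) : Prop :=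
  t ≤ τ G ∧ ∀ F : GraphonSpace, t ≤ τ F → rateFunction W₀ G ≤ rateFunction W₀ F

/-- `t` is in the symmetric regime for `W₀ ∈ ℬ^γ` and `τ`: every minimizer lies in `ℬ̃^γ`. -/
def InSymmetricRegime {m : ℕ} (γ : Fin m → ℝ) (W₀ : Graphon) (τ : GraphonSpace → ℝ) (t : ℝ) :
    Prop :=
  ∀ G : GraphonSpace, IsMinimizer W₀ τ t G → G ∈ classesOf (Graphon.blockGraphons γ)

end GraphonSpace

/-- The convex minorant of `ψ` on `s`: the pointwise supremum of the convex functions on `s` that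
lie below `ψ`. -/
def convexMinorant (s : Set ℝ) (ψ : ℝ → ℝ) (x : ℝ) : ℝ :=
  sSup {c : ℝ | ∃ g : ℝ → ℝ, ConvexOn ℝ s g ∧ (∀ z ∈ s, g z ≤ ψ z) ∧ c = g x}

/-- The point `(x, y)` lies on (the graph over `[0,1]` of) the convex minorant of `ψ`, a function
on `[0,1]`. -/
def OnConvexMinorant (ψ : ℝ → ℝ) (x y : ℝ) : Prop :=
  x ∈ Icc (0 : ℝ) 1 ∧ y = convexMinorant (Icc 0 1) ψ x

end

noncomputable section

open scoped Topology

/-! ### Entropy, support lines and the convex minorant -/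

namespace Graphon

/-! A graphon with finite `I_{W₀}` vanishes almost everywhere on the diagonal blocks, so everything
happens among split graphons. For split `f` only two numbers matter: the entropy `E(f) = ∫ h_p(f)`
and the moment `M(f) = ∫ f^d`, both over `[0,γ] × (γ,1]`; the factor `½` in `I_{W₀}` cancels against
the mirror block, so that `I_{W₀}(f) = E(f)`. Let `w = γ(1-γ)` be the area of the block.

The density of a split graphon is a sum over the proper 2-colourings of `H`, the colour of a vertex
being the side on which it is placed. In each term, Hölder's inequality is applied to each vertex of
one colour class, which has `d` neighbours. Since each vertex of the other class occurs in `d` such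
products, the roots recombine, and the term is at most `M(f)^(|V|/2)` (`homDensity_le`). Equality
holds if `f` on the block depends on one coordinate only (`homDensity_eq_of_rows`), in particular
for `f_r`. Hence density at least that of `f_r` forces `M(f) ≥ w r^d`.

If `(r^d, h_p(r))` is on the convex minorant and `r < 1`, there is a support line `h_p(u) ≥ h_p(r) +
s(u^d - r^d)` with `s ≥ 0`; integrating it gives `E(f) ≥ w h_p(r)`. For uniqueness, the line touches
in at most two points (`binRelEntropy_sub_min_card_le_two`), and a multiple of `u^d - r^d`
compensates for the second one; this yields a pointwise bound on `|u - r|` that integrates to an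
`L¹` bound (`exists_entropy_stability`). At `r = 1` compactness replaces the support line. Because
`J` is defined through infima over small balls, both arguments are run with an error `ε` on nearby
split graphons (`le_rateFunction`, `eq_mk_of_rateFunction_le`).

If the point is off the convex minorant, some chord passes strictly below it. A split graphon whose
rows take the two values given by the ends of the chord, in the right proportion, has the moment and
hence the density of `f_r`, but smaller entropy (`exists_isSplit_offEntropy_lt`). A minimizer exists
(`exists_isMinimizer`). Were it a block graphon, it would be some `f_b`
(`exists_eq_mk_bipartiteGraphon`) with `b ≥ r`, because of its density. Its rate is at least `w
h_p(b) ≥ w h_p(r)`, by the first case for `H = K₂` (`le_rateFunction_bipartiteGraphon`): a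
contradiction.

Existence of the minimizer rests on compactness of `𝒲̃_Ω`. This is proved in a finer metric, which
admits only rearrangements preserving `[0,γ]`, so that vanishing on the diagonal blocks is a closed
condition. Total boundedness follows from weak regularity (`exists_rectSum_cutBound`) and
rearrangement of finite labellings (`exists_rearrangement`), completeness from weak `L²` limits
(`exists_weak_limit`). -/

theorem binRelEntropy_eq {p : ℝ} (hp : p ∈ Ioo (0 : ℝ) 1) (u : ℝ) :
    binRelEntropy p u = -Real.binEntropy u - u * Real.log p - (1 - u) * Real.log (1 - p) := by
  have h1 : u * Real.log (u / p) = u * Real.log u - u * Real.log p := by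
    rcases eq_or_ne u 0 with rfl | hu
    · simp
    · rw [Real.log_div hu hp.1.ne']; ring
  have h2 : (1 - u) * Real.log ((1 - u) / (1 - p)) =
      (1 - u) * Real.log (1 - u) - (1 - u) * Real.log (1 - p) := by
    rcases eq_or_ne (1 - u) 0 with hu | hu
    · simp [hu]
    · rw [Real.log_div hu (by linarith [hp.2])]; ring
  rw [binRelEntropy, h1, h2, Real.binEntropy, Real.log_inv, Real.log_inv]
  ring

theorem continuous_binRelEntropy {p : ℝ} (hp : p ∈ Ioo (0 : ℝ) 1) :
    Continuous (binRelEntropy p) := by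
  rw [funext (binRelEntropy_eq hp)]
  fun_prop

theorem hasDerivAt_binRelEntropy {p u : ℝ} (hp : p ∈ Ioo (0 : ℝ) 1) (hu : u ∈ Ioo (0 : ℝ) 1) :
    HasDerivAt (binRelEntropy p)
      (Real.log u - Real.log (1 - u) - Real.log p + Real.log (1 - p)) u := by
  rw [funext (binRelEntropy_eq hp)]
  have h := Real.hasDerivAt_binEntropy hu.1.ne' hu.2.ne
  have h2 := ((h.neg.sub ((hasDerivAt_id u).mul_const (Real.log p))).sub
    (((hasDerivAt_const u (1 : ℝ)).sub (hasDerivAt_id u)).mul_const (Real.log (1 - p))))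
  refine (h2.congr_deriv ?_).congr_of_eventuallyEq (Filter.Eventually.of_forall fun x => ?_)
  · ring
  · simp

theorem strictConvexOn_binRelEntropy {p : ℝ} (hp : p ∈ Ioo (0 : ℝ) 1) :
    StrictConvexOn ℝ (Icc 0 1) (binRelEntropy p) := by
  refine ⟨convex_Icc 0 1, fun x hx y hy hxy a b ha hb hab => ?_⟩
  have h := Real.strictConcave_binEntropy.2 hx hy hxy ha hb hab
  simp only [binRelEntropy_eq hp, smul_eq_mul] at h ⊢
  have : b = 1 - a := by linarith
  subst this
  nlinarith

theorem binRelEntropy_nonneg_of_mem {p u : ℝ} (hp : p ∈ Ioo (0 : ℝ) 1) (hu : u ∈ Icc (0 : ℝ) 1) :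
    0 ≤ binRelEntropy p u :=
  binRelEntropy_nonneg ⟨hp.1.le, hp.2.le⟩ hu (fun h => absurd h hp.1.ne')
    (fun h => absurd h hp.2.ne)

theorem binRelEntropy_self {p : ℝ} (hp : p ∈ Ioo (0 : ℝ) 1) : binRelEntropy p p = 0 := by
  have : 1 - p ≠ 0 := by linarith [hp.2]
  simp [binRelEntropy, hp.1.ne', this]

/-- With a second zero besides `p`, strict convexity would make the value at the midpoint negative.
-/
theorem eq_of_binRelEntropy_eq_zero {p u : ℝ} (hp : p ∈ Ioo (0 : ℝ) 1) (hu : u ∈ Icc (0 : ℝ) 1)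
    (h : binRelEntropy p u = 0) : u = p := by
  by_contra hne
  have := (strictConvexOn_binRelEntropy hp).2 hu ⟨hp.1.le, hp.2.le⟩ hne
    (show (0 : ℝ) < 1 / 2 by norm_num) (show (0 : ℝ) < 1 / 2 by norm_num) (by norm_num)
  rw [h, binRelEntropy_self hp] at this
  simp only [smul_eq_mul] at this
  have h2 := binRelEntropy_nonneg_of_mem (p := p) (u := 1 / 2 * u + 1 / 2 * p) hp
    ⟨by linarith [hu.1, hp.1], by linarith [hu.2, hp.2]⟩
  linarith

/-- The slope of the chord from the zero at `p` is nonnegative, and slopes of a convex function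
increase. -/
theorem monotoneOn_binRelEntropy {p : ℝ} (hp : p ∈ Ioo (0 : ℝ) 1) :
    MonotoneOn (binRelEntropy p) (Icc p 1) := by
  intro x hx y hy hxy
  rcases hx.1.eq_or_lt with rfl | hpx
  · rw [binRelEntropy_self hp]
    exact binRelEntropy_nonneg_of_mem hp ⟨hp.1.le.trans hy.1, hy.2⟩
  rcases hxy.eq_or_lt with rfl | hxy
  · rfl
  have hc := (strictConvexOn_binRelEntropy hp).convexOn.slope_mono_adjacent
    (x := p) (y := x) (z := y) ⟨hp.1.le, hp.2.le⟩ ⟨hp.1.le.trans hy.1, hy.2⟩ hpx hxy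
  rw [binRelEntropy_self hp, sub_zero] at hc
  have h1 : 0 ≤ binRelEntropy p x / (x - p) :=
    div_nonneg (binRelEntropy_nonneg_of_mem hp ⟨hp.1.le.trans hx.1, hx.2⟩) (by linarith)
  have h2 := h1.trans hc
  rw [le_div_iff₀ (by linarith)] at h2
  linarith

end Graphon

/-- On a compact set, `E` is at most `ε + C D` if it is nonpositive where `D ≥ 0` vanishes. -/
theorem IsCompact.exists_le_add_mul {α : Type*} [TopologicalSpace α] {K : Set α}
    (hK : IsCompact K) {D E : α → ℝ} (hD : ContinuousOn D K) (hE : ContinuousOn E K)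
    (hD0 : ∀ u ∈ K, 0 ≤ D u) (h : ∀ u ∈ K, D u = 0 → E u ≤ 0) {ε : ℝ} (hε : 0 < ε) :
    ∃ C : ℝ, 0 ≤ C ∧ ∀ C' ≥ C, ∀ u ∈ K, E u ≤ ε + C' * D u := by
  have hL : IsCompact (K ∩ E ⁻¹' Ici ε) := by
    obtain ⟨t, ht, ht'⟩ := (continuousOn_iff_isClosed.1 hE) _ (isClosed_Ici (a := ε))
    rw [inter_comm, ht']
    rw [inter_comm]
    exact hK.inter_right ht
  rcases (K ∩ E ⁻¹' Ici ε).eq_empty_or_nonempty with he | hne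
  · refine ⟨0, le_rfl, fun C' hC' u hu => ?_⟩
    have : ¬ ε ≤ E u := fun hh => by
      have : u ∈ K ∩ E ⁻¹' Ici ε := ⟨hu, hh⟩
      rw [he] at this; exact this
    nlinarith [hD0 u hu, mul_nonneg hC' (hD0 u hu)]
  obtain ⟨a, ha, hamin⟩ := hL.exists_isMinOn hne (hD.mono inter_subset_left)
  obtain ⟨b, hb, hbmax⟩ := hL.exists_isMaxOn hne (hE.mono inter_subset_left)
  have hDa : 0 < D a := (hD0 a ha.1).lt_of_ne fun h0 => by
    have := h a ha.1 h0.symm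
    have h2 : ε ≤ E a := ha.2
    linarith
  have hEb : 0 < E b := hε.trans_le hb.2
  -- The maximum of `E` over the minimum of `D`, both on the compact set where `E ≥ ε`; there `D` is
  -- positive by hypothesis.
  refine ⟨E b / D a, by positivity, fun C' hC' u hu => ?_⟩
  have hC0 : 0 ≤ C' := (by positivity : 0 ≤ E b / D a).trans hC'
  by_cases hu' : ε ≤ E u
  · have h1 : E u ≤ E b := hbmax ⟨hu, hu'⟩
    have h2 : D a ≤ D u := hamin ⟨hu, hu'⟩
    have h3 : E b ≤ C' * D a := by rwa [ge_iff_le, div_le_iff₀ hDa] at hC'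
    nlinarith [mul_le_mul_of_nonneg_left h2 hC0]
  · nlinarith [mul_nonneg hC0 (hD0 u hu)]

/-- A point of `(0,1)` at which no chord of `ψ` lies strictly below the graph has a support line. -/
theorem exists_support_line {ψ : ℝ → ℝ} {x₀ : ℝ} (hx₀ : x₀ ∈ Ioo (0 : ℝ) 1)
    (h : ∀ x ∈ Icc (0 : ℝ) 1, ∀ y ∈ Icc (0 : ℝ) 1, x < x₀ → x₀ < y →
      (y - x) * ψ x₀ ≤ (y - x₀) * ψ x + (x₀ - x) * ψ y) :
    ∃ s : ℝ, ∀ x ∈ Icc (0 : ℝ) 1, ψ x₀ + s * (x - x₀) ≤ ψ x := by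
  -- The slopes of the chords to the left of `x₀`. By `h` each slope to the right is an upper bound,
  -- so their supremum is the slope of a support line.
  set A : Set ℝ := (fun x => (ψ x₀ - ψ x) / (x₀ - x)) '' (Ico 0 x₀) with hA
  have hAne : A.Nonempty := ⟨_, 0, ⟨le_rfl, hx₀.1⟩, rfl⟩
  have hub : ∀ y ∈ Ioc x₀ 1, (ψ y - ψ x₀) / (y - x₀) ∈ upperBounds A := by
    rintro y hy _ ⟨x, hx, rfl⟩
    have := h x ⟨hx.1, by linarith [hx.2, hx₀.2]⟩ y ⟨by linarith [hy.1, hx₀.1], hy.2⟩ hx.2 hy.1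
    simp only
    rw [div_le_div_iff₀ (by linarith [hx.2]) (by linarith [hy.1])]
    nlinarith
  refine ⟨sSup A, fun x hx => ?_⟩
  rcases lt_trichotomy x x₀ with hlt | rfl | hgt
  · have := le_csSup ⟨_, hub 1 ⟨hx₀.2, le_rfl⟩⟩ (show (ψ x₀ - ψ x) / (x₀ - x) ∈ A from
      ⟨x, ⟨hx.1, hlt⟩, rfl⟩)
    rw [div_le_iff₀ (by linarith)] at this
    linarith
  · simp
  · have := csSup_le hAne (hub x ⟨hgt, hx.2⟩)
    rw [le_div_iff₀ (by linarith)] at this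
    linarith

/-- Each convex function below `ψ` lies below the chords of `ψ`, hence so does the supremum.
Nonnegativity of `ψ` makes the zero function a competitor, so the supremum is over a nonempty set.
-/
theorem OnConvexMinorant.chord_le {ψ : ℝ → ℝ} {x₀ : ℝ} (hψ : ∀ x ∈ Icc (0 : ℝ) 1, 0 ≤ ψ x)
    (h : OnConvexMinorant ψ x₀ (ψ x₀)) :
    ∀ x ∈ Icc (0 : ℝ) 1, ∀ y ∈ Icc (0 : ℝ) 1, x < x₀ → x₀ < y →
      (y - x) * ψ x₀ ≤ (y - x₀) * ψ x + (x₀ - x) * ψ y := by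
  intro x hx y hy hxx hxy
  have hpos : 0 < y - x := by linarith
  rw [mul_comm, ← le_div_iff₀ hpos]
  conv_lhs => rw [h.2]
  refine csSup_le ⟨0, 0, convexOn_const 0 (convex_Icc 0 1), hψ, rfl⟩ ?_
  rintro _ ⟨g, hg, hgψ, rfl⟩
  rw [le_div_iff₀ hpos]
  have := hg.2 hx hy (div_nonneg (by linarith : 0 ≤ y - x₀) hpos.le)
    (div_nonneg (by linarith : 0 ≤ x₀ - x) hpos.le)
    (by rw [← add_div, div_eq_one_iff_eq hpos.ne']; ring)
  simp only [smul_eq_mul] at this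
  have e : (y - x₀) / (y - x) * x + (x₀ - x) / (y - x) * y = x₀ := by
    field_simp; ring
  rw [e] at this
  have h2 : g x₀ * (y - x) ≤ (y - x₀) * g x + (x₀ - x) * g y := by
    refine (mul_le_mul_of_nonneg_right this hpos.le).trans (le_of_eq ?_)
    field_simp
  nlinarith [mul_le_mul_of_nonneg_left (hgψ x hx) (by linarith : 0 ≤ y - x₀),
    mul_le_mul_of_nonneg_left (hgψ y hy) (by linarith : 0 ≤ x₀ - x)]

theorem onConvexMinorant_of_convexOn {ψ g : ℝ → ℝ} {x₀ : ℝ} (hx₀ : x₀ ∈ Icc (0 : ℝ) 1)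
    (hg : ConvexOn ℝ (Icc 0 1) g) (hgψ : ∀ x ∈ Icc (0 : ℝ) 1, g x ≤ ψ x) (hg₀ : g x₀ = ψ x₀) :
    OnConvexMinorant ψ x₀ (ψ x₀) := by
  refine ⟨hx₀, le_antisymm (le_csSup ⟨ψ x₀, ?_⟩ ⟨g, hg, hgψ, hg₀.symm⟩)
    (csSup_le ⟨_, g, hg, hgψ, rfl⟩ ?_)⟩
  all_goals
    rintro _ ⟨k, -, hk, rfl⟩
    exact hk _ hx₀

/-- A convex function may jump up at an end point: take `ψ 1` at `1` and `0` elsewhere. -/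
theorem onConvexMinorant_one {ψ : ℝ → ℝ} (hψ : ∀ x ∈ Icc (0 : ℝ) 1, 0 ≤ ψ x) :
    OnConvexMinorant ψ 1 (ψ 1) := by
  have h1 : 0 ≤ ψ 1 := hψ 1 ⟨zero_le_one, le_rfl⟩
  refine onConvexMinorant_of_convexOn (g := fun x => if x = 1 then ψ 1 else 0)
    ⟨zero_le_one, le_rfl⟩ ⟨convex_Icc 0 1, ?_⟩ ?_ (by simp)
  · intro x hx y hy a b ha hb hab
    simp only [smul_eq_mul]
    split_ifs with h2 h3 h4 h5
    · nlinarith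
    · have : b = 0 := by
        by_contra hb0
        have := lt_of_le_of_ne hy.2 h4
        have := lt_of_le_of_ne hb (Ne.symm hb0)
        nlinarith
      have : a = 1 := by linarith
      subst this; linarith [mul_nonneg hb le_rfl]
    · have : a = 0 := by
        by_contra ha0
        have := lt_of_le_of_ne hx.2 h3
        have := lt_of_le_of_ne ha (Ne.symm ha0)
        nlinarith [hy.2]
      have : b = 1 := by linarith
      subst this; linarith
    · exfalso
      have := lt_of_le_of_ne hx.2 h3
      have := lt_of_le_of_ne hy.2 h5
      rcases ha.eq_or_lt with rfl | ha
      · nlinarith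
      · nlinarith
    all_goals positivity
  · intro x hx
    split_ifs with h
    · rw [h]
    · exact hψ x hx

/-- Otherwise an interior `x₀` has a support line, an affine function touching `ψ` from below, and
`x₀ = 1` is on the convex minorant in any case. -/
theorem exists_chord_lt {ψ : ℝ → ℝ} {x₀ : ℝ} (hψ : ∀ x ∈ Icc (0 : ℝ) 1, 0 ≤ ψ x)
    (hx₀ : x₀ ∈ Ioc (0 : ℝ) 1) (h : ¬ OnConvexMinorant ψ x₀ (ψ x₀)) :
    ∃ x ∈ Icc (0 : ℝ) 1, ∃ y ∈ Icc (0 : ℝ) 1, x < x₀ ∧ x₀ < y ∧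
      (y - x₀) * ψ x + (x₀ - x) * ψ y < (y - x) * ψ x₀ := by
  by_contra! hcon
  rcases hx₀.2.eq_or_lt with rfl | hlt
  · exact h (onConvexMinorant_one hψ)
  obtain ⟨s, hs⟩ := exists_support_line ⟨hx₀.1, hlt⟩ hcon
  refine h (onConvexMinorant_of_convexOn (g := fun x => ψ x₀ + s * (x - x₀)) ⟨hx₀.1.le, hx₀.2⟩
    ⟨convex_Icc 0 1, fun x _ y _ a b _ _ hab => le_of_eq ?_⟩ hs (by simp))
  have : b = 1 - a := by linarith
  subst this
  simp only [smul_eq_mul]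
  ring

/-! ### The contact points of a support line -/

/-- Strict log-concavity of `u ↦ uⁿ (1 - u)` on `(0,1)`, between two points of equal value. -/
theorem pow_mul_one_sub_lt {n : ℕ} {a b v : ℝ} (ha : 0 < a) (hb : b < 1) (hav : a < v) (hvb : v < b)
    (hab : a ^ n * (1 - a) = b ^ n * (1 - b)) : a ^ n * (1 - a) < v ^ n * (1 - v) := by
  have hlog : ∀ x : ℝ, 0 < x → x < 1 →
      Real.log (x ^ n * (1 - x)) = n * Real.log x + Real.log (1 - x) := fun x h0 h1 => by
    rw [Real.log_mul (by positivity) (by linarith), Real.log_pow]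
  have hv0 : 0 < v := ha.trans hav
  have hv1 : v < 1 := hvb.trans hb
  have h1a : 0 < 1 - a := by linarith
  have h1v : 0 < 1 - v := by linarith
  rw [← Real.log_lt_log_iff (by positivity) (by positivity)]
  have e := congrArg Real.log hab
  rw [hlog a ha (by linarith), hlog b (by linarith) hb] at e
  rw [hlog a ha (by linarith), hlog v hv0 hv1]
  have hpos : 0 < b - a := by linarith
  have hl : 0 < (b - v) / (b - a) := div_pos (by linarith) hpos
  have hm : 0 < (v - a) / (b - a) := div_pos (by linarith) hpos
  have hlm : (b - v) / (b - a) + (v - a) / (b - a) = 1 := by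
    rw [← add_div, div_eq_one_iff_eq hpos.ne']; ring
  have k1 := strictConcaveOn_log_Ioi.2 (show a ∈ Ioi 0 from ha)
    (show b ∈ Ioi 0 from by simp only [mem_Ioi]; linarith) (by linarith) hl hm hlm
  have k2 := strictConcaveOn_log_Ioi.2 (show 1 - a ∈ Ioi 0 from h1a)
    (show 1 - b ∈ Ioi 0 from by simp only [mem_Ioi]; linarith) (by linarith) hl hm hlm
  simp only [smul_eq_mul] at k1 k2
  have e1 : (b - v) / (b - a) * a + (v - a) / (b - a) * b = v := by field_simp; ring
  have e2 : (b - v) / (b - a) * (1 - a) + (v - a) / (b - a) * (1 - b) = 1 - v := by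
    field_simp; ring
  rw [e1] at k1
  rw [e2] at k2
  set l := (b - v) / (b - a)
  set m := (v - a) / (b - a)
  have hm' : m = 1 - l := by linarith
  rw [hm'] at k1 k2
  -- Strictness is taken from `log (1 - v)` alone, so `n = 0` is covered.
  have k3 := mul_le_mul_of_nonneg_left k1.le (Nat.cast_nonneg (α := ℝ) n)
  nlinarith

namespace Graphon

/-- The function `h_p(u) - s u^d` attains its minimum over `[0,1]` in at most two points. -/
theorem binRelEntropy_sub_min_card_le_two {p : ℝ} (hp : p ∈ Ioo (0 : ℝ) 1) (d : ℕ) (s m : ℝ)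
    (hmin : ∀ u ∈ Icc (0 : ℝ) 1, m ≤ binRelEntropy p u - s * u ^ d)
    {a b c : ℝ} (ha0 : 0 ≤ a) (hab : a < b) (hbc : b < c) (hc1 : c ≤ 1)
    (ha : binRelEntropy p a - s * a ^ d = m) (hb : binRelEntropy p b - s * b ^ d = m)
    (hc : binRelEntropy p c - s * c ^ d = m) : False := by
  -- With three minimum points, Rolle gives zeros `ξ₁ < b < ξ₂` of `φ'` (the middle one because `b`
  -- is an interior minimum), and then zeros `η₁ < b < η₂` of `φ''`. Between these `φ''` turns out
  -- to be negative, so `φ` decreases to the right of its minimum point `b`.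
  set φ : ℝ → ℝ := fun u => binRelEntropy p u - s * u ^ d with hφ
  set φ₁ : ℝ → ℝ := fun u => (Real.log u - Real.log (1 - u) - Real.log p + Real.log (1 - p)) -
    s * (d * u ^ (d - 1)) with hφ₁
  set φ₂ : ℝ → ℝ := fun u => u⁻¹ + (1 - u)⁻¹ -
    s * (d * ((d - 1 : ℕ) * u ^ (d - 1 - 1))) with hφ₂
  have hcont : Continuous φ := by
    have := continuous_binRelEntropy hp
    simp only [hφ]; fun_prop
  have hd1 : ∀ u ∈ Ioo (0 : ℝ) 1, HasDerivAt φ (φ₁ u) u := fun u hu =>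
    (hasDerivAt_binRelEntropy hp hu).sub ((hasDerivAt_pow d u).const_mul s)
  have hd2 : ∀ u ∈ Ioo (0 : ℝ) 1, HasDerivAt φ₁ (φ₂ u) u := fun u hu => by
    have h1 := Real.hasDerivAt_log hu.1.ne'
    have h2 := ((hasDerivAt_id u).const_sub 1).log (by simp only [id]; linarith [hu.2])
    have h3 := ((((h1.sub h2).sub_const (Real.log p)).add_const (Real.log (1 - p)))).sub
      (((hasDerivAt_pow (d - 1) u).const_mul (d : ℝ)).const_mul s)
    refine h3.congr_deriv ?_
    simp only [hφ₂, id]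
    rw [neg_div, one_div]; ring
  have rolle : ∀ (f f' : ℝ → ℝ), (∀ u ∈ Ioo (0 : ℝ) 1, HasDerivAt f (f' u) u) →
      ∀ x y, 0 < x → y < 1 → x < y → f x = f y → ∃ z ∈ Ioo x y, f' z = 0 := by
    intro f f' hf x y hx hy hxy he
    refine exists_hasDerivAt_eq_zero hxy (fun z hz => ?_) he fun z hz => hf z ⟨?_, ?_⟩
    · exact (hf z ⟨by linarith [hz.1], by linarith [hz.2]⟩).continuousAt.continuousWithinAt
    · linarith [hz.1]
    · linarith [hz.2]
  obtain ⟨ξ₁, hξ₁, e₁⟩ := exists_hasDerivAt_eq_zero hab hcont.continuousOn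
    (show φ a = φ b from ha.trans hb.symm)
    fun z hz => hd1 z ⟨by linarith [hz.1], by linarith [hz.2]⟩
  obtain ⟨ξ₂, hξ₂, e₂⟩ := exists_hasDerivAt_eq_zero hbc hcont.continuousOn
    (show φ b = φ c from hb.trans hc.symm)
    fun z hz => hd1 z ⟨by linarith [hz.1], by linarith [hz.2]⟩
  have hb01 : b ∈ Ioo (0 : ℝ) 1 := ⟨by linarith, by linarith⟩
  have eb : φ₁ b = 0 := by
    refine IsLocalMin.hasDerivAt_eq_zero (f := φ) ?_ (hd1 b hb01)
    filter_upwards [Icc_mem_nhds hb01.1 hb01.2] with u hu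
    simpa only [hφ, hb] using hmin u hu
  obtain ⟨η₁, hη₁, g₁⟩ := rolle φ₁ φ₂ hd2 ξ₁ b (by linarith [hξ₁.1]) (by linarith) hξ₁.2
    (e₁.trans eb.symm)
  obtain ⟨η₂, hη₂, g₂⟩ := rolle φ₁ φ₂ hd2 b ξ₂ (by linarith) (by linarith [hξ₂.2]) hξ₂.1
    (eb.trans e₂.symm)
  -- Clearing denominators reduces the sign of `φ''` to the log-concave function `u^(d-1) (1 - u)`,
  -- which takes the same value at `η₁` and `η₂`.
  have hθ : ∀ u ∈ Ioo (0 : ℝ) 1, u * (1 - u) * φ₂ u =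
      1 - s * d * (d - 1 : ℕ) * (u ^ (d - 1) * (1 - u)) := by
    intro u hu
    have h0 : u ≠ 0 := hu.1.ne'
    have h1 : 1 - u ≠ 0 := by linarith [hu.2]
    simp only [hφ₂]
    rcases Nat.eq_zero_or_pos (d - 1) with hd | hd
    · rw [hd]; field_simp; simp
    · obtain ⟨k, hk⟩ : ∃ k, d - 1 = k + 1 := ⟨d - 1 - 1, by omega⟩
      rw [hk, Nat.add_sub_cancel, pow_succ]
      field_simp
      ring
  have hη₁' : η₁ ∈ Ioo (0 : ℝ) 1 := ⟨by linarith [hξ₁.1, hη₁.1], by linarith [hη₁.2]⟩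
  have hη₂' : η₂ ∈ Ioo (0 : ℝ) 1 := ⟨by linarith [hη₂.1], by linarith [hξ₂.2, hη₂.2]⟩
  set κ : ℝ := s * d * (d - 1 : ℕ) with hκ
  have k₁ := hθ η₁ hη₁'
  have k₂ := hθ η₂ hη₂'
  rw [g₁, mul_zero] at k₁
  rw [g₂, mul_zero] at k₂
  have hq₁ : 0 < η₁ ^ (d - 1) * (1 - η₁) :=
    mul_pos (pow_pos hη₁'.1 _) (by linarith [hη₁'.2])
  have hκ0 : 0 < κ := by
    by_contra! h
    nlinarith
  have hneg : ∀ u ∈ Ioo η₁ η₂, φ₂ u < 0 := by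
    intro u hu
    have hu01 : u ∈ Ioo (0 : ℝ) 1 := ⟨by linarith [hu.1, hη₁'.1], by linarith [hu.2, hη₂'.2]⟩
    have hlt := pow_mul_one_sub_lt (n := d - 1) hη₁'.1 hη₂'.2 hu.1 hu.2 (by
      have : κ * (η₁ ^ (d - 1) * (1 - η₁)) = κ * (η₂ ^ (d - 1) * (1 - η₂)) := by linarith
      exact mul_left_cancel₀ hκ0.ne' this)
    have h3 := mul_lt_mul_of_pos_left hlt hκ0
    have h4 := hθ u hu01
    have h5 : 0 < u * (1 - u) := mul_pos hu01.1 (by linarith [hu01.2])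
    by_contra! h
    nlinarith [mul_nonneg h5.le h]
  have hbη : Icc b η₂ ⊆ Ioo (0 : ℝ) 1 := fun u hu =>
    ⟨by linarith [hu.1, hb01.1], by linarith [hu.2, hη₂'.2]⟩
  have hanti : StrictAntiOn φ₁ (Icc b η₂) := by
    refine strictAntiOn_of_deriv_neg (convex_Icc _ _)
      (fun u hu => (hd2 u (hbη hu)).continuousAt.continuousWithinAt) fun u hu => ?_
    rw [interior_Icc] at hu
    rw [(hd2 u (hbη (Ioo_subset_Icc_self hu))).deriv]
    exact hneg u ⟨by linarith [hu.1, hη₁.2], hu.2⟩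
  have hanti' : StrictAntiOn φ (Icc b η₂) := by
    refine strictAntiOn_of_deriv_neg (convex_Icc _ _) hcont.continuousOn fun u hu => ?_
    rw [interior_Icc] at hu
    rw [(hd1 u (hbη (Ioo_subset_Icc_self hu))).deriv, ← eb]
    exact hanti ⟨le_rfl, hη₂.1.le⟩ (Ioo_subset_Icc_self hu) hu.1
  have hlast := hanti' ⟨le_rfl, hη₂.1.le⟩ ⟨hη₂.1.le, le_rfl⟩ hη₂.1
  have := hmin η₂ ⟨hη₂'.1.le, hη₂'.2.le⟩
  simp only [hφ] at hlast
  linarith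

/-! ### Entropy as a function of the `d`-th power: support and stability -/

/-- The entropy of the `d`-th root. -/
abbrev rootEntropy (p : ℝ) (d : ℕ) : ℝ → ℝ := fun x => binRelEntropy p (x ^ (1 / (d : ℝ)))

theorem rootEntropy_pow (p : ℝ) {d : ℕ} (hd : 1 ≤ d) {u : ℝ} (hu : 0 ≤ u) :
    rootEntropy p d (u ^ d) = binRelEntropy p u := by
  rw [rootEntropy, one_div, Real.pow_rpow_inv_natCast hu (by omega)]

theorem rootEntropy_nonneg {p : ℝ} (hp : p ∈ Ioo (0 : ℝ) 1) (d : ℕ) :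
    ∀ x ∈ Icc (0 : ℝ) 1, 0 ≤ rootEntropy p d x := fun x hx =>
  binRelEntropy_nonneg_of_mem hp ⟨Real.rpow_nonneg hx.1 _, Real.rpow_le_one hx.1 hx.2 (by positivity)⟩

theorem pow_mem_Icc {u : ℝ} (hu : u ∈ Icc (0 : ℝ) 1) (d : ℕ) : u ^ d ∈ Icc (0 : ℝ) 1 :=
  ⟨pow_nonneg hu.1 _, pow_le_one₀ hu.1 hu.2⟩

variable {p r : ℝ} {d : ℕ}

/-- At a point of the convex minorant, `h_p` as a function of `u^d` has a support line, whose slope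
is positive to the right of `p`. -/
theorem exists_entropy_support (hp : p ∈ Ioo (0 : ℝ) 1) (hd : 1 ≤ d) (hr : r ∈ Ico p 1)
    (hcm : OnConvexMinorant (rootEntropy p d) (r ^ d) (binRelEntropy p r)) :
    ∃ s : ℝ, 0 ≤ s ∧ (p < r → 0 < s) ∧ (p = r → s = 0) ∧ ∀ u ∈ Icc (0 : ℝ) 1,
      binRelEntropy p r + s * (u ^ d - r ^ d) ≤ binRelEntropy p u := by
  have hr0 : 0 < r := hp.1.trans_le hr.1
  rcases hr.1.eq_or_lt with rfl | hpr
  · refine ⟨0, le_rfl, fun h => absurd h (lt_irrefl _), fun _ => rfl, fun u hu => ?_⟩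
    rw [binRelEntropy_self hp]
    simpa using binRelEntropy_nonneg_of_mem hp hu
  rw [← rootEntropy_pow p hd hr0.le] at hcm
  obtain ⟨s, hs⟩ := exists_support_line ⟨pow_pos hr0 d, pow_lt_one₀ hr0.le hr.2 (by omega)⟩
    (hcm.chord_le (rootEntropy_nonneg hp d))
  have hs' : ∀ u ∈ Icc (0 : ℝ) 1,
      binRelEntropy p r + s * (u ^ d - r ^ d) ≤ binRelEntropy p u := fun u hu => by
    have := hs _ (pow_mem_Icc hu d)
    rwa [rootEntropy_pow p hd hr0.le, rootEntropy_pow p hd hu.1] at this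
  -- Evaluate the support inequality at `p`, where the entropy is zero.
  have hpos : 0 < s := by
    have h1 := hs' p ⟨hp.1.le, hp.2.le⟩
    rw [binRelEntropy_self hp] at h1
    have h2 : 0 < binRelEntropy p r :=
      (binRelEntropy_nonneg_of_mem hp ⟨hr0.le, hr.2.le⟩).lt_of_ne fun h0 =>
        hpr.ne' (eq_of_binRelEntropy_eq_zero hp ⟨hr0.le, hr.2.le⟩ h0.symm)
    have h3 : p ^ d < r ^ d := pow_lt_pow_left₀ hpr hp.1.le (by omega)
    by_contra! hs0
    nlinarith
  exact ⟨s, hpos.le, fun _ => hpos, fun h => absurd h hpr.ne, hs'⟩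

theorem pow_eq_one_of_mem (hd : 1 ≤ d) {u : ℝ} (hu : u ∈ Icc (0 : ℝ) 1)
    (h : 1 - u ^ d = 0) : u = 1 := by
  have : u ^ d = 1 := by linarith
  exact (pow_eq_one_iff_of_nonneg hu.1 (by omega)).1 this

/-- Lower bound for `h_p` in terms of the `d`-th power, at a point of the convex minorant. -/
theorem exists_entropy_lower_bound (hp : p ∈ Ioo (0 : ℝ) 1) (hd : 1 ≤ d) (hr : r ∈ Icc p 1)
    (hcm : OnConvexMinorant (rootEntropy p d) (r ^ d) (binRelEntropy p r)) {ε : ℝ} (hε : 0 < ε) :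
    ∃ C : ℝ, 0 ≤ C ∧ ∀ u ∈ Icc (0 : ℝ) 1,
      binRelEntropy p r - binRelEntropy p u ≤ ε + C * (r ^ d - u ^ d) := by
  have hc := continuous_binRelEntropy hp
  -- At `r = 1` the derivative of `h_p` is infinite and no support line exists; the compactness
  -- bound with `D u = 1 - u^d` takes its place, at the cost of `ε`.
  rcases hr.2.eq_or_lt with rfl | hr1
  · obtain ⟨C, hC, h⟩ := (isCompact_Icc (a := (0 : ℝ)) (b := 1)).exists_le_add_mul
      (D := fun u => 1 - u ^ d) (E := fun u => binRelEntropy p 1 - binRelEntropy p u)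
      (by fun_prop) (by fun_prop) (fun u hu => sub_nonneg.2 (pow_mem_Icc hu d).2)
      (fun u hu h => by rw [pow_eq_one_of_mem hd hu h, sub_self]) hε
    exact ⟨C, hC, fun u hu => by simpa using h C le_rfl u hu⟩
  · obtain ⟨s, hs, -, -, h⟩ := exists_entropy_support hp hd ⟨hr.1, hr1⟩ hcm
    exact ⟨s, hs, fun u hu => by linarith [h u hu]⟩

/-- Stability at a point of the convex minorant: `h_p(u)` close to `h_p(r)` on average and `u^d` not
below `r^d` on average force `u` to be close to `r` on average. -/
theorem exists_entropy_stability (hp : p ∈ Ioo (0 : ℝ) 1) (hd : 1 ≤ d) (hr : r ∈ Icc p 1)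
    (hcm : OnConvexMinorant (rootEntropy p d) (r ^ d) (binRelEntropy p r)) {ε : ℝ} (hε : 0 < ε) :
    ∃ C₁ C₂ : ℝ, 0 ≤ C₁ ∧ 0 ≤ C₂ ∧ ∀ u ∈ Icc (0 : ℝ) 1,
      |u - r| ≤ ε + C₁ * (binRelEntropy p u - binRelEntropy p r) + C₂ * (r ^ d - u ^ d) := by
  have hc := continuous_binRelEntropy hp
  have hr0 : 0 < r := hp.1.trans_le hr.1
  rcases hr.2.eq_or_lt with rfl | hr1
  · obtain ⟨C, hC, h⟩ := (isCompact_Icc (a := (0 : ℝ)) (b := 1)).exists_le_add_mul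
      (D := fun u => 1 - u ^ d) (E := fun u => |u - 1|)
      (by fun_prop) (by fun_prop) (fun u hu => sub_nonneg.2 (pow_mem_Icc hu d).2)
      (fun u hu h => by rw [pow_eq_one_of_mem hd hu h]; simp) hε
    exact ⟨0, C, le_rfl, hC, fun u hu => by simpa using h C le_rfl u hu⟩
  obtain ⟨s, hs, hspos, hs0, h⟩ := exists_entropy_support hp hd ⟨hr.1, hr1⟩ hcm
  set D : ℝ → ℝ := fun u => binRelEntropy p u - binRelEntropy p r - s * (u ^ d - r ^ d) with hD
  -- `D` vanishes at `r` and at no more than one further point `q`. If `q` exists, `K` is chosen so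
  -- that `K (u^d - r^d)` cancels `|u - r|` there; the compactness bound then applies to the
  -- difference.
  obtain ⟨K, hK, hK0⟩ : ∃ K : ℝ, (∀ u ∈ Icc (0 : ℝ) 1, D u = 0 →
      |u - r| - K * (u ^ d - r ^ d) ≤ 0) ∧ (s = 0 → K = 0) := by
    rcases hr.1.eq_or_lt with hpr | hpr
    · refine ⟨0, fun u hu hu0 => ?_, fun _ => rfl⟩
      have := eq_of_binRelEntropy_eq_zero hp hu (by
        simp only [hD, hs0 hpr] at hu0
        rw [← hpr, binRelEntropy_self hp] at hu0
        linarith)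
      rw [this, hpr]; simp
    by_cases hex : ∃ q ∈ Icc (0 : ℝ) 1, D q = 0 ∧ q ≠ r
    · obtain ⟨q, hq, hq0, hqr⟩ := hex
      refine ⟨|q - r| / (q ^ d - r ^ d), fun u hu hu0 => ?_,
        fun h0 => absurd h0 (hspos hpr).ne'⟩
      have hqd : q ^ d - r ^ d ≠ 0 := fun h0 => hqr
        ((pow_left_inj₀ hq.1 hr0.le (by omega)).1 (sub_eq_zero.1 h0))
      by_cases hur : u = r
      · simp [hur]
      by_cases huq : u = q
      · rw [huq, div_mul_cancel₀ _ hqd, sub_self]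
      exfalso
      have key : ∀ {a b c : ℝ}, a ∈ Icc (0 : ℝ) 1 → c ∈ Icc (0 : ℝ) 1 → D a = 0 → D b = 0 →
          D c = 0 → a < b → b < c → False := fun {a b c} ha hc ha' hb' hc' hab hbc => by
        simp only [hD] at ha' hb' hc'
        exact binRelEntropy_sub_min_card_le_two hp d s (binRelEntropy p r - s * r ^ d)
          (fun u hu => by linarith [h u hu]) ha.1 hab hbc hc.2 (by linarith) (by linarith)
          (by linarith)
      have hr' : r ∈ Icc (0 : ℝ) 1 := ⟨hr0.le, hr.2⟩
      have hDr : D r = 0 := by simp [hD]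
      rcases lt_or_gt_of_ne hur with h1 | h1 <;> rcases lt_or_gt_of_ne huq with h2 | h2 <;>
        rcases lt_or_gt_of_ne hqr with h3 | h3
      · exact key hu hr' hu0 hq0 hDr h2 h3
      · exact key hu hq hu0 hDr hq0 h1 h3
      · exact key hq hr' hq0 hu0 hDr h2 h1
      · linarith
      · linarith
      · exact key hr' hq hDr hu0 hq0 h1 h2
      · exact key hq hu hq0 hDr hu0 h3 h1
      · exact key hr' hu hDr hq0 hu0 h3 h2
    · push Not at hex
      refine ⟨0, fun u hu hu0 => ?_, fun _ => rfl⟩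
      rw [hex u hu hu0]; simp
  obtain ⟨C, hC, hCu⟩ := (isCompact_Icc (a := (0 : ℝ)) (b := 1)).exists_le_add_mul
    (D := D) (E := fun u => |u - r| - K * (u ^ d - r ^ d))
    (by simp only [hD]; fun_prop) (by fun_prop) (fun u hu => by
      simp only [hD]; linarith [h u hu]) hK hε
  -- The coefficient of `r^d - u^d` must be nonnegative, because the moment is controlled only from
  -- below. Enlarging `C` achieves this if `s > 0`; if `s = 0`, then `K = 0`.
  obtain ⟨C', hC', hC'K⟩ : ∃ C' ≥ C, 0 ≤ C' * s - K := by
    rcases hs.eq_or_lt with h0 | h0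
    · exact ⟨C, le_rfl, by rw [hK0 h0.symm, ← h0]; simp⟩
    · refine ⟨max C (K / s), le_max_left _ _, ?_⟩
      have := mul_le_mul_of_nonneg_right (le_max_right C (K / s)) hs
      rw [div_mul_cancel₀ _ h0.ne'] at this
      linarith
  refine ⟨C', C' * s - K, hC.trans hC', hC'K, fun u hu => ?_⟩
  have := hCu C' hC' u hu
  simp only [hD] at this
  linarith

end Graphon

/-! ### The off-diagonal block and its `d`-th moment -/

namespace Graphon

/-- The interval `[0,γ]`. -/
abbrev leftPart (γ : ℝ) : Set unitInterval := {x | (x : ℝ) ≤ γ}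

theorem measurableSet_leftPart (γ : ℝ) : MeasurableSet (leftPart γ) :=
  measurableSet_le (by fun_prop) measurable_const

/-- The off-diagonal block `[0,γ] × (γ,1]`. -/
abbrev offBlock (γ : ℝ) : Set (unitInterval × unitInterval) := leftPart γ ×ˢ (leftPart γ)ᶜ

theorem measurableSet_offBlock (γ : ℝ) : MeasurableSet (offBlock γ) :=
  (measurableSet_leftPart γ).prod (measurableSet_leftPart γ).compl

/-- `f` vanishes on the diagonal blocks `[0,γ]² ∪ (γ,1]²`. -/
def IsSplit (γ : ℝ) (f : Graphon) : Prop :=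
  ∀ x y : unitInterval, (x ∈ leftPart γ ↔ y ∈ leftPart γ) → f x y = 0

/-- The restriction of a graphon to `[0,γ] × (γ,1]`. -/
def offKernel (γ : ℝ) (f : Graphon) (x y : unitInterval) : ℝ :=
  (offBlock γ).indicator (fun z => f z.1 z.2) (x, y)

theorem offKernel_mem_Icc (γ : ℝ) (f : Graphon) (x y : unitInterval) :
    offKernel γ f x y ∈ Icc (0 : ℝ) 1 := by
  rw [offKernel, indicator]
  split_ifs
  · exact f.mem_Icc' _ _
  · simp

theorem measurable_offKernel (γ : ℝ) (f : Graphon) {α : Type*} [MeasurableSpace α]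
    {u v : α → unitInterval} (hu : Measurable u) (hv : Measurable v) :
    Measurable fun a => offKernel γ f (u a) (v a) :=
  (((f.measurable_comp measurable_fst measurable_snd).indicator
    (measurableSet_offBlock γ))).comp (hu.prodMk hv)

/-- The `d`-th moment of a graphon on `[0,γ] × (γ,1]`. -/
def offMoment (γ : ℝ) (d : ℕ) (f : Graphon) : ℝ := ∫ z in offBlock γ, f z.1 z.2 ^ d

theorem offMoment_eq_integral (γ : ℝ) {d : ℕ} (hd : 1 ≤ d) (f : Graphon) :
    offMoment γ d f = ∫ x, ∫ y, offKernel γ f x y ^ d := by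
  rw [offMoment, ← integral_indicator (measurableSet_offBlock γ)]
  have : (offBlock γ).indicator (fun z : unitInterval × unitInterval => f z.1 z.2 ^ d) =
      fun z => offKernel γ f z.1 z.2 ^ d := by
    ext z
    by_cases hz : z ∈ offBlock γ
    · simp [offKernel, hz]
    · rw [indicator_of_notMem hz, offKernel, indicator_of_notMem hz, zero_pow (by omega)]
  rw [this]
  refine integral_prod _ (Integrable.of_bound
    ((measurable_offKernel γ f measurable_fst measurable_snd).pow_const d).aestronglyMeasurable 1
    (Filter.Eventually.of_forall fun z => ?_))
  have := pow_mem_Icc (offKernel_mem_Icc γ f z.1 z.2) d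
  rw [Real.norm_eq_abs, abs_of_nonneg this.1]
  exact this.2

end Graphon

/-! ### Hölder's inequality -/

/-- Hölder's inequality for a product of `d` bounded functions. -/
theorem integral_prod_le_prod_rpow {α ι : Type*} [MeasurableSpace α] {μ : Measure α}
    [IsFiniteMeasure μ] {s : Finset ι} {d : ℕ} (hs : s.card = d) (hd : 1 ≤ d) {f : ι → α → ℝ}
    (hf : ∀ i, Measurable (f i)) (hf' : ∀ i a, f i a ∈ Icc (0 : ℝ) 1) :
    ∫ a, ∏ i ∈ s, f i a ∂μ ≤ ∏ i ∈ s, (∫ a, f i a ^ d ∂μ) ^ (1 / (d : ℝ)) := by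
  have hd0 : (d : ℝ) ≠ 0 := by positivity
  have hmem : ∀ a, ∏ i ∈ s, f i a ∈ Icc (0 : ℝ) 1 := fun a =>
    ⟨Finset.prod_nonneg fun i _ => (hf' i a).1,
      Finset.prod_le_one (fun i _ => (hf' i a).1) fun i _ => (hf' i a).2⟩
  have hint : ∀ g : α → ℝ, Measurable g → (∀ a, g a ∈ Icc (0 : ℝ) 1) → Integrable g μ :=
    fun g hg hg' => Integrable.of_bound hg.aestronglyMeasurable 1
      (Filter.Eventually.of_forall fun a => by
        rw [Real.norm_eq_abs, abs_of_nonneg (hg' a).1]; exact (hg' a).2)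
  have hpowint : ∀ i, ENNReal.ofReal (∫ a, f i a ^ d ∂μ) = ∫⁻ a, ENNReal.ofReal (f i a ^ d) ∂μ :=
    fun i => ofReal_integral_eq_lintegral_ofReal
      (hint _ ((hf i).pow_const d) fun a => Graphon.pow_mem_Icc (hf' i a) d)
      (Filter.Eventually.of_forall fun a => (Graphon.pow_mem_Icc (hf' i a) d).1)
  have hnn : ∀ i, 0 ≤ ∫ a, f i a ^ d ∂μ := fun i => integral_nonneg fun a =>
    (Graphon.pow_mem_Icc (hf' i a) d).1
  rw [← ENNReal.ofReal_le_ofReal_iff (Finset.prod_nonneg fun i _ => Real.rpow_nonneg (hnn i) _),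
    ofReal_integral_eq_lintegral_ofReal
      (hint _ (Finset.measurable_fun_prod _ fun i _ => hf i) hmem)
      (Filter.Eventually.of_forall fun a => (hmem a).1),
    ENNReal.ofReal_prod_of_nonneg fun i _ => Real.rpow_nonneg (hnn i) _]
  have key := ENNReal.lintegral_prod_norm_pow_le (μ := μ) s
    (f := fun i a => ENNReal.ofReal (f i a ^ d)) (p := fun _ => 1 / (d : ℝ))
    (fun i _ => ((hf i).pow_const d).ennreal_ofReal.aemeasurable)
    (by rw [Finset.sum_const, hs, nsmul_eq_mul, mul_one_div_cancel hd0])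
    (fun i _ => by positivity)
  refine le_trans (le_of_eq (lintegral_congr fun a => ?_)) (key.trans (le_of_eq ?_))
  · rw [ENNReal.ofReal_prod_of_nonneg fun i _ => (hf' i a).1]
    refine Finset.prod_congr rfl fun i _ => ?_
    rw [ENNReal.ofReal_rpow_of_nonneg (pow_nonneg (hf' i a).1 d) (by positivity), one_div,
      Real.pow_rpow_inv_natCast (hf' i a).1 (by omega)]
  · refine Finset.prod_congr rfl fun i _ => ?_
    rw [← hpowint, ENNReal.ofReal_rpow_of_nonneg (hnn i) (by positivity)]

/-! ### Proper 2-colourings of a regular bipartite graph -/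

namespace SimpleGraph

variable {V : Type*} [Fintype V] [DecidableEq V] (H : SimpleGraph V) [DecidableRel H.Adj]

/-- The proper `2`-colourings of `H`. -/
def boolColorings : Finset (V → Bool) :=
  Finset.univ.filter fun c => ∀ v w, H.Adj v w → c v ≠ c w

variable {H}

theorem mem_boolColorings {c : V → Bool} :
    c ∈ H.boolColorings ↔ ∀ v w, H.Adj v w → c v ≠ c w := by
  simp [boolColorings]

theorem boolColorings_card_pos (h : H.IsBipartite) : 0 < H.boolColorings.card := by
  obtain ⟨C⟩ := h
  refine Finset.card_pos.2 ⟨fun v => decide (C v = 0), mem_boolColorings.2 fun v w hvw h0 => ?_⟩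
  have := C.valid hvw
  simp only [decide_eq_decide] at h0
  refine this ?_
  rcases Fin.exists_fin_two.1 ⟨C v, rfl⟩ with h1 | h1 <;>
    rcases Fin.exists_fin_two.1 ⟨C w, rfl⟩ with h2 | h2 <;> simp_all

/-- Both products run over the edges, each of which has one end of each colour. After Hölder, this
exchange collects the factors that belong to one `true` vertex. -/
theorem prod_neighborFinset_comm {M : Type*} [CommMonoid M] {c : V → Bool}
    (hc : c ∈ H.boolColorings) (g : V → V → M) :
    ∏ b ∈ Finset.univ.filter (fun v => ¬ c v = true), ∏ a ∈ H.neighborFinset b, g a b =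
      ∏ a ∈ Finset.univ.filter (fun v => c v = true), ∏ b ∈ H.neighborFinset a, g a b := by
  refine Finset.prod_comm' fun b a => ?_
  simp only [Finset.mem_filter, Finset.mem_univ, true_and, mem_neighborFinset]
  constructor
  · rintro ⟨h1, h2⟩
    refine ⟨h2.symm, ?_⟩
    have := mem_boolColorings.1 hc _ _ h2
    revert h1 this; cases c a <;> cases c b <;> simp
  · rintro ⟨h1, h2⟩
    refine ⟨?_, h1.symm⟩
    have := mem_boolColorings.1 hc _ _ h1
    revert h2 this; cases c a <;> cases c b <;> simp

theorem prod_edgeFinset_eq {M : Type*} [CommMonoid M] {c : V → Bool}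
    (hc : c ∈ H.boolColorings) (g : Sym2 V → M) :
    ∏ e ∈ H.edgeFinset, g e =
      ∏ b ∈ Finset.univ.filter (fun v => ¬ c v = true), ∏ a ∈ H.neighborFinset b, g s(a, b) := by
  have hc' := mem_boolColorings.1 hc
  rw [Finset.prod_sigma']
  symm
  refine Finset.prod_bij (fun q _ => s(q.2, q.1)) ?_ ?_ ?_ ?_
  · rintro ⟨b, a⟩ h
    simp only [Finset.mem_sigma, mem_neighborFinset] at h
    simpa using h.2.symm
  · rintro ⟨b, a⟩ h ⟨b', a'⟩ h' he
    simp only [Finset.mem_sigma, mem_neighborFinset, Finset.mem_filter, Finset.mem_univ,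
      true_and] at h h'
    simp only [Sym2.eq_iff] at he
    rcases he with ⟨rfl, rfl⟩ | ⟨rfl, rfl⟩
    · rfl
    · have := hc' _ _ h.2
      simp_all
  · intro e he
    induction e with | _ u v =>
    have huv : H.Adj u v := by simpa using he
    have := hc' _ _ huv
    by_cases hv : c v = true
    · refine ⟨⟨u, v⟩, ?_, Sym2.eq_swap⟩
      simp only [Finset.mem_sigma, mem_neighborFinset, Finset.mem_filter, Finset.mem_univ,
        true_and]
      exact ⟨fun h => this (h.trans hv.symm), huv⟩
    · refine ⟨⟨v, u⟩, ?_, rfl⟩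
      simp only [Finset.mem_sigma, mem_neighborFinset, Finset.mem_filter, Finset.mem_univ,
        true_and]
      exact ⟨hv, huv.symm⟩
  · intro q _; rfl

/-- Counting edges from either side gives `d` times the size of each class, so the classes have
equal size. -/
theorem card_color_class {d : ℕ} (hd : 1 ≤ d) (hreg : H.IsRegularOfDegree d) {c : V → Bool}
    (hc : c ∈ H.boolColorings) :
    (Finset.univ.filter fun v => c v = true).card = Fintype.card V / 2 := by
  -- Double counting, as the product exchange in the multiplicative copy of `ℕ`.
  have h := prod_neighborFinset_comm hc (fun _ _ => Multiplicative.ofAdd (1 : ℕ))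
  simp only [Finset.prod_const, card_neighborFinset_eq_degree, hreg.degree_eq] at h
  simp only [← ofAdd_nsmul, smul_eq_mul, mul_one] at h
  have h' := Multiplicative.ofAdd.injective h
  have h1 := Nat.eq_of_mul_eq_mul_right hd h'
  have h2 := Finset.card_filter_add_card_filter_not (s := (Finset.univ : Finset V))
    (fun v => c v = true)
  rw [Finset.card_univ] at h2
  omega

end SimpleGraph

/-! ### Homomorphism densities of split graphons -/

namespace Graphon

theorem integrable_of_mem_Icc {α : Type*} [MeasurableSpace α] {μ : Measure α} [IsFiniteMeasure μ]
    {f : α → ℝ} (hf : Measurable f) (hf' : ∀ a, f a ∈ Icc (0 : ℝ) 1) : Integrable f μ :=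
  Integrable.of_bound hf.aestronglyMeasurable 1 (Filter.Eventually.of_forall fun a => by
    rw [Real.norm_eq_abs, abs_of_nonneg (hf' a).1]; exact (hf' a).2)

section HomDensity

variable {V : Type*} [Fintype V] [DecidableEq V] {H : SimpleGraph V} [DecidableRel H.Adj]
  {γ : ℝ} {f : Graphon} {d : ℕ}

/-- The vertex placements in which the colour of a vertex is the side of its position. -/
def colorCell (γ : ℝ) (c : V → Bool) : Set (V → unitInterval) :=
  {x | ∀ v, x v ∈ leftPart γ ↔ c v = true}

omit [DecidableEq V] in
theorem measurableSet_colorCell (γ : ℝ) (c : V → Bool) : MeasurableSet (colorCell γ c) := by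
  rw [colorCell, ofPred_forall]
  refine MeasurableSet.iInter fun v => ?_
  exact ((measurableSet_leftPart γ).preimage (measurable_pi_apply v)).iff (MeasurableSet.const _)

/-- Each placement of the vertices lies in exactly one cell, that of the colouring by sides, whether
proper or not. -/
theorem homDensity_eq_sum_cells (γ : ℝ) (H : SimpleGraph V) [DecidableRel H.Adj] (f : Graphon) :
    homDensity H f = ∑ c : V → Bool, ∫ x, (colorCell γ c).indicator
      (fun x => ∏ e ∈ H.edgeFinset, f.edgeVal x e) x := by
  classical
  rw [← integral_finsetSum, homDensity]
  · refine integral_congr_ae (Filter.Eventually.of_forall fun x => ?_)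
    simp only
    rw [Finset.sum_eq_single (fun v => decide (x v ∈ leftPart γ))]
    · rw [indicator_of_mem]
      intro v; simp
    · intro c _ hc
      refine indicator_of_notMem (fun hx => hc ?_) _
      funext v
      have := hx v
      cases h : c v <;> simp_all
    · simp
  · intro c _
    exact (integrable_of_mem_Icc (f.measurable_prod_edgeVal _)
      (f.prod_edgeVal_mem_Icc _)).indicator (measurableSet_colorCell γ c)

theorem indicator_cell_eq_zero (hf : IsSplit γ f) {c : V → Bool} (hc : c ∉ H.boolColorings)
    (x : V → unitInterval) :
    (colorCell γ c).indicator (fun x => ∏ e ∈ H.edgeFinset, f.edgeVal x e) x = 0 := by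
  rw [SimpleGraph.mem_boolColorings] at hc
  push Not at hc
  obtain ⟨v, w, hvw, hcvw⟩ := hc
  by_cases hx : x ∈ colorCell γ c
  · rw [indicator_of_mem hx]
    refine Finset.prod_eq_zero (i := s(v, w)) (by simpa using hvw) ?_
    rw [edgeVal_mk]
    exact hf _ _ (by rw [hx v, hx w, hcvw])
  · exact indicator_of_notMem hx _

/-- The indicator of the cell is absorbed by the kernels: a vertex on the wrong side has an edge,
since `d ≥ 1`, and the kernel of that edge is zero. -/
theorem indicator_cell_eq_prod (hd : 1 ≤ d) (hreg : H.IsRegularOfDegree d) {c : V → Bool}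
    (hc : c ∈ H.boolColorings) (x : V → unitInterval) :
    (colorCell γ c).indicator (fun x => ∏ e ∈ H.edgeFinset, f.edgeVal x e) x =
      ∏ b ∈ Finset.univ.filter (fun v => ¬ c v = true), ∏ a ∈ H.neighborFinset b,
        offKernel γ f (x a) (x b) := by
  have hc' := SimpleGraph.mem_boolColorings.1 hc
  by_cases hx : x ∈ colorCell γ c
  · rw [indicator_of_mem hx, SimpleGraph.prod_edgeFinset_eq hc]
    refine Finset.prod_congr rfl fun b hb => Finset.prod_congr rfl fun a ha => ?_
    simp only [Finset.mem_filter, Finset.mem_univ, true_and, SimpleGraph.mem_neighborFinset]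
      at hb ha
    have := hc' _ _ ha
    have hca : c a = true := by revert hb this; cases c a <;> cases c b <;> simp
    have : (x a, x b) ∈ offBlock γ := ⟨(hx a).2 hca, fun h => hb ((hx b).1 h)⟩
    rw [edgeVal_mk, offKernel, indicator_of_mem this]
  · rw [indicator_of_notMem hx]
    symm
    simp only [colorCell, mem_ofPred_eq, not_forall] at hx
    obtain ⟨v, hv⟩ := hx
    obtain ⟨w, hw⟩ : ∃ w, H.Adj v w := by
      have : 0 < (H.neighborFinset v).card := by
        rw [SimpleGraph.card_neighborFinset_eq_degree, hreg.degree_eq]; omega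
      obtain ⟨w, hw⟩ := Finset.card_pos.1 this
      exact ⟨w, by simpa using hw⟩
    have hvw := hc' _ _ hw
    by_cases hcv : c v = true
    · rw [SimpleGraph.prod_neighborFinset_comm hc (fun a b => offKernel γ f (x a) (x b))]
      refine Finset.prod_eq_zero (i := v) (by simpa using hcv)
        (Finset.prod_eq_zero (i := w) (by simpa using hw) (indicator_of_notMem (fun h => hv ?_) _))
      simp only [hcv, iff_true]
      exact h.1
    · refine Finset.prod_eq_zero (i := v) (by simpa using hcv)
        (Finset.prod_eq_zero (i := w) (by simpa using hw) (indicator_of_notMem (fun h => hv ?_) _))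
      exact ⟨fun h' => absurd h' h.2, fun h' => absurd h' hcv⟩

/-- Fubini over the two colour classes of a proper colouring. -/
theorem integral_cell_eq (hd : 1 ≤ d) (hreg : H.IsRegularOfDegree d) {c : V → Bool}
    (hc : c ∈ H.boolColorings) :
    ∫ x, (colorCell γ c).indicator (fun x => ∏ e ∈ H.edgeFinset, f.edgeVal x e) x =
      ∫ x : {v // c v = true} → unitInterval,
        ∏ b ∈ Finset.univ.filter (fun v => ¬ c v = true), ∫ y, ∏ a ∈ H.neighborFinset b,
          offKernel γ f (if h : c a = true then x ⟨a, h⟩ else 0) y := by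
  have hc' := SimpleGraph.mem_boolColorings.1 hc
  simp_rw [indicator_cell_eq_prod hd hreg hc]
  set G : ({v // c v = true} → unitInterval) × ({v // ¬ c v = true} → unitInterval) → ℝ := fun q =>
    ∏ b : {v // ¬ c v = true}, ∏ a ∈ H.neighborFinset b.1,
      offKernel γ f (if h : c a = true then q.1 ⟨a, h⟩ else 0) (q.2 b) with hG
  have hmp := volume_preserving_piEquivPiSubtypeProd (fun _ : V => unitInterval)
    (fun v => c v = true)
  have h1 : (fun x : V → unitInterval => ∏ b ∈ Finset.univ.filter (fun v => ¬ c v = true),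
      ∏ a ∈ H.neighborFinset b, offKernel γ f (x a) (x b)) =
      fun x => G (MeasurableEquiv.piEquivPiSubtypeProd (fun _ : V => unitInterval)
        (fun v => c v = true) x) := by
    funext x
    simp only [hG]
    rw [Finset.prod_subtype (p := fun v => ¬ c v = true) _ (by simp)]
    refine Finset.prod_congr rfl fun b _ => Finset.prod_congr rfl fun a ha => ?_
    have hab := hc' _ _ ((SimpleGraph.mem_neighborFinset _ _ _).1 ha)
    have hb := b.2
    have hca : c a = true := by revert hb hab; cases c a <;> cases c b <;> simp
    -- Neighbours of a `false` vertex are `true`, so the default position `0` never occurs.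
    rw [dif_pos hca]
    rfl
  have hmem : ∀ q, G q ∈ Icc (0 : ℝ) 1 := fun q =>
    ⟨Finset.prod_nonneg fun b _ => Finset.prod_nonneg fun a _ => (offKernel_mem_Icc _ _ _ _).1,
      Finset.prod_le_one (fun b _ => Finset.prod_nonneg fun a _ => (offKernel_mem_Icc _ _ _ _).1)
      fun b _ => Finset.prod_le_one (fun a _ => (offKernel_mem_Icc _ _ _ _).1)
        fun a _ => (offKernel_mem_Icc _ _ _ _).2⟩
  have hmeas : Measurable G := by
    refine Finset.measurable_fun_prod _ fun b _ => Finset.measurable_fun_prod _ fun a _ => ?_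
    refine measurable_offKernel γ f ?_ (by fun_prop)
    split_ifs <;> fun_prop
  rw [h1, hmp.integral_comp' G, Measure.volume_eq_prod,
    integral_prod _ (integrable_of_mem_Icc hmeas hmem)]
  refine integral_congr_ae (Filter.Eventually.of_forall fun x => ?_)
  simp only [hG]
  rw [integral_fintype_prod_volume_eq_prod (fun (b : {v // ¬ c v = true}) (y : unitInterval) =>
    ∏ a ∈ H.neighborFinset b.1, offKernel γ f (if h : c a = true then x ⟨a, h⟩ else 0) y)]
  rw [Finset.prod_subtype (p := fun v => ¬ c v = true) _ (by simp)]

/-- Each `true` vertex is a neighbour of `d` vertices, so its `d` factors `K^(1/d)` combine to `K`.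
This turns the Hölder bounds into a product over single vertices. -/
theorem prod_rpow_eq (hd : 1 ≤ d) (hreg : H.IsRegularOfDegree d) {c : V → Bool}
    (hc : c ∈ H.boolColorings) {K : unitInterval → ℝ} (hK : ∀ x, 0 ≤ K x)
    (x : {v // c v = true} → unitInterval) :
    ∏ b ∈ Finset.univ.filter (fun v => ¬ c v = true), ∏ a ∈ H.neighborFinset b,
      K (if h : c a = true then x ⟨a, h⟩ else 0) ^ (1 / (d : ℝ)) = ∏ a, K (x a) := by
  rw [SimpleGraph.prod_neighborFinset_comm hc
    (fun a _ => K (if h : c a = true then x ⟨a, h⟩ else 0) ^ (1 / (d : ℝ)))]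
  simp only [Finset.prod_const, SimpleGraph.card_neighborFinset_eq_degree, hreg.degree_eq]
  rw [Finset.prod_subtype (p := fun v => c v = true) _ (by simp)]
  refine Finset.prod_congr rfl fun a _ => ?_
  rw [dif_pos a.2, one_div, Real.rpow_inv_natCast_pow (hK _) (by omega)]

theorem integral_prod_offMoment (γ : ℝ) (hd : 1 ≤ d) (hreg : H.IsRegularOfDegree d) (f : Graphon)
    {c : V → Bool} (hc : c ∈ H.boolColorings) :
    ∫ x : {v // c v = true} → unitInterval, ∏ a, ∫ y, offKernel γ f (x a) y ^ d =
      offMoment γ d f ^ (Fintype.card V / 2) := by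
  rw [integral_fintype_prod_volume_eq_pow (fun x => ∫ y, offKernel γ f x y ^ d),
    ← offMoment_eq_integral γ hd, Fintype.card_subtype, SimpleGraph.card_color_class hd hreg hc]

theorem homDensity_eq_sum_colorings (hf : IsSplit γ f) :
    homDensity H f = ∑ c ∈ H.boolColorings, ∫ x, (colorCell γ c).indicator
      (fun x => ∏ e ∈ H.edgeFinset, f.edgeVal x e) x := by
  rw [homDensity_eq_sum_cells γ]
  symm
  refine Finset.sum_subset (Finset.subset_univ _) fun c _ hc => ?_
  simp_rw [indicator_cell_eq_zero hf hc]
  simp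

/-- The upper bound on the homomorphism density of a regular bipartite graph. -/
theorem homDensity_le (hd : 1 ≤ d) (hreg : H.IsRegularOfDegree d) (hf : IsSplit γ f) :
    homDensity H f ≤ H.boolColorings.card * offMoment γ d f ^ (Fintype.card V / 2) := by
  rw [homDensity_eq_sum_colorings hf, ← nsmul_eq_mul]
  refine Finset.sum_le_card_nsmul _ _ _ fun c hc => ?_
  rw [integral_cell_eq hd hreg hc, ← integral_prod_offMoment γ hd hreg f hc]
  have hm1 : ∀ g : unitInterval → unitInterval → ℝ, Measurable (Function.uncurry g) →
      Measurable fun x => ∫ y, g x y := fun g hg =>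
    (hg.stronglyMeasurable.integral_prod_right (f := g)).measurable
  have hI : ∀ g : unitInterval → ℝ, (∀ y, g y ∈ Icc (0 : ℝ) 1) → ∫ y, g y ∈ Icc (0 : ℝ) 1 :=
    fun g hg => ⟨integral_nonneg fun y => (hg y).1, by
      refine (integral_mono_of_nonneg (Filter.Eventually.of_forall fun y => (hg y).1)
        (integrable_const (1 : ℝ)) (Filter.Eventually.of_forall fun y => (hg y).2)).trans ?_
      simp⟩
  have hK : ∀ x, ∫ y, offKernel γ f x y ^ d ∈ Icc (0 : ℝ) 1 := fun x =>
    hI _ fun y => pow_mem_Icc (offKernel_mem_Icc γ f x y) d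
  refine integral_mono_of_nonneg (Filter.Eventually.of_forall fun x => ?_) ?_
    (Filter.Eventually.of_forall fun x => ?_)
  · exact Finset.prod_nonneg fun b _ => integral_nonneg fun y =>
      Finset.prod_nonneg fun a _ => (offKernel_mem_Icc _ _ _ _).1
  · refine integrable_of_mem_Icc (Finset.measurable_fun_prod _ fun a _ => ?_) fun x => ?_
    · exact (hm1 (fun x y => offKernel γ f x y ^ d) ((measurable_offKernel γ f measurable_fst measurable_snd).pow_const d)).comp
        (measurable_pi_apply a)
    · exact ⟨Finset.prod_nonneg fun a _ => (hK _).1,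
        Finset.prod_le_one (fun a _ => (hK _).1) fun a _ => (hK _).2⟩
  · simp only
    -- For fixed positions of the `true` vertices, Hölder is applied separately to each `false`
    -- vertex.
    rw [← prod_rpow_eq hd hreg hc (fun x => (hK x).1) x]
    refine Finset.prod_le_prod (fun b _ => integral_nonneg fun y =>
      Finset.prod_nonneg fun a _ => (offKernel_mem_Icc _ _ _ _).1) fun b _ => ?_
    exact integral_prod_le_prod_rpow
      (by rw [SimpleGraph.card_neighborFinset_eq_degree, hreg.degree_eq]) hd
      (fun a => measurable_offKernel γ f measurable_const measurable_id)
      (fun a y => offKernel_mem_Icc _ _ _ _)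

/-- The bound `homDensity_le` is attained by graphons whose off-diagonal block depends on one
coordinate only. -/
theorem homDensity_eq_of_rows (hd : 1 ≤ d) (hreg : H.IsRegularOfDegree d) (hf : IsSplit γ f)
    {κ : unitInterval → ℝ} (hκ : ∀ x ∈ leftPart γ, ∀ y ∉ leftPart γ, f x y = κ x) :
    homDensity H f = H.boolColorings.card * offMoment γ d f ^ (Fintype.card V / 2) := by
  rw [homDensity_eq_sum_colorings hf, ← nsmul_eq_mul]
  refine Finset.sum_eq_card_nsmul fun c hc => ?_
  rw [integral_cell_eq hd hreg hc, ← integral_prod_offMoment γ hd hreg f hc]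
  refine integral_congr_ae (Filter.Eventually.of_forall fun x => ?_)
  simp only
  set k : unitInterval → ℝ := (leftPart γ).indicator κ with hk
  set u : unitInterval → ℝ := (leftPart γ)ᶜ.indicator 1 with hu
  -- The kernel is a product whose second factor is an indicator, so all its powers agree and Hölder
  -- is an equality.
  have hfk : ∀ x y, offKernel γ f x y = k x * u y := by
    intro x y
    by_cases hx : x ∈ leftPart γ <;> by_cases hy : y ∈ leftPart γ
    · rw [offKernel, indicator_of_notMem (fun h => h.2 hy), hu,
        indicator_of_notMem (fun h : y ∈ (leftPart γ)ᶜ => h hy), mul_zero]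
    · rw [offKernel, indicator_of_mem (show (x, y) ∈ offBlock γ from ⟨hx, hy⟩), hu, hk,
        indicator_of_mem hx, indicator_of_mem (show y ∈ (leftPart γ)ᶜ from hy)]
      simp [hκ x hx y hy]
    · rw [offKernel, indicator_of_notMem (fun h => hx h.1), hk, indicator_of_notMem hx, zero_mul]
    · rw [offKernel, indicator_of_notMem (fun h => hx h.1), hk, indicator_of_notMem hx, zero_mul]
  -- If `(γ,1]` is empty, nothing is known about the sign of `κ`; both sides are then zero.
  have hk0 : ∀ x, u = 0 ∨ 0 ≤ k x := by
    intro x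
    rcases eq_or_ne u 0 with h | h
    · exact Or.inl h
    · right
      obtain ⟨y, hy⟩ := Function.ne_iff.1 h
      have hy' : u y = 1 := by
        by_cases hy' : y ∈ (leftPart γ)ᶜ
        · simp [hu, indicator_of_mem hy']
        · exact absurd (indicator_of_notMem hy' _) hy
      have := (offKernel_mem_Icc γ f x y).1
      rwa [hfk, hy', mul_one] at this
  have hud : ∀ n : ℕ, 1 ≤ n → ∀ y, u y ^ n = u y := by
    intro n hn y
    by_cases hy : y ∈ (leftPart γ)ᶜ
    · simp [hu, indicator_of_mem hy]
    · simp only [hu, indicator_of_notMem hy]; exact zero_pow (by omega)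
  have hu0 : 0 ≤ ∫ y, u y := integral_nonneg fun y => indicator_nonneg (fun _ _ => by simp) y
  rw [← prod_rpow_eq hd hreg hc (K := fun x => ∫ y, offKernel γ f x y ^ d) (fun x =>
    integral_nonneg fun y => pow_nonneg (offKernel_mem_Icc γ f x y).1 d) x]
  refine Finset.prod_congr rfl fun b _ => ?_
  have hcard : (H.neighborFinset b).card = d := by
    rw [SimpleGraph.card_neighborFinset_eq_degree, hreg.degree_eq]
  simp only [hfk, Finset.prod_mul_distrib, mul_pow, Finset.prod_const, hcard, hud d hd]
  rw [integral_const_mul]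
  simp only [integral_const_mul]
  rcases eq_or_ne u 0 with h | h
  · simp only [h, Pi.zero_apply, integral_zero, mul_zero, Finset.prod_const, hcard]
    rw [Real.zero_rpow (by positivity), zero_pow (by omega)]
  · have hk0' : ∀ x, 0 ≤ k x := fun x => (hk0 x).resolve_left h
    simp only [Real.mul_rpow (pow_nonneg (hk0' _) d) hu0, one_div,
      Real.pow_rpow_inv_natCast (hk0' _) (show d ≠ 0 by omega), Finset.prod_mul_distrib,
      Finset.prod_const, hcard]
    rw [Real.rpow_inv_natCast_pow hu0 (by omega)]

end HomDensity

end Graphon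

namespace Graphon

variable {γ p : ℝ}

/-! ### Cut distance and `L¹` distance -/

theorem cutDist_le_integral_abs (f g : Graphon) :
    cutDist f g ≤ ∫ z : unitInterval × unitInterval, |f z.1 z.2 - g z.1 z.2| :=
  cutDist_le fun _ _ _ _ => (abs_integral_le_integral_abs).trans
    (setIntegral_le_integral (integrable_sub f g).abs
      (Filter.Eventually.of_forall fun _ => abs_nonneg _))

theorem cutMetric_le_cutDist (f g : Graphon) : cutMetric f g ≤ cutDist f g :=
  cutMetric_le f g ⟨MeasurableEquiv.refl _, MeasurePreserving.id _⟩

/-! ### Split graphons -/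

theorem bipartiteGraphon_isSplit (γ : ℝ) {r : ℝ} (hr : r ∈ Icc (0 : ℝ) 1) :
    IsSplit γ (bipartiteGraphon γ r hr) := fun _ _ h => if_pos h

theorem bipartiteGraphon_apply_off {r : ℝ} (hr : r ∈ Icc (0 : ℝ) 1) {x y : unitInterval}
    (hx : x ∈ leftPart γ) (hy : y ∉ leftPart γ) : bipartiteGraphon γ r hr x y = r :=
  if_neg fun h => hy (h.1 hx)

theorem bipartiteGraphon_apply_of_not {r : ℝ} (hr : r ∈ Icc (0 : ℝ) 1) {x y : unitInterval}
    (h : ¬ (x ∈ leftPart γ ↔ y ∈ leftPart γ)) : bipartiteGraphon γ r hr x y = r :=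
  if_neg h

theorem measurableSet_diagBlocks (γ : ℝ) : MeasurableSet
    {z : unitInterval × unitInterval | z.1 ∈ leftPart γ ↔ z.2 ∈ leftPart γ} :=
  ((measurableSet_leftPart γ).preimage measurable_fst).iff
    ((measurableSet_leftPart γ).preimage measurable_snd)

open Classical in
/-- The graphon `f`, set to zero on the diagonal blocks. -/
def splitPart (γ : ℝ) (f : Graphon) : Graphon where
  toFun x y := if (x ∈ leftPart γ ↔ y ∈ leftPart γ) then 0 else f x y
  symm' x y := by simp only [iff_comm, f.symm' x y]
  mem_Icc' x y := by
    split_ifs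
    · simp
    · exact f.mem_Icc' x y
  measurable' := Measurable.ite (measurableSet_diagBlocks γ) measurable_const f.measurable'

theorem splitPart_isSplit (γ : ℝ) (f : Graphon) : IsSplit γ (splitPart γ f) :=
  fun _ _ h => if_pos h

theorem mem_randomRegion_iff (hp : p ∈ Ioo (0 : ℝ) 1) {hp' : p ∈ Icc (0 : ℝ) 1}
    (z : unitInterval × unitInterval) :
    z ∈ randomRegion (bipartiteGraphon γ p hp') ↔
      ¬ (z.1 ∈ leftPart γ ↔ z.2 ∈ leftPart γ) := by
  rw [randomRegion, mem_ofPred_eq]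
  by_cases h : (z.1 ∈ leftPart γ ↔ z.2 ∈ leftPart γ)
  · rw [bipartiteGraphon_isSplit γ hp' _ _ h]; simp [h]
  · rw [bipartiteGraphon_apply_of_not hp' h]; simp only [h, not_false_eq_true, iff_true]; exact hp

theorem mem_supportedGraphons_iff (hp : p ∈ Ioo (0 : ℝ) 1) {hp' : p ∈ Icc (0 : ℝ) 1} {f : Graphon} :
    f ∈ supportedGraphons (bipartiteGraphon γ p hp') ↔
      ∀ᵐ z : unitInterval × unitInterval, (z.1 ∈ leftPart γ ↔ z.2 ∈ leftPart γ) →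
        f z.1 z.2 = 0 := by
  rw [supportedGraphons, mem_ofPred_eq, ae_iff]
  refine iff_of_eq (congrArg (fun s => volume s = 0) ?_)
  ext z
  simp only [mem_ofPred_eq, mem_compl_iff, mem_randomRegion_iff hp, not_not, Classical.not_imp]
  refine and_congr_right fun h => ?_
  rw [bipartiteGraphon_isSplit γ hp' _ _ h]

theorem IsSplit.mem_supportedGraphons (hp : p ∈ Ioo (0 : ℝ) 1) {hp' : p ∈ Icc (0 : ℝ) 1}
    {f : Graphon} (hf : IsSplit γ f) :
    f ∈ supportedGraphons (bipartiteGraphon γ p hp') :=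
  (mem_supportedGraphons_iff hp).2 (Filter.Eventually.of_forall fun z => hf z.1 z.2)

theorem splitPart_ae_eq (hp : p ∈ Ioo (0 : ℝ) 1) {hp' : p ∈ Icc (0 : ℝ) 1} {f : Graphon}
    (hf : f ∈ supportedGraphons (bipartiteGraphon γ p hp')) :
    ∀ᵐ z : unitInterval × unitInterval, splitPart γ f z.1 z.2 = f z.1 z.2 := by
  filter_upwards [(mem_supportedGraphons_iff hp).1 hf] with z hz
  by_cases h : (z.1 ∈ leftPart γ ↔ z.2 ∈ leftPart γ)
  · rw [hz h, splitPart_isSplit γ f _ _ h]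
  · exact if_neg h

theorem dist_splitPart (hp : p ∈ Ioo (0 : ℝ) 1) {hp' : p ∈ Icc (0 : ℝ) 1} {f : Graphon}
    (hf : f ∈ supportedGraphons (bipartiteGraphon γ p hp')) : dist f (splitPart γ f) = 0 := by
  refine le_antisymm ?_ dist_nonneg
  refine (cutMetric_le_cutDist _ _).trans ((cutDist_le_integral_abs _ _).trans (le_of_eq ?_))
  rw [integral_eq_zero_of_ae]
  filter_upwards [splitPart_ae_eq hp hf] with z hz
  rw [hz]; simp

theorem relEntropyFunctional_splitPart (hp : p ∈ Ioo (0 : ℝ) 1) {hp' : p ∈ Icc (0 : ℝ) 1}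
    {f : Graphon}
    (hf : f ∈ supportedGraphons (bipartiteGraphon γ p hp')) :
    relEntropyFunctional (bipartiteGraphon γ p hp') (splitPart γ f) =
      relEntropyFunctional (bipartiteGraphon γ p hp') f := by
  rw [relEntropyFunctional, relEntropyFunctional]
  congr 1
  refine lintegral_congr_ae ?_
  filter_upwards [splitPart_ae_eq hp hf] with z hz
  rw [hz]

theorem measurable_relEntropy {p' : ℝ} {hp' : p' ∈ Icc (0 : ℝ) 1} (f : Graphon) :
    Measurable fun z : unitInterval × unitInterval =>
      relEntropy (bipartiteGraphon γ p' hp' z.1 z.2) (f z.1 z.2) := by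
  have hf := f.measurable_comp (α := unitInterval × unitInterval) measurable_fst measurable_snd
  have hW := (bipartiteGraphon γ p' hp').measurable_comp (α := unitInterval × unitInterval)
    measurable_fst measurable_snd
  unfold relEntropy binRelEntropy
  refine Measurable.ite ?_ measurable_const (Measurable.ennreal_ofReal ?_)
  · refine MeasurableSet.union (MeasurableSet.inter ?_ ?_) (MeasurableSet.inter ?_ ?_)
    · exact hW (measurableSet_singleton 0)
    · exact (hf (measurableSet_singleton 0)).compl
    · exact hW (measurableSet_singleton 1)
    · exact (hf (measurableSet_singleton 1)).compl
  · exact (hf.mul (hf.div hW).log).add ((hf.const_sub 1).mul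
      ((hf.const_sub 1).div (hW.const_sub 1)).log)

/-- On the diagonal blocks `W₀ = 0`, where any nonzero value costs infinite entropy. -/
theorem mem_supportedGraphons_of_lt_top (hp : p ∈ Ioo (0 : ℝ) 1) {hp' : p ∈ Icc (0 : ℝ) 1}
    {f : Graphon}
    (h : relEntropyFunctional (bipartiteGraphon γ p hp') f < ∞) :
    f ∈ supportedGraphons (bipartiteGraphon γ p hp') := by
  rw [mem_supportedGraphons_iff hp]
  have h1 : ∫⁻ z : unitInterval × unitInterval,
      relEntropy (bipartiteGraphon γ p hp' z.1 z.2) (f z.1 z.2) ≠ ∞ := fun h2 => by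
    rw [relEntropyFunctional, h2, ENNReal.mul_top (by simp)] at h
    exact lt_irrefl _ h
  filter_upwards [ae_lt_top (measurable_relEntropy f) h1] with z hz hz'
  rw [bipartiteGraphon_isSplit γ hp' _ _ hz'] at hz
  by_contra hne
  rw [relEntropy, if_pos (Or.inl ⟨rfl, hne⟩)] at hz
  exact lt_irrefl _ hz

/-- `φ` is the sum of its restriction to the block and the reflection of that restriction. The
resulting factor `2` cancels the `½` of the entropy functional. -/
theorem lintegral_offBlock_add_swap {γ : ℝ} {φ : unitInterval × unitInterval → ℝ≥0∞}
    (hφ : Measurable φ) (hsymm : ∀ z, φ z.swap = φ z)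
    (h0 : ∀ z : unitInterval × unitInterval, (z.1 ∈ leftPart γ ↔ z.2 ∈ leftPart γ) → φ z = 0) :
    ∫⁻ z, φ z = 2 * ∫⁻ z in offBlock γ, φ z := by
  have h1 : ∀ z, φ z = (offBlock γ).indicator φ z + (offBlock γ).indicator φ z.swap := by
    intro z
    by_cases hx : z.1 ∈ leftPart γ <;> by_cases hy : z.2 ∈ leftPart γ
    · rw [h0 z (by simp [hx, hy]), indicator_of_notMem fun h => h.2 hy,
        indicator_of_notMem fun h => h.2 hx, add_zero]
    · rw [indicator_of_mem (show z ∈ offBlock γ from ⟨hx, hy⟩),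
        indicator_of_notMem fun h => hy h.1, add_zero]
    · rw [indicator_of_notMem fun h => hx h.1,
        indicator_of_mem (show z.swap ∈ offBlock γ from ⟨hy, hx⟩), zero_add, hsymm]
    · rw [h0 z (by simp [hx, hy]), indicator_of_notMem fun h => hx h.1,
        indicator_of_notMem fun h => hy h.1, add_zero]
  have hm := hφ.indicator (measurableSet_offBlock γ)
  have h2 : ∫⁻ z : unitInterval × unitInterval, (offBlock γ).indicator φ z.swap =
      ∫⁻ z, (offBlock γ).indicator φ z :=
    (Measure.measurePreserving_swap (μ := (volume : Measure unitInterval))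
      (ν := (volume : Measure unitInterval))).lintegral_comp hm
  rw [lintegral_congr h1, lintegral_add_left hm, h2, lintegral_indicator (measurableSet_offBlock γ),
    two_mul]

theorem volume_leftPart (hγ : γ ∈ Ioo (0 : ℝ) 1) :
    volume (leftPart γ) = ENNReal.ofReal γ := by
  have : leftPart γ = Iic (⟨γ, hγ.1.le, hγ.2.le⟩ : unitInterval) := by
    ext x; simp [leftPart, ← Subtype.coe_le_coe]
  rw [this]; simp

theorem volume_leftPart_compl (hγ : γ ∈ Ioo (0 : ℝ) 1) :
    volume (leftPart γ)ᶜ = ENNReal.ofReal (1 - γ) := by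
  rw [prob_compl_eq_one_sub (measurableSet_leftPart γ), volume_leftPart hγ,
    ENNReal.ofReal_sub _ hγ.1.le, ENNReal.ofReal_one]

theorem volume_real_offBlock (hγ : γ ∈ Ioo (0 : ℝ) 1) :
    volume.real (offBlock γ) = γ * (1 - γ) := by
  rw [Measure.real, Measure.volume_eq_prod, Measure.prod_prod, volume_leftPart hγ,
    volume_leftPart_compl hγ, ENNReal.toReal_mul, ENNReal.toReal_ofReal hγ.1.le,
    ENNReal.toReal_ofReal (by linarith [hγ.2])]

/-- The entropy of the off-diagonal block. -/
def offEntropy (γ p : ℝ) (f : Graphon) : ℝ := ∫ z in offBlock γ, binRelEntropy p (f z.1 z.2)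

theorem integrable_comp_continuous (f : Graphon) {g : ℝ → ℝ} (hg : Continuous g)
    (S : Set (unitInterval × unitInterval)) :
    IntegrableOn (fun z => g (f z.1 z.2)) S := by
  obtain ⟨C, hC⟩ := (isCompact_Icc (a := (0 : ℝ)) (b := 1)).exists_bound_of_continuousOn
    hg.continuousOn
  exact Integrable.of_bound (hg.measurable.comp
    (f.measurable_comp measurable_fst measurable_snd)).aestronglyMeasurable C
    (Filter.Eventually.of_forall fun z => hC _ (f.mem_Icc' _ _))

theorem IsSplit.relEntropyFunctional_eq (hp : p ∈ Ioo (0 : ℝ) 1) {hp' : p ∈ Icc (0 : ℝ) 1}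
    {f : Graphon} (hf : IsSplit γ f) :
    relEntropyFunctional (bipartiteGraphon γ p hp') f = ENNReal.ofReal (offEntropy γ p f) := by
  rw [relEntropyFunctional, lintegral_offBlock_add_swap (γ := γ) (measurable_relEntropy f),
    ← mul_assoc, one_div, ENNReal.inv_mul_cancel (by simp) (by simp), one_mul, offEntropy,
    ofReal_integral_eq_lintegral_ofReal]
  · refine setLIntegral_congr_fun (measurableSet_offBlock γ) fun z hz => ?_
    rw [bipartiteGraphon_apply_off hp' hz.1 hz.2, relEntropy, if_neg]
    rintro (h | h)
    · exact hp.1.ne' h.1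
    · exact hp.2.ne h.1
  · exact integrable_comp_continuous f (continuous_binRelEntropy hp) _
  · exact Filter.Eventually.of_forall fun z => binRelEntropy_nonneg_of_mem hp (f.mem_Icc' _ _)
  · intro z
    simp only [Prod.fst_swap, Prod.snd_swap]
    rw [f.symm', (bipartiteGraphon γ p hp').symm']
  · intro z hz
    rw [hf _ _ hz, bipartiteGraphon_isSplit γ hp' _ _ hz]
    simp [relEntropy, binRelEntropy]

/-- For split graphons the cut distance is at most twice the `L¹` distance on the block. -/
theorem IsSplit.cutDist_le {f g : Graphon} (hf : IsSplit γ f) (hg : IsSplit γ g) :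
    cutDist f g ≤ 2 * ∫ z in offBlock γ, |f z.1 z.2 - g z.1 z.2| := by
  refine (cutDist_le_integral_abs f g).trans (le_of_eq ?_)
  have hm : Measurable fun z : unitInterval × unitInterval => |f z.1 z.2 - g z.1 z.2| :=
    ((f.measurable_comp measurable_fst measurable_snd).sub
      (g.measurable_comp measurable_fst measurable_snd)).abs
  have h := lintegral_offBlock_add_swap (γ := γ) hm.ennreal_ofReal
    (fun z => by simp only [Prod.fst_swap, Prod.snd_swap]; rw [f.symm', g.symm'])
    (fun z hz => by rw [hf _ _ hz, hg _ _ hz]; simp)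
  rw [← ofReal_integral_eq_lintegral_ofReal (integrable_sub f g).abs
      (Filter.Eventually.of_forall fun _ => abs_nonneg _),
    ← ofReal_integral_eq_lintegral_ofReal (integrable_sub f g).abs.integrableOn
      (Filter.Eventually.of_forall fun _ => abs_nonneg _)] at h
  have h' := congrArg ENNReal.toReal h
  rw [ENNReal.toReal_mul, ENNReal.toReal_ofReal (integral_nonneg fun _ => abs_nonneg _),
    ENNReal.toReal_ofReal (integral_nonneg fun _ => abs_nonneg _)] at h'
  simpa using h'

end Graphon

/-! ### The rate function in terms of split graphons -/

namespace GraphonSpace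

open Graphon

variable {γ p : ℝ}

theorem homDensity_mk {V : Type*} [Fintype V] [DecidableEq V] (H : SimpleGraph V)
    [DecidableRel H.Adj] (f : Graphon) : homDensity H (mk f) = Graphon.homDensity H f := rfl

theorem abs_homDensity_sub_le {V : Type*} [Fintype V] [DecidableEq V] (H : SimpleGraph V)
    [DecidableRel H.Adj] (F G : GraphonSpace) :
    |homDensity H F - homDensity H G| ≤ H.edgeFinset.card * dist F G := by
  obtain ⟨f, rfl⟩ := SeparationQuotient.surjective_mk F
  obtain ⟨g, rfl⟩ := SeparationQuotient.surjective_mk G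
  exact Graphon.abs_homDensity_sub_le H f g

theorem mem_classesOf_iff {A : Set Graphon} {F : GraphonSpace} :
    F ∈ classesOf A ↔ ∃ g ∈ A, F = mk g := by
  simp only [classesOf, mem_ofPred_eq, dist_eq_zero]

theorem mk_splitPart (hp : p ∈ Ioo (0 : ℝ) 1) {hp' : p ∈ Icc (0 : ℝ) 1} {f : Graphon}
    (hf : f ∈ supportedGraphons (bipartiteGraphon γ p hp')) : mk (splitPart γ f) = mk f := by
  rw [eq_comm, mk_eq_mk_iff]
  exact dist_splitPart hp hf

theorem mem_classesOf_supportedGraphons_iff (hp : p ∈ Ioo (0 : ℝ) 1) {hp' : p ∈ Icc (0 : ℝ) 1}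
    {F : GraphonSpace} : F ∈ classesOf (supportedGraphons (bipartiteGraphon γ p hp')) ↔
      ∃ g, IsSplit γ g ∧ F = mk g := by
  rw [mem_classesOf_iff]
  constructor
  · rintro ⟨g, hg, rfl⟩
    exact ⟨_, splitPart_isSplit γ g, (mk_splitPart hp hg).symm⟩
  · rintro ⟨g, hg, rfl⟩
    exact ⟨g, hg.mem_supportedGraphons hp, rfl⟩

/-- The infimum over each ball is at most the rate, so some point of the ball has small entropy;
being finite, its entropy permits passing to the split part. -/
theorem exists_isSplit_of_rateFunction_lt (hp : p ∈ Ioo (0 : ℝ) 1) {hp' : p ∈ Icc (0 : ℝ) 1}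
    {F : GraphonSpace} {a : ℝ} (h : rateFunction (bipartiteGraphon γ p hp') F < ENNReal.ofReal a)
    {η : ℝ} (hη : 0 < η) :
    ∃ f, IsSplit γ f ∧ dist F (mk f) ≤ η ∧ offEntropy γ p f < a := by
  rw [rateFunction] at h
  split_ifs at h with hF
  · have h1 := (le_iSup (fun η : {η : ℝ // 0 < η} => ⨅ h : {h : Graphon // dist F (mk h) ≤ η},
      relEntropyFunctional (bipartiteGraphon γ p hp') h) ⟨η, hη⟩).trans_lt h
    obtain ⟨⟨f, hf⟩, hfa⟩ := iInf_lt_iff.1 h1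
    have hs := mem_supportedGraphons_of_lt_top hp (hfa.trans_le le_top)
    refine ⟨splitPart γ f, splitPart_isSplit γ f, by rwa [mk_splitPart hp hs], ?_⟩
    simp only at hfa
    rw [← relEntropyFunctional_splitPart hp hs,
      (splitPart_isSplit γ f).relEntropyFunctional_eq hp] at hfa
    exact (ENNReal.ofReal_lt_ofReal_iff'.1 hfa).1
  · exact absurd h (not_lt.2 le_top)

theorem rateFunction_mk_le (hp : p ∈ Ioo (0 : ℝ) 1) {hp' : p ∈ Icc (0 : ℝ) 1}
    {f : Graphon} (hf : IsSplit γ f) :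
    rateFunction (bipartiteGraphon γ p hp') (mk f) ≤ ENNReal.ofReal (offEntropy γ p f) := by
  rw [rateFunction, if_pos ((mem_classesOf_supportedGraphons_iff hp).2 ⟨f, hf, rfl⟩)]
  refine iSup_le fun η => (iInf_le _ ⟨f, ?_⟩).trans (hf.relEntropyFunctional_eq hp).le
  rw [dist_self]; exact η.2.le

end GraphonSpace

/-! ### Moment and entropy under a density constraint -/

namespace Graphon

variable {V : Type*} [Fintype V] [DecidableEq V] {H : SimpleGraph V} [DecidableRel H.Adj]
  {γ p r : ℝ} {d : ℕ}

theorem setIntegral_offBlock_const (hγ : γ ∈ Ioo (0 : ℝ) 1) (c : ℝ) :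
    ∫ _ in offBlock γ, c = γ * (1 - γ) * c := by
  rw [setIntegral_const, volume_real_offBlock hγ, smul_eq_mul]

theorem offMoment_bipartiteGraphon (hγ : γ ∈ Ioo (0 : ℝ) 1) (hr : r ∈ Icc (0 : ℝ) 1) (d : ℕ) :
    offMoment γ d (bipartiteGraphon γ r hr) = γ * (1 - γ) * r ^ d := by
  rw [← setIntegral_offBlock_const hγ, offMoment]
  refine setIntegral_congr_fun (measurableSet_offBlock γ) fun z hz => ?_
  simp only [bipartiteGraphon_apply_off hr hz.1 hz.2]

theorem offEntropy_bipartiteGraphon (hγ : γ ∈ Ioo (0 : ℝ) 1) (hr : r ∈ Icc (0 : ℝ) 1) :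
    offEntropy γ p (bipartiteGraphon γ r hr) = γ * (1 - γ) * binRelEntropy p r := by
  rw [← setIntegral_offBlock_const hγ, offEntropy]
  refine setIntegral_congr_fun (measurableSet_offBlock γ) fun z hz => ?_
  simp only [bipartiteGraphon_apply_off hr hz.1 hz.2]

theorem homDensity_bipartiteGraphon (hd : 1 ≤ d) (hreg : H.IsRegularOfDegree d)
    (hγ : γ ∈ Ioo (0 : ℝ) 1) (hr : r ∈ Icc (0 : ℝ) 1) :
    homDensity H (bipartiteGraphon γ r hr) =
      H.boolColorings.card * (γ * (1 - γ) * r ^ d) ^ (Fintype.card V / 2) := by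
  rw [homDensity_eq_of_rows hd hreg (bipartiteGraphon_isSplit γ hr) (κ := fun _ => r)
    fun x hx y hy => bipartiteGraphon_apply_off hr hx hy, offMoment_bipartiteGraphon hγ hr]

theorem offMoment_nonneg (γ : ℝ) (d : ℕ) (f : Graphon) : 0 ≤ offMoment γ d f :=
  integral_nonneg fun _ => pow_nonneg (f.nonneg _ _) d

omit [DecidableEq V] in
theorem half_card_pos [Nonempty V] (hd : 1 ≤ d) (hreg : H.IsRegularOfDegree d) :
    Fintype.card V / 2 ≠ 0 := by
  obtain ⟨v⟩ := ‹Nonempty V›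
  have h := H.degree_lt_card_verts v
  rw [hreg.degree_eq] at h
  omega

theorem strictMono_density [Nonempty V] (hd : 1 ≤ d) (hreg : H.IsRegularOfDegree d)
    (hbip : H.IsBipartite) {x y : ℝ} (hx : 0 ≤ x) (hxy : x < y) :
    (H.boolColorings.card : ℝ) * x ^ (Fintype.card V / 2) <
      H.boolColorings.card * y ^ (Fintype.card V / 2) :=
  mul_lt_mul_of_pos_left (pow_lt_pow_left₀ hxy hx (half_card_pos hd hreg))
    (by exact_mod_cast SimpleGraph.boolColorings_card_pos hbip)

/-- A split graphon with homomorphism density almost that of `f_r` has `d`-th moment almost that of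
`f_r`. -/
theorem exists_offMoment_lower_bound [Nonempty V] (hd : 1 ≤ d) (hreg : H.IsRegularOfDegree d)
    (hbip : H.IsBipartite) (hγ : γ ∈ Ioo (0 : ℝ) 1) (hr : r ∈ Icc (0 : ℝ) 1) (hr0 : 0 < r)
    {ε : ℝ} (hε : 0 < ε) :
    ∃ δ > 0, ∀ f : Graphon, IsSplit γ f →
      homDensity H (bipartiteGraphon γ r hr) - δ ≤ homDensity H f →
        γ * (1 - γ) * r ^ d - ε ≤ offMoment γ d f := by
  set M : ℝ := γ * (1 - γ) * r ^ d with hM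
  have hMpos : 0 < M := mul_pos (mul_pos hγ.1 (by linarith [hγ.2])) (pow_pos hr0 d)
  -- Truncation at `0` keeps `x` where the power is monotone.
  set x : ℝ := max (M - ε) 0 with hx
  have hx0 : 0 ≤ x := le_max_right _ _
  have hxM : x < M := max_lt (by linarith) hMpos
  have hlt := strictMono_density (H := H) hd hreg hbip hx0 hxM
  refine ⟨(H.boolColorings.card * M ^ (Fintype.card V / 2) -
    H.boolColorings.card * x ^ (Fintype.card V / 2)) / 2, by linarith, fun f hf hfd => ?_⟩
  rw [homDensity_bipartiteGraphon hd hreg hγ hr] at hfd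
  by_contra! hcon
  have h1 := homDensity_le (H := H) hd hreg hf
  have h2 : offMoment γ d f ≤ x := hcon.le.trans (le_max_left _ _)
  have h3 : (H.boolColorings.card : ℝ) * offMoment γ d f ^ (Fintype.card V / 2) ≤
      H.boolColorings.card * x ^ (Fintype.card V / 2) :=
    mul_le_mul_of_nonneg_left (pow_le_pow_left₀ (offMoment_nonneg γ d f) h2 _) (Nat.cast_nonneg _)
  linarith

theorem integrableOn_offEntropy (hp : p ∈ Ioo (0 : ℝ) 1) (f : Graphon) :
    IntegrableOn (fun z => binRelEntropy p (f z.1 z.2)) (offBlock γ) :=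
  integrable_comp_continuous f (continuous_binRelEntropy hp) _

theorem integrableOn_offMoment (f : Graphon) :
    IntegrableOn (fun z => f z.1 z.2 ^ d) (offBlock γ) :=
  integrable_comp_continuous f (continuous_pow d) _

theorem entropy_sub_offEntropy_le (hp : p ∈ Ioo (0 : ℝ) 1) (hγ : γ ∈ Ioo (0 : ℝ) 1) {ε C : ℝ}
    (h : ∀ u ∈ Icc (0 : ℝ) 1, binRelEntropy p r - binRelEntropy p u ≤ ε + C * (r ^ d - u ^ d))
    (f : Graphon) :
    γ * (1 - γ) * binRelEntropy p r - offEntropy γ p f ≤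
      γ * (1 - γ) * ε + C * (γ * (1 - γ) * r ^ d - offMoment γ d f) := by
  have hE := integrableOn_offEntropy (γ := γ) hp f
  have hM := integrableOn_offMoment (γ := γ) (d := d) f
  have hc : ∀ c : ℝ, IntegrableOn (fun _ => c) (offBlock γ) := fun c => integrable_const c
  have h2 : IntegrableOn (fun z => C * (r ^ d - f z.1 z.2 ^ d)) (offBlock γ) :=
    ((hc (r ^ d)).sub hM).const_mul C
  have := integral_mono (f := fun z : unitInterval × unitInterval =>
      binRelEntropy p r - binRelEntropy p (f z.1 z.2))
    (g := fun z => ε + C * (r ^ d - f z.1 z.2 ^ d)) ((hc (binRelEntropy p r)).sub hE)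
    ((hc ε).add h2) fun z => h _ (f.mem_Icc' z.1 z.2)
  rw [integral_sub (hc _) hE, integral_add (hc _) h2, integral_const_mul,
    integral_sub (hc _) hM] at this
  simpa only [setIntegral_offBlock_const hγ, offEntropy, offMoment] using this

theorem integral_abs_sub_le (hp : p ∈ Ioo (0 : ℝ) 1) (hγ : γ ∈ Ioo (0 : ℝ) 1) {ε C₁ C₂ : ℝ}
    (h : ∀ u ∈ Icc (0 : ℝ) 1,
      |u - r| ≤ ε + C₁ * (binRelEntropy p u - binRelEntropy p r) + C₂ * (r ^ d - u ^ d))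
    (f : Graphon) :
    ∫ z in offBlock γ, |f z.1 z.2 - r| ≤
      γ * (1 - γ) * ε + C₁ * (offEntropy γ p f - γ * (1 - γ) * binRelEntropy p r) +
        C₂ * (γ * (1 - γ) * r ^ d - offMoment γ d f) := by
  have hE := integrableOn_offEntropy (γ := γ) hp f
  have hM := integrableOn_offMoment (γ := γ) (d := d) f
  have hA := integrable_comp_continuous f (g := fun u => |u - r|) (by fun_prop) (offBlock γ)
  have hc : ∀ c : ℝ, IntegrableOn (fun _ => c) (offBlock γ) := fun c => integrable_const c
  have h1 : IntegrableOn (fun z => C₁ * (binRelEntropy p (f z.1 z.2) - binRelEntropy p r))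
      (offBlock γ) := (hE.sub (hc (binRelEntropy p r))).const_mul C₁
  have h2 : IntegrableOn (fun z => C₂ * (r ^ d - f z.1 z.2 ^ d)) (offBlock γ) :=
    ((hc (r ^ d)).sub hM).const_mul C₂
  have h12 : IntegrableOn (fun z => ε + C₁ * (binRelEntropy p (f z.1 z.2) - binRelEntropy p r))
      (offBlock γ) := (hc ε).add h1
  have := integral_mono (f := fun z : unitInterval × unitInterval => |f z.1 z.2 - r|)
    (g := fun z => ε + C₁ * (binRelEntropy p (f z.1 z.2) - binRelEntropy p r) +
      C₂ * (r ^ d - f z.1 z.2 ^ d)) hA (h12.add h2) fun z => h _ (f.mem_Icc' z.1 z.2)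
  rw [integral_add h12 h2, integral_add (hc _) h1, integral_const_mul, integral_const_mul,
    integral_sub hE (hc _), integral_sub (hc _) hM] at this
  simpa only [setIntegral_offBlock_const hγ, offEntropy, offMoment] using this

end Graphon

/-! ### The rate at a point of the convex minorant -/

namespace GraphonSpace

open Graphon

variable {V : Type*} [Fintype V] [DecidableEq V] [Nonempty V] {H : SimpleGraph V}
  [DecidableRel H.Adj] {γ p r : ℝ} {d : ℕ}

omit [Nonempty V] in
/-- Split graphons with controlled entropy and density near a point of finite rate. -/
theorem exists_isSplit_near (hp : p ∈ Ioo (0 : ℝ) 1) {hp' : p ∈ Icc (0 : ℝ) 1}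
    {F : GraphonSpace} {a t : ℝ}
    (h : rateFunction (bipartiteGraphon γ p hp') F < ENNReal.ofReal a) (ht : t ≤ homDensity H F)
    {η δ : ℝ} (hη : 0 < η) (hδ : 0 < δ) :
    ∃ f, IsSplit γ f ∧ dist F (mk f) ≤ η ∧ offEntropy γ p f < a ∧
      t - δ ≤ Graphon.homDensity H f := by
  set e : ℝ := (H.edgeFinset.card : ℝ) with he
  have he0 : 0 ≤ e := Nat.cast_nonneg _
  -- The density is `e`-Lipschitz, so radius `δ / (e + 1)` costs at most `δ`.
  obtain ⟨f, hf, hd, hI⟩ := exists_isSplit_of_rateFunction_lt hp h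
    (lt_min hη (by positivity : 0 < δ / (e + 1)))
  refine ⟨f, hf, hd.trans (min_le_left _ _), hI, ?_⟩
  have h1 := abs_homDensity_sub_le H F (mk f)
  have h2 : e * dist F (mk f) ≤ δ := by
    have := mul_le_mul_of_nonneg_left (hd.trans (min_le_right _ _)) he0
    refine this.trans ?_
    rw [mul_div_assoc', div_le_iff₀ (by linarith)]
    nlinarith
  rw [homDensity_mk] at h1
  have := (abs_le.1 (h1.trans h2)).2
  linarith

/-- The lower bound on the rate function under a density constraint. -/
theorem le_rateFunction (hd : 1 ≤ d) (hreg : H.IsRegularOfDegree d) (hbip : H.IsBipartite)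
    (hγ : γ ∈ Ioo (0 : ℝ) 1) (hp : p ∈ Ioo (0 : ℝ) 1) {hp' : p ∈ Icc (0 : ℝ) 1}
    (hr : r ∈ Icc p 1) (hr' : r ∈ Icc (0 : ℝ) 1)
    (hcm : OnConvexMinorant (rootEntropy p d) (r ^ d) (binRelEntropy p r)) {F : GraphonSpace}
    (hF : Graphon.homDensity H (bipartiteGraphon γ r hr') ≤ homDensity H F) :
    ENNReal.ofReal (γ * (1 - γ) * binRelEntropy p r) ≤
      rateFunction (bipartiteGraphon γ p hp') F := by
  by_contra! hlt
  obtain ⟨a, ha1, ha2⟩ := exists_between hlt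
  have hatop : a ≠ ∞ := (ha2.trans_le le_top).ne
  rw [← ENNReal.ofReal_toReal hatop] at ha1 ha2
  have ha3 := (ENNReal.ofReal_lt_ofReal_iff'.1 ha2).1
  set w := γ * (1 - γ) with hw
  have hw0 : 0 < w := mul_pos hγ.1 (by linarith [hγ.2])
  have hw1 : w ≤ 1 := by nlinarith [hγ.1, hγ.2]
  -- Half the gap: one `ε` pays for the pointwise bound, the other for the defect of the moment.
  set ε := (w * binRelEntropy p r - a.toReal) / 2 with hε
  have hε0 : 0 < ε := by linarith
  obtain ⟨C, hC, hCu⟩ := exists_entropy_lower_bound hp hd hr hcm hε0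
  obtain ⟨δ, hδ, hM⟩ := exists_offMoment_lower_bound (H := H) hd hreg hbip hγ hr'
    (hp.1.trans_le hr.1) (by positivity : 0 < ε / (C + 1))
  obtain ⟨f, hf, -, hI, ht⟩ := exists_isSplit_near (H := H) hp ha1 hF one_pos hδ
  have h1 := entropy_sub_offEntropy_le hp hγ hCu f
  have h2 := hM f hf ht
  have h3 : C * (w * r ^ d - offMoment γ d f) ≤ C * (ε / (C + 1)) :=
    mul_le_mul_of_nonneg_left (by linarith) hC
  have h4 : C * (ε / (C + 1)) < ε := by
    rw [mul_div_assoc', div_lt_iff₀ (by linarith)]; nlinarith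
  have h5 : w * ε ≤ ε := by nlinarith
  linarith

/-- At a point of the convex minorant, `f_r` is the only possible minimizer. -/
theorem eq_mk_of_rateFunction_le (hd : 1 ≤ d) (hreg : H.IsRegularOfDegree d)
    (hbip : H.IsBipartite) (hγ : γ ∈ Ioo (0 : ℝ) 1) (hp : p ∈ Ioo (0 : ℝ) 1)
    {hp' : p ∈ Icc (0 : ℝ) 1} (hr : r ∈ Icc p 1) (hr' : r ∈ Icc (0 : ℝ) 1)
    (hcm : OnConvexMinorant (rootEntropy p d) (r ^ d) (binRelEntropy p r)) {F : GraphonSpace}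
    (hF : Graphon.homDensity H (bipartiteGraphon γ r hr') ≤ homDensity H F)
    (hJ : rateFunction (bipartiteGraphon γ p hp') F ≤
      ENNReal.ofReal (γ * (1 - γ) * binRelEntropy p r)) :
    F = mk (bipartiteGraphon γ r hr') := by
  refine dist_le_zero.1 (le_of_forall_pos_le_add fun ε hε => ?_)
  rw [zero_add]
  set w := γ * (1 - γ) with hw
  have hw0 : 0 < w := mul_pos hγ.1 (by linarith [hγ.2])
  have hw1 : w ≤ 1 := by nlinarith [hγ.1, hγ.2]
  -- Three terms of size `ε/8` bound the `L¹` distance on the block; it is doubled by symmetry, and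
  -- the approximation of `F` adds another `ε/8`, in total `7ε/8`.
  have hε8 : 0 < ε / 8 := by positivity
  obtain ⟨C₁, C₂, hC₁, hC₂, hCu⟩ := exists_entropy_stability hp hd hr hcm hε8
  obtain ⟨δ, hδ, hM⟩ := exists_offMoment_lower_bound (H := H) hd hreg hbip hγ hr'
    (hp.1.trans_le hr.1) (by positivity : 0 < ε / 8 / (C₂ + 1))
  have hr0 : 0 ≤ binRelEntropy p r := binRelEntropy_nonneg_of_mem hp hr'
  have hJ' : rateFunction (bipartiteGraphon γ p hp') F <
      ENNReal.ofReal (w * binRelEntropy p r + ε / 8 / (C₁ + 1)) := by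
    refine hJ.trans_lt ((ENNReal.ofReal_lt_ofReal_iff (by positivity)).2 ?_)
    have : 0 < ε / 8 / (C₁ + 1) := by positivity
    linarith
  obtain ⟨f, hf, hdist, hI, ht⟩ := exists_isSplit_near (H := H) hp hJ' hF
    (by positivity : 0 < ε / 8) hδ
  have h1 := integral_abs_sub_le hp hγ hCu f
  have h2 := hM f hf ht
  have key : ∀ C x : ℝ, 0 ≤ C → x ≤ ε / 8 / (C + 1) → C * x ≤ ε / 8 := fun C x hC hx => by
    refine (mul_le_mul_of_nonneg_left hx hC).trans ?_
    rw [mul_div_assoc', div_le_iff₀ (by linarith)]; nlinarith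
  have h3 := key C₂ (w * r ^ d - offMoment γ d f) hC₂ (by linarith)
  have h4 := key C₁ (offEntropy γ p f - w * binRelEntropy p r) hC₁ (by linarith)
  have h5 : w * (ε / 8) ≤ ε / 8 := by nlinarith
  have h6 : dist (mk f) (mk (bipartiteGraphon γ r hr')) ≤ 2 * ∫ z in offBlock γ, |f z.1 z.2 - r| := by
    refine (cutMetric_le_cutDist _ _).trans
      ((hf.cutDist_le (bipartiteGraphon_isSplit γ hr')).trans (le_of_eq ?_))
    congr 1
    refine setIntegral_congr_fun (measurableSet_offBlock γ) fun z hz => ?_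
    simp only [bipartiteGraphon_apply_off hr' hz.1 hz.2]
  have := dist_triangle F (mk f) (mk (bipartiteGraphon γ r hr'))
  linarith

end GraphonSpace

/-! ### Measure-preserving permutations of intervals -/

namespace Graphon

/-- A finite system of disjoint half-open subintervals of `[0,1]`, with the map that sends a point
to the index of its interval. -/
structure IntervalSystem (I : Type*) where
  /-- The left end point. -/
  start : I → ℝ
  /-- The length. -/
  len : I → ℝ
  /-- The index of the interval of a point. -/
  index : unitInterval → Option I
  index_eq_some : ∀ x i, index x = some i ↔ start i < x ∧ (x : ℝ) ≤ start i + len i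
  start_nonneg : ∀ i, 0 ≤ start i
  end_le_one : ∀ i, start i + len i ≤ 1

namespace IntervalSystem

variable {I : Type*} (B : IntervalSystem I)

theorem shift_mem {π : Equiv.Perm I} (hπ : ∀ i, B.len (π i) = B.len i) {x : unitInterval} {i : I}
    (h : B.index x = some i) :
    (x : ℝ) - B.start i + B.start (π i) ∈ Ioc (B.start (π i)) (B.start (π i) + B.len (π i)) := by
  have := (B.index_eq_some x i).1 h
  rw [hπ]
  constructor <;> linarith [this.1, this.2]

/-- The piecewise translation that permutes the intervals. -/
def permFun (π : Equiv.Perm I) (hπ : ∀ i, B.len (π i) = B.len i) (x : unitInterval) :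
    unitInterval :=
  match h : B.index x with
  | none => x
  | some i => ⟨x - B.start i + B.start (π i), by
      have := B.shift_mem hπ h
      exact ⟨(B.start_nonneg _).trans this.1.le, this.2.trans (B.end_le_one _)⟩⟩

theorem permFun_of_none {π : Equiv.Perm I} (hπ : ∀ i, B.len (π i) = B.len i) {x : unitInterval}
    (h : B.index x = none) : B.permFun π hπ x = x := by
  unfold permFun
  split
  · rfl
  · simp_all

theorem coe_permFun_of_some {π : Equiv.Perm I} (hπ : ∀ i, B.len (π i) = B.len i)
    {x : unitInterval} {i : I} (h : B.index x = some i) :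
    (B.permFun π hπ x : ℝ) = x - B.start i + B.start (π i) := by
  unfold permFun
  split
  · simp_all
  · rename_i j hj
    rw [h] at hj
    obtain rfl := Option.some.inj hj
    rfl

theorem index_permFun {π : Equiv.Perm I} (hπ : ∀ i, B.len (π i) = B.len i) (x : unitInterval) :
    B.index (B.permFun π hπ x) = (B.index x).map π := by
  cases h : B.index x with
  | none => rw [B.permFun_of_none hπ h, h]; rfl
  | some i =>
    rw [Option.map_some, B.index_eq_some, B.coe_permFun_of_some hπ h]
    exact B.shift_mem hπ h

theorem len_symm {π : Equiv.Perm I} (hπ : ∀ i, B.len (π i) = B.len i) (i : I) :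
    B.len (π.symm i) = B.len i := by
  have := hπ (π.symm i)
  rw [Equiv.apply_symm_apply] at this
  exact this.symm

theorem permFun_symm_permFun {π π' : Equiv.Perm I} (hπ : ∀ i, B.len (π i) = B.len i)
    (hπ' : ∀ i, B.len (π' i) = B.len i) (hinv : ∀ i, π' (π i) = i) (x : unitInterval) :
    B.permFun π' hπ' (B.permFun π hπ x) = x := by
  have h1 := B.index_permFun hπ x
  cases h : B.index x with
  | none => rw [B.permFun_of_none hπ h, B.permFun_of_none hπ' h]
  | some i =>
    rw [h, Option.map_some] at h1
    ext
    rw [B.coe_permFun_of_some hπ' h1, B.coe_permFun_of_some hπ h, hinv]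
    ring

theorem measurableSet_index_some (i : I) : MeasurableSet {x | B.index x = some i} := by
  simp only [B.index_eq_some]
  exact (measurableSet_lt measurable_const measurable_subtype_coe).inter
    (measurableSet_le measurable_subtype_coe measurable_const)

theorem measurableSet_index_none [Finite I] : MeasurableSet {x | B.index x = none} := by
  have : {x | B.index x = none} = (⋃ i, {x | B.index x = some i})ᶜ := by
    ext x
    cases h : B.index x <;> simp [h]
  rw [this]
  exact (MeasurableSet.iUnion fun i => B.measurableSet_index_some i).compl

theorem preimage_eq_iUnion (s : Set unitInterval) :
    s = ⋃ o : Option I, s ∩ {x | B.index x = o} := by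
  ext x; simp

theorem measurable_permFun [Finite I] {π : Equiv.Perm I} (hπ : ∀ i, B.len (π i) = B.len i) :
    Measurable (B.permFun π hπ) := by
  refine Measurable.subtype_mk (f := fun x => (B.permFun π hπ x : ℝ)) (h := fun x =>
    (B.permFun π hπ x).2) ?_
  intro s hs
  rw [B.preimage_eq_iUnion (_ ⁻¹' s)]
  refine MeasurableSet.iUnion fun o => ?_
  cases o with
  | none =>
    have : (fun x => (B.permFun π hπ x : ℝ)) ⁻¹' s ∩ {x | B.index x = none} =
        (fun x : unitInterval => (x : ℝ)) ⁻¹' s ∩ {x | B.index x = none} := by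
      ext x
      refine and_congr_left fun h => ?_
      simp only [mem_preimage]
      rw [B.permFun_of_none hπ h]
    rw [this]
    exact (measurable_subtype_coe hs).inter B.measurableSet_index_none
  | some i =>
    have : (fun x => (B.permFun π hπ x : ℝ)) ⁻¹' s ∩ {x | B.index x = some i} =
        (fun x : unitInterval => (x : ℝ) - B.start i + B.start (π i)) ⁻¹' s ∩
          {x | B.index x = some i} := by
      ext x
      refine and_congr_left fun h => ?_
      simp only [mem_preimage]
      rw [B.coe_permFun_of_some hπ h]
    rw [this]
    have hm : Measurable fun x : unitInterval => (x : ℝ) - B.start i + B.start (π i) := by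
      fun_prop
    exact (hm hs).inter (B.measurableSet_index_some i)

/-- On one interval the map is a translation, so the claim is translation invariance of Lebesgue
measure on `ℝ`. -/
theorem volume_preimage_inter {π : Equiv.Perm I} (hπ : ∀ i, B.len (π i) = B.len i) (i : I)
    (s : Set unitInterval) :
    volume (B.permFun π hπ ⁻¹' s ∩ {x | B.index x = some i}) =
      volume (s ∩ {x | B.index x = some (π i)}) := by
  have hvol : ∀ t : Set unitInterval, volume t = volume ((↑) '' t : Set ℝ) := fun t => by
    rw [Measure.Subtype.volume_def,
      (MeasurableEmbedding.subtype_coe measurableSet_Icc).comap_apply]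
  have : ((↑) '' (B.permFun π hπ ⁻¹' s ∩ {x | B.index x = some i}) : Set ℝ) =
      (fun x : ℝ => x + (B.start (π i) - B.start i)) ⁻¹'
        ((↑) '' (s ∩ {x | B.index x = some (π i)})) := by
    ext x
    constructor
    · rintro ⟨y, ⟨hy, hyi⟩, rfl⟩
      refine ⟨B.permFun π hπ y, ⟨hy, ?_⟩, ?_⟩
      · have := B.index_permFun hπ y
        rw [show B.index y = some i from hyi] at this
        exact this
      · rw [B.coe_permFun_of_some hπ hyi]; ring
    · rintro ⟨y, ⟨hy, hyi⟩, hxy⟩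
      have hyi' : B.index y = some (π i) := hyi
      have h2 : B.index (B.permFun π.symm (B.len_symm hπ) y) = some i := by
        rw [B.index_permFun, hyi']; simp
      refine ⟨B.permFun π.symm (B.len_symm hπ) y, ⟨?_, h2⟩, ?_⟩
      · rw [mem_preimage, B.permFun_symm_permFun _ _ (by simp)]
        exact hy
      · rw [B.coe_permFun_of_some _ hyi', Equiv.symm_apply_apply]
        have hxy' : (y : ℝ) = x + (B.start (π i) - B.start i) := hxy
        rw [hxy']; ring
  rw [hvol, this, measure_preimage_add_right, ← hvol]

variable [Fintype I]

theorem measurePreserving_permFun {π : Equiv.Perm I} (hπ : ∀ i, B.len (π i) = B.len i) :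
    MeasurePreserving (B.permFun π hπ) volume volume := by
  have hm := B.measurable_permFun hπ
  refine ⟨hm, Measure.ext fun s hs => ?_⟩
  rw [Measure.map_apply hm hs]
  have hmeas : ∀ o : Option I, MeasurableSet {x | B.index x = o} := fun o => by
    cases o with
    | none => exact B.measurableSet_index_none
    | some i => exact B.measurableSet_index_some i
  have hsum : ∀ t : Set unitInterval, MeasurableSet t →
      volume t = ∑ o : Option I, volume (t ∩ {x | B.index x = o}) := fun t ht => by
    conv_lhs => rw [B.preimage_eq_iUnion t]
    rw [measure_iUnion, tsum_fintype]
    · intro o o' hoo'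
      refine Set.disjoint_left.2 fun x hx hx' => hoo' ?_
      exact hx.2.symm.trans hx'.2
    · exact fun o => ht.inter (hmeas o)
  rw [hsum _ (hm hs), hsum _ hs, Fintype.sum_option, Fintype.sum_option]
  congr 1
  · congr 1
    ext x
    refine and_congr_left fun h => ?_
    rw [mem_preimage, B.permFun_of_none hπ h]
  · simp_rw [B.volume_preimage_inter hπ]
    exact Equiv.sum_comp π fun i => volume (s ∩ {x | B.index x = some i})

/-- The measure-preserving bijection that permutes the intervals of a system. -/
def permMPBij (π : Equiv.Perm I) (hπ : ∀ i, B.len (π i) = B.len i) : MPBij :=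
  ⟨{ toFun := B.permFun π hπ
     invFun := B.permFun π.symm (B.len_symm hπ)
     left_inv := B.permFun_symm_permFun _ _ (by simp)
     right_inv := B.permFun_symm_permFun _ _ (by simp)
     measurable_toFun := B.measurable_permFun hπ
     measurable_invFun := B.measurable_permFun (B.len_symm hπ) }, B.measurePreserving_permFun hπ⟩

omit [Fintype I] in
theorem volume_real_index (hl : ∀ i, 0 ≤ B.len i) (i : I) :
    volume.real {x | B.index x = some i} = B.len i := by
  have : {x | B.index x = some i} = ((↑) : unitInterval → ℝ) ⁻¹'
      Ioc (B.start i) (B.start i + B.len i) := by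
    ext x; simp only [mem_preimage, mem_Ioc, ← B.index_eq_some]; rfl
  have hsub : Ioc (B.start i) (B.start i + B.len i) ⊆ unitInterval := fun x hx =>
    ⟨(B.start_nonneg i).trans hx.1.le, hx.2.trans (B.end_le_one i)⟩
  rw [this, Measure.real, Measure.Subtype.volume_def,
    (MeasurableEmbedding.subtype_coe measurableSet_Icc).comap_apply,
    Subtype.image_preimage_coe, inter_eq_right.2 hsub]
  simp [hl i]

end IntervalSystem

/-- The splitting of `(0,γ]` and `(γ,1]` into `N` intervals of equal length each. -/
def gridSystem {γ : ℝ} (hγ : γ ∈ Ioo (0 : ℝ) 1) {N : ℕ} (hN : N ≠ 0) :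
    IntervalSystem (Bool × Fin N) where
  start i := if i.1 then γ * (i.2 / N) else γ + (1 - γ) * (i.2 / N)
  len i := if i.1 then γ / N else (1 - γ) / N
  index x :=
    if h : 0 < (x : ℝ) then
      if h' : (x : ℝ) ≤ γ then some (true, ⟨⌈(x : ℝ) / γ * N⌉₊ - 1, by
        have h1 : ⌈(x : ℝ) / γ * N⌉₊ ≤ N := Nat.ceil_le.2
          (mul_le_of_le_one_left (Nat.cast_nonneg _) ((div_le_one hγ.1).2 h'))
        omega⟩)
      else some (false, ⟨⌈((x : ℝ) - γ) / (1 - γ) * N⌉₊ - 1, by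
        have h1 : ⌈((x : ℝ) - γ) / (1 - γ) * N⌉₊ ≤ N := Nat.ceil_le.2
          (mul_le_of_le_one_left (Nat.cast_nonneg _)
            ((div_le_one (by linarith [hγ.2])).2 (by linarith [x.2.2])))
        omega⟩)
    else none
  index_eq_some := by
    have hN0 : (0 : ℝ) < N := by positivity
    have hγ1 : 0 < 1 - γ := by linarith [hγ.2]
    -- The cells are open on the left and closed on the right, hence the ceiling minus one. The
    -- point `0` belongs to no cell.
    have key : ∀ (y l : ℝ) (k : ℕ), 0 < l → 0 < y →
        (⌈y / l * N⌉₊ - 1 = k ↔ l * (k / N) < y ∧ y ≤ l * (k / N) + l / N) := by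
      intro y l k hl hy
      have hpos : 0 < ⌈y / l * N⌉₊ := Nat.ceil_pos.2 (by positivity)
      have e : ⌈y / l * N⌉₊ - 1 = k ↔ ⌈y / l * N⌉₊ = k + 1 := by omega
      rw [e, Nat.ceil_eq_iff (by omega), Nat.add_sub_cancel]
      refine and_congr ?_ ?_
      · rw [div_mul_eq_mul_div, lt_div_iff₀ hl, mul_div_assoc', div_lt_iff₀ hN0, mul_comm l]
      · rw [div_mul_eq_mul_div, div_le_iff₀ hl, mul_div_assoc', ← add_div, le_div_iff₀ hN0]
        push_cast
        rw [show ((k : ℝ) + 1) * l = l * k + l by ring]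
    rintro x ⟨b, k⟩
    have hk : (k : ℝ) / N + 1 / N ≤ 1 := by
      rw [← add_div, div_le_one hN0]
      exact_mod_cast k.2
    have hk0 : 0 ≤ (k : ℝ) / N := by positivity
    have hin : 0 < 1 / (N : ℝ) := by positivity
    by_cases hx : 0 < (x : ℝ)
    · by_cases hx' : (x : ℝ) ≤ γ
      · rw [dif_pos hx, dif_pos hx']
        cases b
        · simp only [Option.some.injEq, Prod.mk.injEq, Bool.true_eq_false, false_and, false_iff,
            Bool.false_eq_true, if_false, not_and]
          intro h
          nlinarith [mul_nonneg hγ1.le hk0]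
        · simp only [Option.some.injEq, Prod.mk.injEq, true_and, if_true, Fin.ext_iff]
          exact key x γ k hγ.1 hx
      · rw [dif_pos hx, dif_neg hx']
        cases b
        · simp only [Option.some.injEq, Prod.mk.injEq, true_and, Bool.false_eq_true, if_false,
            Fin.ext_iff]
          rw [key (x - γ) (1 - γ) k hγ1 (by linarith)]
          constructor <;> rintro ⟨h1, h2⟩ <;> constructor <;> linarith
        · simp only [Option.some.injEq, Prod.mk.injEq, Bool.false_eq_true, false_and, false_iff,
            if_true, not_and, not_le]
          intro h
          have : γ * ((k : ℝ) / N + 1 / N) ≤ γ := mul_le_of_le_one_right hγ.1.le hk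
          rw [mul_add, mul_one_div] at this
          linarith
    · rw [dif_neg hx]
      simp only [reduceCtorEq, false_iff, not_and]
      intro h
      cases b
      · simp only [Bool.false_eq_true, if_false] at h
        nlinarith [mul_nonneg hγ1.le hk0, hγ.1]
      · simp only [if_true] at h
        nlinarith [mul_nonneg hγ.1.le hk0]
  start_nonneg i := by
    have hγ1 : 0 < 1 - γ := by linarith [hγ.2]
    have hγ0 := hγ.1
    split_ifs <;> positivity
  end_le_one i := by
    have hN0 : (0 : ℝ) < N := by positivity
    have hγ1 : 0 < 1 - γ := by linarith [hγ.2]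
    have hk : (i.2 : ℝ) / N + 1 / N ≤ 1 := by
      rw [← add_div, div_le_one hN0]
      exact_mod_cast i.2.2
    split_ifs
    · have : γ * ((i.2 : ℝ) / N + 1 / N) ≤ γ := mul_le_of_le_one_right hγ.1.le hk
      rw [mul_add, mul_one_div] at this
      linarith
    · have : (1 - γ) * ((i.2 : ℝ) / N + 1 / N) ≤ 1 - γ := mul_le_of_le_one_right hγ1.le hk
      rw [mul_add, mul_one_div] at this
      linarith

end Graphon

/-! ### Matching finite labellings -/

/-- Two labellings of a finite set can be matched by a permutation up to the differences of the
label counts. -/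
theorem Equiv.Perm.exists_card_mismatch_le {ι C : Type*} [Fintype ι] [Fintype C] [DecidableEq C]
    (s t : ι → C) : ∃ π : Equiv.Perm ι, (Finset.univ.filter fun i => s (π i) ≠ t i).card ≤
      ∑ c, ((Finset.univ.filter fun i => t i = c).card -
        (Finset.univ.filter fun i => s i = c).card) := by
  classical
  obtain ⟨π, -, hπ⟩ := Finset.exists_max_image (Finset.univ : Finset (Equiv.Perm ι))
    (fun π => (Finset.univ.filter fun i => s (π i) = t i).card) ⟨1, Finset.mem_univ _⟩
  refine ⟨π, ?_⟩
  rw [Finset.card_eq_sum_card_fiberwise (f := t) (t := Finset.univ) (by simp)]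
  refine Finset.sum_le_sum fun c _ => ?_
  rw [Finset.filter_filter]
  by_cases hex : ∃ i, s (π i) ≠ t i ∧ t i = c
  swap
  · rw [Finset.filter_eq_empty_iff.2 fun i _ h => hex ⟨i, h⟩]
    exact Nat.zero_le _
  obtain ⟨i, hi, hic⟩ := hex
  -- `π` has the most matches. If a position `j` held a label `c` not wanted there, while `i` lacks
  -- `c`, swapping `i` and `j` would gain a match. So, once `c` is lacking somewhere, every
  -- occurrence of `c` in `s` is matched, and the mismatches are what is left of the fibre of `t`.
  have claim : ∀ j, s (π j) = c → t j = c := by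
    intro j hj
    by_contra hjc
    have hij : i ≠ j := by rintro rfl; exact hi (hj.trans hic.symm)
    have hlt := hπ ((Equiv.swap i j).trans π) (Finset.mem_univ _)
    refine absurd hlt (not_le.2 (Finset.card_lt_card ?_))
    rw [Finset.ssubset_iff_of_subset]
    · refine ⟨i, ?_, by simpa using hi⟩
      refine Finset.mem_filter.2 ⟨Finset.mem_univ _, ?_⟩
      rw [Equiv.trans_apply, Equiv.swap_apply_left, hj, hic]
    · intro k hk
      simp only [Finset.mem_filter, Finset.mem_univ, true_and] at hk ⊢
      have hki : k ≠ i := by rintro rfl; exact hi hk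
      have hkj : k ≠ j := by rintro rfl; exact hjc (hk.symm.trans hj)
      simpa [Equiv.swap_apply_of_ne_of_ne hki hkj] using hk
  have h1 : (Finset.univ.filter fun i => s i = c).card =
      (Finset.univ.filter fun i => s (π i) = c).card := by
    symm
    refine Finset.card_bij (fun i _ => π i) (by simp) (fun _ _ _ _ h => π.injective h)
      fun b hb => ⟨π.symm b, by simpa using hb, by simp⟩
  have h2 : (Finset.univ.filter fun i => s (π i) = c).card +
      (Finset.univ.filter fun i => s (π i) ≠ t i ∧ t i = c).card ≤
        (Finset.univ.filter fun i => t i = c).card := by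
    rw [← Finset.card_union_of_disjoint]
    · refine Finset.card_le_card fun k hk => ?_
      simp only [Finset.mem_union, Finset.mem_filter, Finset.mem_univ, true_and] at hk ⊢
      exact hk.elim (claim k) fun h => h.2
    · refine Finset.disjoint_filter.2 fun k _ hk h => h.1 (hk.trans h.2.symm)
  omega

/-! ### Grid approximation and rearrangement of finitely valued maps -/

namespace Graphon

variable {γ : ℝ} {N : ℕ} (hγ : γ ∈ Ioo (0 : ℝ) 1) (hN : N ≠ 0)

theorem gridSystem_index_side {x : unitInterval} {i : Bool × Fin N}
    (h : (gridSystem hγ hN).index x = some i) : x ∈ leftPart γ ↔ i.1 = true := by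
  simp only [gridSystem] at h
  split_ifs at h with h1 h2
  · rw [← Option.some.inj h]
    exact iff_of_true h2 rfl
  · rw [← Option.some.inj h]
    exact iff_of_false h2 (by simp)

theorem gridSystem_index_none {x : unitInterval} (h : (gridSystem hγ hN).index x = none) :
    x = 0 := by
  simp only [gridSystem] at h
  split_ifs at h with h1
  exact Subtype.ext (le_antisymm (not_lt.1 h1) x.2.1)

theorem gridSystem_len_nonneg (i : Bool × Fin N) : 0 ≤ (gridSystem hγ hN).len i := by
  have h1 : 0 < 1 - γ := by linarith [hγ.2]
  have h0 := hγ.1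
  simp only [gridSystem]
  split_ifs <;> positivity

theorem gridSystem_len_le (i : Bool × Fin N) : (gridSystem hγ hN).len i ≤ 1 / N := by
  simp only [gridSystem]
  split_ifs <;> gcongr <;> linarith [hγ.1, hγ.2]

theorem volume_real_gridSystem_none :
    volume.real {x | (gridSystem hγ hN).index x = none} = 0 := by
  refine measureReal_mono_null (s₂ := {0}) (fun x hx => gridSystem_index_none hγ hN hx) ?_
  simp [Measure.real]

theorem gridSystem_dist_le {x : unitInterval} {i : Bool × Fin N}
    (h : (gridSystem hγ hN).index x = some i) {y : unitInterval}
    (hy : (y : ℝ) = (gridSystem hγ hN).start i + (gridSystem hγ hN).len i) :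
    dist x y ≤ 1 / N := by
  have h1 := ((gridSystem hγ hN).index_eq_some x i).1 h
  have h2 := gridSystem_len_le hγ hN i
  rw [Subtype.dist_eq, Real.dist_eq, abs_le]
  constructor <;> linarith [h1.1, h1.2]

/-- A measurable map with finitely many values is close to a map that is constant on the intervals of
every fine enough grid. -/
theorem exists_gridSystem_approx {C : Type*} [Fintype C] [Nonempty C] [MeasurableSpace C]
    [MeasurableSingletonClass C] {σ : unitInterval → C} (hσ : Measurable σ) {ε : ℝ} (hε : 0 < ε) :
    ∃ N₀ : ℕ, ∀ N ≥ N₀, ∀ hN : N ≠ 0, ∃ s : Bool × Fin N → C,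
      volume.real {x | ∃ i, (gridSystem hγ hN).index x = some i ∧ σ x ≠ s i} ≤ ε := by
  classical
  set e := Fintype.equivFin C
  set f : unitInterval → ℝ := fun x => (e (σ x) : ℕ) with hf
  have hfm : Measurable f := (measurable_of_finite fun c : C => ((e c : ℕ) : ℝ)).comp hσ
  have hfi : Integrable f := Integrable.of_bound hfm.aestronglyMeasurable (Fintype.card C)
    (Filter.Eventually.of_forall fun x => by
      rw [Real.norm_eq_abs, abs_of_nonneg (Nat.cast_nonneg _)]
      exact Nat.cast_le.2 (e (σ x)).2.le)
  -- With values coded as integers, `σ` is `L¹`-close to a continuous, hence uniformly continuous,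
  -- function; on each fine cell the label is read off by rounding its value at the right end point.
  obtain ⟨g, hg, hgi⟩ := hfi.exists_boundedContinuous_integral_sub_le
    (by positivity : 0 < ε / 4)
  have huc := CompactSpace.uniformContinuous_of_continuous g.continuous
  obtain ⟨δ, hδ, hgδ⟩ := Metric.uniformContinuous_iff.1 huc (1 / 4) (by norm_num)
  obtain ⟨N₀, hN₀⟩ := exists_nat_gt (1 / δ)
  refine ⟨N₀, fun N hNN hN => ?_⟩
  have hN0 : (0 : ℝ) < N := by positivity
  have hNδ : 1 / (N : ℝ) < δ := by
    rw [div_lt_comm₀ hN0 hδ]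
    exact hN₀.trans_le (by exact_mod_cast hNN)
  set B := gridSystem hγ hN with hB
  set y : Bool × Fin N → unitInterval := fun i => ⟨B.start i + B.len i,
    add_nonneg (B.start_nonneg i) (gridSystem_len_nonneg hγ hN i), B.end_le_one i⟩ with hy
  set s : Bool × Fin N → C := fun i =>
    if h : ∃ c, |((e c : ℕ) : ℝ) - g (y i)| < 1 / 2 then h.choose else Classical.arbitrary C with hs
  refine ⟨s, ?_⟩
  -- If `f` is within `1/4` of `g` at `x`, both integer codes are within `1/2` of the value of `g`
  -- at the end point, hence equal. Markov's inequality bounds the remaining points.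
  have hsub : {x | ∃ i, B.index x = some i ∧ σ x ≠ s i} ⊆ {x | 1 / 4 ≤ ‖f x - g x‖} := by
    rintro x ⟨i, hi, hne⟩
    by_contra hlt
    simp only [mem_ofPred_eq, not_le, Real.norm_eq_abs] at hlt
    have h1 := hgδ ((gridSystem_dist_le hγ hN hi (y := y i) rfl).trans_lt hNδ)
    rw [Real.dist_eq] at h1
    have h2 : |f x - g (y i)| < 1 / 2 := by
      have := abs_sub_le (f x) (g x) (g (y i))
      linarith
    have hex : ∃ c, |((e c : ℕ) : ℝ) - g (y i)| < 1 / 2 := ⟨σ x, h2⟩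
    have h3 : |((e (s i) : ℕ) : ℝ) - g (y i)| < 1 / 2 := by
      simp only [hs, dif_pos hex]
      exact hex.choose_spec
    have h4 : |((e (σ x) : ℕ) : ℝ) - ((e (s i) : ℕ) : ℝ)| < 1 := by
      have := abs_sub_le ((e (σ x) : ℕ) : ℝ) (g (y i)) ((e (s i) : ℕ) : ℝ)
      rw [abs_sub_comm (g (y i))] at this
      simp only [hf] at h2
      linarith
    refine hne (e.injective (Fin.ext ?_))
    have h5 : |((e (σ x) : ℕ) : ℤ) - ((e (s i) : ℕ) : ℤ)| < 1 := by exact_mod_cast h4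
    have := Int.abs_lt_one_iff.1 h5
    omega
  have hmark := mul_meas_ge_le_integral_of_nonneg (μ := volume) (f := fun x => ‖f x - g x‖)
    (Filter.Eventually.of_forall fun _ => norm_nonneg _) (hfi.sub hgi).norm (1 / 4)
  have := measureReal_mono hsub (μ := volume)
  linarith

/-- Permuting a grid separately on the two sides preserves the sides. -/
theorem permMPBij_preserves_side {π : Equiv.Perm (Bool × Fin N)} (hπ : ∀ i, (π i).1 = i.1)
    (hl : ∀ i, (gridSystem hγ hN).len (π i) = (gridSystem hγ hN).len i) (x : unitInterval) :
    ((gridSystem hγ hN).permMPBij π hl).1 x ∈ leftPart γ ↔ x ∈ leftPart γ := by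
  change (gridSystem hγ hN).permFun π hl x ∈ leftPart γ ↔ x ∈ leftPart γ
  cases h : (gridSystem hγ hN).index x with
  | none => rw [IntervalSystem.permFun_of_none _ _ h]
  | some i =>
    have h2 := (gridSystem hγ hN).index_permFun hl x
    rw [h, Option.map_some] at h2
    rw [gridSystem_index_side hγ hN h, gridSystem_index_side hγ hN h2, hπ]

/-- The side `[0,γ]` or `(γ,1]`. -/
def side (γ : ℝ) (b : Bool) : Set unitInterval := {x | x ∈ leftPart γ ↔ b = true}

theorem volume_real_label_eq {C : Type*} [DecidableEq C] (s : Bool × Fin N → C) (b : Bool) (c : C) :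
    volume.real {x | ∃ k, (gridSystem hγ hN).index x = some (b, k) ∧ s (b, k) = c} =
      (Finset.univ.filter fun k => s (b, k) = c).card * (if b then γ / N else (1 - γ) / N) := by
  have : {x | ∃ k, (gridSystem hγ hN).index x = some (b, k) ∧ s (b, k) = c} =
      ⋃ k ∈ Finset.univ.filter (fun k => s (b, k) = c),
        {x | (gridSystem hγ hN).index x = some (b, k)} := by
    ext x; simp [and_comm]
  rw [this, measureReal_biUnion_finset]
  · rw [← nsmul_eq_mul]
    refine Finset.sum_eq_card_nsmul fun k _ => ?_
    rw [IntervalSystem.volume_real_index _ (gridSystem_len_nonneg hγ hN)]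
    rfl
  · intro k _ k' _ hkk'
    refine Set.disjoint_left.2 fun x hx hx' => hkk' ?_
    have := (show _ = _ from hx).symm.trans hx'
    simpa using this
  · exact fun k _ => IntervalSystem.measurableSet_index_some _ _

/-- Two finitely-valued measurable maps with almost the same distribution on each side are almost
equal after a measure-preserving bijection that preserves the sides. -/
theorem exists_rearrangement (hγ : γ ∈ Ioo (0 : ℝ) 1) {C : Type*} [Fintype C] [Nonempty C]
    [MeasurableSpace C]
    [MeasurableSingletonClass C] {σ τ : unitInterval → C} (hσ : Measurable σ) (hτ : Measurable τ)
    {η : ℝ} (h : ∀ b c, volume.real (τ ⁻¹' {c} ∩ side γ b) ≤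
      volume.real (σ ⁻¹' {c} ∩ side γ b) + η) {ε : ℝ} (hε : 0 < ε) :
    ∃ φ : MPBij, (∀ x, φ.1 x ∈ leftPart γ ↔ x ∈ leftPart γ) ∧
      volume.real {x | σ (φ.1 x) ≠ τ x} ≤ 2 * Fintype.card C * |η| + ε := by
  classical
  set n : ℝ := (Fintype.card C : ℝ) with hn
  have hn0 : 0 ≤ n := Nat.cast_nonneg _
  -- The two grid approximations cost `2 ε₁`, and the mismatched cells cost `2 n (|η| + 2 ε₁)`.
  set ε₁ : ℝ := ε / (4 * n + 2) with hε₁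
  have hε₁0 : 0 < ε₁ := by positivity
  obtain ⟨N₁, hN₁⟩ := exists_gridSystem_approx hγ hσ hε₁0
  obtain ⟨N₂, hN₂⟩ := exists_gridSystem_approx hγ hτ hε₁0
  set N := max (max N₁ N₂) 1 with hNdef
  have hN : N ≠ 0 := by omega
  obtain ⟨s, hs⟩ := hN₁ N (by omega) hN
  obtain ⟨t, ht⟩ := hN₂ N (by omega) hN
  choose π hπ using fun b => Equiv.Perm.exists_card_mismatch_le (fun k => s (b, k))
    (fun k => t (b, k))
  -- The cells of either side are permuted among themselves; they have equal length, so the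
  -- permutation is realized by a measure-preserving map.
  set ρ : Equiv.Perm (Bool × Fin N) := Equiv.prodShear (Equiv.refl Bool) π with hρ
  have hρ1 : ∀ i, (ρ i).1 = i.1 := fun i => rfl
  have hl : ∀ i, (gridSystem hγ hN).len (ρ i) = (gridSystem hγ hN).len i := fun i => rfl
  set B := gridSystem hγ hN with hB
  refine ⟨B.permMPBij ρ hl, permMPBij_preserves_side hγ hN hρ1 hl, ?_⟩
  set l : Bool → ℝ := fun b => if b then γ / N else (1 - γ) / N with hldef
  have hl0 : ∀ b, 0 ≤ l b := fun b => gridSystem_len_nonneg hγ hN (b, ⟨0, by omega⟩)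
  set E := {x | ∃ i, B.index x = some i ∧ σ x ≠ s i} with hE
  set E' := {x | ∃ i, B.index x = some i ∧ τ x ≠ t i} with hE'
  have hcount : ∀ b c, l b * (((Finset.univ.filter fun k => t (b, k) = c).card -
      (Finset.univ.filter fun k => s (b, k) = c).card : ℕ) : ℝ) ≤ |η| + 2 * ε₁ := by
    intro b c
    rcases le_total (Finset.univ.filter fun k => t (b, k) = c).card
      (Finset.univ.filter fun k => s (b, k) = c).card with hle | hle
    · rw [Nat.sub_eq_zero_of_le hle]
      have := abs_nonneg η
      simp only [Nat.cast_zero, mul_zero]; linarith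
    rw [Nat.cast_sub hle, mul_sub, mul_comm, ← volume_real_label_eq hγ hN t b c, mul_comm (l b),
      ← volume_real_label_eq hγ hN s b c]
    have h1 : volume.real {x | ∃ k, B.index x = some (b, k) ∧ t (b, k) = c} ≤
        volume.real (τ ⁻¹' {c} ∩ side γ b) + ε₁ := by
      refine (measureReal_mono (s₂ := (τ ⁻¹' {c} ∩ side γ b) ∪ E') ?_).trans
        ((measureReal_union_le _ _).trans (by linarith))
      rintro x ⟨k, hk, hkc⟩
      by_cases hx : τ x = t (b, k)
      · exact Or.inl ⟨hx.trans hkc, gridSystem_index_side hγ hN hk⟩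
      · exact Or.inr ⟨_, hk, hx⟩
    have h2 : volume.real (σ ⁻¹' {c} ∩ side γ b) ≤
        volume.real {x | ∃ k, B.index x = some (b, k) ∧ s (b, k) = c} + ε₁ := by
      refine (measureReal_mono (s₂ := ({x | ∃ k, B.index x = some (b, k) ∧ s (b, k) = c} ∪ E) ∪
        {x | B.index x = none}) ?_).trans ((measureReal_union_le _ _).trans ?_)
      · rintro x ⟨hx, hxb⟩
        cases hi : B.index x with
        | none => exact Or.inr hi
        | some i =>
          refine Or.inl ?_
          by_cases hxs : σ x = s i
          · refine Or.inl ⟨i.2, ?_, ?_⟩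
            · have h3 := gridSystem_index_side hγ hN hi
              have h4 : (x ∈ leftPart γ ↔ b = true) := hxb
              have : i.1 = b := by rw [h3] at h4; exact Bool.eq_iff_iff.2 h4
              rw [← this]; exact hi
            · have h3 := gridSystem_index_side hγ hN hi
              have h4 : (x ∈ leftPart γ ↔ b = true) := hxb
              have : i.1 = b := by rw [h3] at h4; exact Bool.eq_iff_iff.2 h4
              rw [← this]; exact hxs.symm.trans hx
          · exact Or.inr ⟨i, hi, hxs⟩
      · rw [volume_real_gridSystem_none hγ hN, add_zero]
        exact (measureReal_union_le _ _).trans (by linarith)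
    have := h b c
    have := le_abs_self η
    linarith
  have hmis : ∀ b, l b * ((Finset.univ.filter fun k => s (b, π b k) ≠ t (b, k)).card : ℝ) ≤
      n * (|η| + 2 * ε₁) := by
    intro b
    refine (mul_le_mul_of_nonneg_left (Nat.cast_le.2 (hπ b)) (hl0 b)).trans ?_
    rw [Nat.cast_sum, Finset.mul_sum]
    refine (Finset.sum_le_card_nsmul _ _ _ fun c _ => hcount b c).trans ?_
    rw [nsmul_eq_mul, Finset.card_univ]
  have hbad : volume.real (⋃ i ∈ Finset.univ.filter (fun i => s (ρ i) ≠ t i),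
      {x | B.index x = some i}) ≤ 2 * (n * (|η| + 2 * ε₁)) := by
    refine (measureReal_biUnion_finset_le _ _).trans ?_
    simp only [B.volume_real_index (gridSystem_len_nonneg hγ hN)]
    rw [Finset.sum_filter, Fintype.sum_prod_type, Fintype.sum_bool, two_mul]
    refine add_le_add ?_ ?_
    · refine le_trans (le_of_eq ?_) (hmis true)
      rw [mul_comm, ← nsmul_eq_mul, ← Finset.sum_const, Finset.sum_filter]
      rfl
    · refine le_trans (le_of_eq ?_) (hmis false)
      rw [mul_comm, ← nsmul_eq_mul, ← Finset.sum_const, Finset.sum_filter]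
      rfl
  have hEm : volume.real ((B.permMPBij ρ hl).1 ⁻¹' E) = volume.real E := by
    rw [Measure.real, Measure.real, (B.permMPBij ρ hl).2.measure_preimage_equiv]
  have hcover : {x | σ ((B.permMPBij ρ hl).1 x) ≠ τ x} ⊆
      (((B.permMPBij ρ hl).1 ⁻¹' E ∪ E') ∪ {x | B.index x = none}) ∪
      ⋃ i ∈ Finset.univ.filter (fun i => s (ρ i) ≠ t i), {x | B.index x = some i} := by
    intro x hx
    cases hi : B.index x with
    | none => exact Or.inl (Or.inr hi)
    | some i =>
      have h2 := B.index_permFun hl x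
      rw [hi, Option.map_some] at h2
      by_cases h3 : σ (B.permFun ρ hl x) = s (ρ i)
      · by_cases h4 : τ x = t i
        · refine Or.inr ?_
          simp only [mem_iUnion]
          refine ⟨i, ?_, hi⟩
          simp only [Finset.mem_filter, Finset.mem_univ, true_and]
          rw [← h3, ← h4]
          exact hx
        · exact Or.inl (Or.inl (Or.inr ⟨i, hi, h4⟩))
      · exact Or.inl (Or.inl (Or.inl ⟨ρ i, h2, h3⟩))
  have hfin := measureReal_mono (μ := volume) hcover
  have hu := measureReal_union_le (μ := volume)
    (((B.permMPBij ρ hl).1 ⁻¹' E ∪ E') ∪ {x | B.index x = none})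
    (⋃ i ∈ Finset.univ.filter (fun i => s (ρ i) ≠ t i), {x | B.index x = some i})
  have hu2 := measureReal_union_le (μ := volume) ((B.permMPBij ρ hl).1 ⁻¹' E ∪ E')
    {x | B.index x = none}
  have hu3 := measureReal_union_le (μ := volume) ((B.permMPBij ρ hl).1 ⁻¹' E) E'
  rw [volume_real_gridSystem_none hγ hN] at hu2
  have hεeq : ε₁ * (4 * n + 2) = ε := div_mul_cancel₀ _ (by positivity)
  nlinarith

end Graphon

namespace Graphon

/-! ### Weak regularity -/

/-- The cut norm of `F` is at most `ε`. -/
def CutBound (F : unitInterval × unitInterval → ℝ) (ε : ℝ) : Prop :=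
  ∀ S T : Set unitInterval, MeasurableSet S → MeasurableSet T → |∫ z in S ×ˢ T, F z| ≤ ε

theorem CutBound.add {F G : unitInterval × unitInterval → ℝ} {a b : ℝ} (hF : CutBound F a)
    (hG : CutBound G b) (hF' : Integrable F) (hG' : Integrable G) :
    CutBound (fun z => F z + G z) (a + b) := fun S T hS hT => by
  rw [integral_add hF'.integrableOn hG'.integrableOn]
  exact (abs_add_le _ _).trans (add_le_add (hF S T hS hT) (hG S T hS hT))

theorem CutBound.neg {F : unitInterval × unitInterval → ℝ} {a : ℝ} (hF : CutBound F a) :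
    CutBound (fun z => -F z) a := fun S T hS hT => by
  rw [integral_neg, abs_neg]
  exact hF S T hS hT

theorem cutBound_of_integral_abs_le {F : unitInterval × unitInterval → ℝ} (hF : Integrable F)
    {a : ℝ} (h : ∫ z, |F z| ≤ a) : CutBound F a := fun _ _ _ _ =>
  (abs_integral_le_integral_abs.trans (setIntegral_le_integral hF.abs
    (Filter.Eventually.of_forall fun _ => abs_nonneg _))).trans h

theorem CutBound.comp {F : unitInterval × unitInterval → ℝ} {a : ℝ} (hF : CutBound F a)
    (φ : MPBij) : CutBound (fun z => F (φ.1 z.1, φ.1 z.2)) a := fun S T hS hT => by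
  have hmp : MeasurePreserving (φ.1.prodCongr φ.1) volume volume := φ.2.prod φ.2
  have h := hmp.setIntegral_preimage_emb (φ.1.prodCongr φ.1).measurableEmbedding F
    ((φ.1.symm ⁻¹' S) ×ˢ (φ.1.symm ⁻¹' T))
  have hpre : (φ.1.prodCongr φ.1) ⁻¹' ((φ.1.symm ⁻¹' S) ×ˢ (φ.1.symm ⁻¹' T)) = S ×ˢ T := by
    ext z
    simp [MeasurableEquiv.prodCongr]
  rw [hpre] at h
  have h' : ∫ z in S ×ˢ T, F (φ.1 z.1, φ.1 z.2) =
      ∫ z in (φ.1.symm ⁻¹' S) ×ˢ (φ.1.symm ⁻¹' T), F z := h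
  rw [h']
  exact hF _ _ (φ.1.symm.measurable hS) (φ.1.symm.measurable hT)

/-- The combination `∑ⱼ cⱼ 1_{Sⱼ × Tⱼ}`, with the sets `Sⱼ`, `Tⱼ` encoded by `σ`. -/
def rectSum {k : ℕ} (c : Fin k → ℝ) (σ : unitInterval → Fin k → Bool × Bool)
    (z : unitInterval × unitInterval) : ℝ :=
  ∑ j, c j * if (σ z.1 j).1 = true ∧ (σ z.2 j).2 = true then 1 else 0

theorem measurable_rectSum {k : ℕ} (c : Fin k → ℝ) {σ : unitInterval → Fin k → Bool × Bool}
    (hσ : Measurable σ) : Measurable (rectSum c σ) := by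
  refine Finset.measurable_fun_sum _ fun j _ => Measurable.const_mul (Measurable.ite ?_
    measurable_const measurable_const) _
  have h1 : Measurable fun z : unitInterval × unitInterval => (σ z.1 j).1 :=
    ((measurable_pi_apply j).comp (hσ.comp measurable_fst)).fst
  have h2 : Measurable fun z : unitInterval × unitInterval => (σ z.2 j).2 :=
    ((measurable_pi_apply j).comp (hσ.comp measurable_snd)).snd
  exact (h1 (measurableSet_singleton true)).inter (h2 (measurableSet_singleton true))

theorem abs_rectSum_sub_le {k : ℕ} {c c' : Fin k → ℝ} {δ : ℝ} (h : ∀ j, |c j - c' j| ≤ δ)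
    (σ : unitInterval → Fin k → Bool × Bool) (z : unitInterval × unitInterval) :
    |rectSum c σ z - rectSum c' σ z| ≤ k * δ := by
  rw [rectSum, rectSum, ← Finset.sum_sub_distrib]
  refine (Finset.abs_sum_le_sum_abs _ _).trans ?_
  refine (Finset.sum_le_card_nsmul _ _ δ fun j _ => ?_).trans (by simp)
  rw [← sub_mul, abs_mul]
  refine (mul_le_of_le_one_right (abs_nonneg _) ?_).trans (h j)
  split_ifs <;> simp

theorem abs_rectSum_le {k : ℕ} {c : Fin k → ℝ} (h : ∀ j, |c j| ≤ 1)
    (σ : unitInterval → Fin k → Bool × Bool) (z : unitInterval × unitInterval) :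
    |rectSum c σ z| ≤ k := by
  have := abs_rectSum_sub_le (c := c) (c' := 0) (δ := 1) (by simpa using h) σ z
  simpa [rectSum] using this

theorem integrable_rectSum {k : ℕ} {c : Fin k → ℝ} (h : ∀ j, |c j| ≤ 1)
    {σ : unitInterval → Fin k → Bool × Bool} (hσ : Measurable σ) : Integrable (rectSum c σ) :=
  Integrable.of_bound (measurable_rectSum c hσ).aestronglyMeasurable k
    (Filter.Eventually.of_forall fun z => abs_rectSum_le h σ z)

/-- Subtracting from `F` its integral over `R`, times the indicator of `R`, decreases the energy. -/
theorem integral_sq_sub_indicator_le {F : unitInterval × unitInterval → ℝ} (hF : Measurable F)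
    {M : ℝ} (hM : ∀ z, |F z| ≤ M) {R : Set (unitInterval × unitInterval)} (hR : MeasurableSet R) :
    ∫ z, (F z - (∫ z in R, F z) * R.indicator 1 z) ^ 2 ≤
      (∫ z, F z ^ 2) - (∫ z in R, F z) ^ 2 := by
  set a := ∫ z in R, F z with ha
  have hFi : Integrable F := Integrable.of_bound hF.aestronglyMeasurable M
    (Filter.Eventually.of_forall hM)
  have hF2 : Integrable fun z => F z ^ 2 :=
    Integrable.of_bound (hF.pow_const 2).aestronglyMeasurable (M ^ 2)
      (Filter.Eventually.of_forall fun z => by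
        rw [Real.norm_eq_abs, abs_pow]
        exact pow_le_pow_left₀ (abs_nonneg _) (hM z) 2)
  have h1 : ∀ z, (F z - a * R.indicator 1 z) ^ 2 =
      F z ^ 2 + R.indicator (fun z => -2 * a * F z + a ^ 2) z := fun z => by
    by_cases hz : z ∈ R
    · simp only [indicator_of_mem hz, Pi.one_apply]; ring
    · simp only [indicator_of_notMem hz]; ring
  have hlin : Integrable fun z => -2 * a * F z + a ^ 2 :=
    (hFi.const_mul _).add (integrable_const _)
  simp_rw [h1]
  rw [integral_add hF2 (hlin.indicator hR), integral_indicator hR,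
    integral_add (hFi.const_mul _).integrableOn (integrable_const _), integral_const_mul, ← ha,
    setIntegral_const, smul_eq_mul]
  -- The energy changes by `-2a² + a² vol(R)`.
  have hv : volume.real R ≤ 1 := measureReal_le_one
  nlinarith [sq_nonneg a]

/-- The weak regularity lemma: a kernel of bounded energy is, up to `ε` in cut norm, a bounded
combination of a bounded number of rectangles. -/
theorem exists_rectSum_cutBound {ε : ℝ} (hε : 0 < ε) : ∀ (k : ℕ)
    (F : unitInterval × unitInterval → ℝ), Measurable F → (∃ M, ∀ z, |F z| ≤ M) →
    ∫ z, F z ^ 2 ≤ 1 → ∫ z, F z ^ 2 ≤ k * ε ^ 2 →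
    ∃ (c : Fin k → ℝ) (σ : unitInterval → Fin k → Bool × Bool), (∀ j, |c j| ≤ 1) ∧ Measurable σ ∧
      CutBound (fun z => F z - rectSum c σ z) ε := by
  classical
  intro k
  induction k with
  | zero =>
    rintro F hF ⟨M, hM⟩ - hk
    refine ⟨Fin.elim0, fun _ => Fin.elim0, fun j => j.elim0, measurable_const, fun S T hS hT => ?_⟩
    have h := integral_sq_sub_indicator_le hF hM (hS.prod hT)
    have h0 : 0 ≤ ∫ z, (F z - (∫ z in S ×ˢ T, F z) * (S ×ˢ T).indicator 1 z) ^ 2 :=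
      integral_nonneg fun z => sq_nonneg _
    have : ∫ z in S ×ˢ T, F z = 0 := by
      have : (∫ z in S ×ˢ T, F z) ^ 2 ≤ 0 := by
        simp only [Nat.cast_zero, zero_mul] at hk; linarith
      exact pow_eq_zero_iff (two_ne_zero) |>.1 (le_antisymm this (sq_nonneg _))
    simp only [rectSum, Finset.univ_eq_empty, Finset.sum_empty, sub_zero]
    rw [this, abs_zero]
    exact hε.le
  | succ k ih =>
    rintro F hF ⟨M, hM⟩ h1 hk
    -- Either `F` is already small and zero coefficients pad the sum, or a violating rectangle is
    -- subtracted, which lowers the energy by at least `ε²`. With `k` units of energy this happens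
    -- at most `k` times.
    by_cases hcut : CutBound F ε
    · refine ⟨0, fun _ _ => (false, false), by simp, measurable_const, ?_⟩
      simpa [rectSum] using hcut
    simp only [CutBound, not_forall, not_le] at hcut
    obtain ⟨S, T, hS, hT, hST⟩ := hcut
    have hR := hS.prod hT
    have h := integral_sq_sub_indicator_le hF hM hR
    set a := ∫ z in S ×ˢ T, F z with ha
    have ha2 : ε ^ 2 ≤ a ^ 2 := by
      rw [← sq_abs a]; exact pow_le_pow_left₀ hε.le hST.le 2
    have h0 : 0 ≤ ∫ z, (F z - a * (S ×ˢ T).indicator 1 z) ^ 2 :=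
      integral_nonneg fun z => sq_nonneg _
    have hind : ∀ z, |(S ×ˢ T).indicator (1 : unitInterval × unitInterval → ℝ) z| ≤ 1 := fun z => by
      by_cases hz : z ∈ S ×ˢ T
      · simp only [indicator_of_mem hz, Pi.one_apply, abs_one, le_refl]
      · simp only [indicator_of_notMem hz, abs_zero, zero_le_one]
    have ha1 : |a| ≤ 1 := by
      rw [← sq_le_one_iff_abs_le_one]; linarith
    obtain ⟨c, σ, hc, hσ, hcσ⟩ := ih (fun z => F z - a * (S ×ˢ T).indicator 1 z)
      (hF.sub ((measurable_one.indicator hR).const_mul a)) ⟨M + 1, fun z => by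
        refine (abs_sub _ _).trans (add_le_add (hM z) ?_)
        rw [abs_mul]
        exact mul_le_one₀ ha1 (abs_nonneg _) (hind z)⟩
      (by linarith [sq_nonneg a]) (by push_cast at hk; linarith)
    refine ⟨Fin.cons a c, fun x => Fin.cons (decide (x ∈ S), decide (x ∈ T)) (σ x), ?_, ?_, ?_⟩
    · intro j
      refine Fin.cases ?_ (fun j => ?_) j
      · simpa using ha1
      · simpa using hc j
    · refine measurable_pi_lambda _ fun j => ?_
      refine Fin.cases ?_ (fun j => ?_) j
      · simp only [Fin.cons_zero]
        exact (measurable_to_bool (by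
          convert hS using 1; ext x; simp)).prodMk (measurable_to_bool (by
          convert hT using 1; ext x; simp))
      · simp only [Fin.cons_succ]
        exact (measurable_pi_apply j).comp hσ
    · intro S' T' hS' hT'
      have key : ∀ z, F z - rectSum (k := k + 1) (Fin.cons a c)
          (fun x => Fin.cons (decide (x ∈ S), decide (x ∈ T)) (σ x)) z =
          F z - a * (S ×ˢ T).indicator 1 z - rectSum c σ z := by
        intro z
        simp only [rectSum, Fin.sum_univ_succ, Fin.cons_zero, Fin.cons_succ, decide_eq_true_eq]
        rw [← sub_sub]
        congr 3
        by_cases hz : z ∈ S ×ˢ T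
        · rw [indicator_of_mem hz, if_pos (mem_prod.1 hz)]; rfl
        · rw [indicator_of_notMem hz, if_neg (mt mem_prod.2 hz)]
      simp only [key]
      exact hcσ S' T' hS' hT'

theorem exists_rectSum (f : Graphon) {ε : ℝ} (hε : 0 < ε) {k : ℕ} (hk : 1 ≤ k * ε ^ 2) :
    ∃ (c : Fin k → ℝ) (σ : unitInterval → Fin k → Bool × Bool), (∀ j, |c j| ≤ 1) ∧ Measurable σ ∧
      CutBound (fun z => f z.1 z.2 - rectSum c σ z) ε := by
  have h1 : ∫ z : unitInterval × unitInterval, f z.1 z.2 ^ 2 ≤ 1 := by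
    refine (integral_mono_of_nonneg (Filter.Eventually.of_forall fun z => sq_nonneg _)
      (integrable_const (1 : ℝ)) (Filter.Eventually.of_forall
        fun z : unitInterval × unitInterval => (pow_mem_Icc (f.mem_Icc' z.1 z.2) 2).2)).trans ?_
    simp
  exact exists_rectSum_cutBound hε k _ (f.measurable_comp measurable_fst measurable_snd)
    ⟨1, fun z => by rw [abs_of_nonneg (f.nonneg _ _)]; exact f.le_one _ _⟩ h1 (h1.trans hk)

/-! ### Rearranging step kernels -/

variable {γ : ℝ}

/-- Where both coordinates avoid the set on which `σ` and `τ` differ, only the coefficients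
contribute; on the two strips over that set the trivial bound `2k` is used. -/
theorem integral_abs_rectSum_sub_le {k : ℕ} {c c' : Fin k → ℝ} (hc : ∀ j, |c j| ≤ 1)
    (hc' : ∀ j, |c' j| ≤ 1) {δ : ℝ} (hδ : ∀ j, |c j - c' j| ≤ δ)
    {σ τ : unitInterval → Fin k → Bool × Bool} (hσ : Measurable σ) (hτ : Measurable τ) :
    ∫ z, |rectSum c σ z - rectSum c' τ z| ≤ k * δ + 4 * k * volume.real {x | σ x ≠ τ x} := by
  set E : Set unitInterval := {x | σ x ≠ τ x} with hE
  have hEm : MeasurableSet E := (measurableSet_eq_fun hσ hτ).compl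
  have hle : ∀ z : unitInterval × unitInterval, |rectSum c σ z - rectSum c' τ z| ≤
      k * δ + ((E ×ˢ univ).indicator (fun _ => 2 * (k : ℝ)) z +
        ((univ : Set unitInterval) ×ˢ E).indicator (fun _ => 2 * (k : ℝ)) z) := by
    intro z
    have hk0 : (0 : ℝ) ≤ k := Nat.cast_nonneg _
    have hkδ : 0 ≤ k * δ := (abs_nonneg _).trans (abs_rectSum_sub_le hδ σ z)
    have h2 : |rectSum c σ z - rectSum c' τ z| ≤ 2 * k :=
      (abs_sub _ _).trans (by linarith [abs_rectSum_le hc σ z, abs_rectSum_le hc' τ z])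
    have hnn : ∀ (A : Set (unitInterval × unitInterval)), 0 ≤ A.indicator (fun _ => 2 * (k : ℝ)) z :=
      fun A => indicator_nonneg (fun _ _ => by positivity) z
    by_cases h1 : z.1 ∈ E
    · rw [indicator_of_mem (show z ∈ E ×ˢ (univ : Set unitInterval) from ⟨h1, trivial⟩)]
      linarith [hnn (univ ×ˢ E)]
    · by_cases h3 : z.2 ∈ E
      · rw [indicator_of_mem (show z ∈ (univ : Set unitInterval) ×ˢ E from ⟨trivial, h3⟩)]
        linarith [hnn (E ×ˢ univ)]
      · have e : rectSum c' τ z = rectSum c' σ z := by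
          simp only [hE, mem_ofPred_eq, not_not] at h1 h3
          rw [rectSum, rectSum, h1, h3]
        rw [e]
        linarith [abs_rectSum_sub_le hδ σ z, hnn (E ×ˢ univ), hnn (univ ×ˢ E)]
  have i1 : Integrable ((E ×ˢ (univ : Set unitInterval)).indicator fun _ => 2 * (k : ℝ)) :=
    (integrable_const _).indicator (hEm.prod .univ)
  have i2 : Integrable (((univ : Set unitInterval) ×ˢ E).indicator fun _ => 2 * (k : ℝ)) :=
    (integrable_const _).indicator (MeasurableSet.univ.prod hEm)
  have v1 : volume.real (E ×ˢ (univ : Set unitInterval)) = volume.real E := by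
    rw [Measure.real, Measure.volume_eq_prod, Measure.prod_prod]; simp [Measure.real]
  have v2 : volume.real ((univ : Set unitInterval) ×ˢ E) = volume.real E := by
    rw [Measure.real, Measure.volume_eq_prod, Measure.prod_prod]; simp [Measure.real]
  have e1 : ∫ z : unitInterval × unitInterval, ((E ×ˢ univ).indicator (fun _ => 2 * (k : ℝ)) z +
      ((univ : Set unitInterval) ×ˢ E).indicator (fun _ => 2 * (k : ℝ)) z) =
      4 * k * volume.real E := by
    rw [integral_add i1 i2, integral_indicator (hEm.prod .univ),
      integral_indicator (MeasurableSet.univ.prod hEm), setIntegral_const, setIntegral_const, v1,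
      v2, smul_eq_mul]
    ring
  have i3 : Integrable fun z => (E ×ˢ (univ : Set unitInterval)).indicator (fun _ => 2 * (k : ℝ)) z +
      ((univ : Set unitInterval) ×ˢ E).indicator (fun _ => 2 * (k : ℝ)) z := i1.add i2
  refine (integral_mono (f := fun z => |rectSum c σ z - rectSum c' τ z|)
    ((integrable_rectSum hc hσ).sub (integrable_rectSum hc' hτ)).abs
    ((integrable_const (k * δ)).add i3) hle).trans (le_of_eq ?_)
  refine (integral_add (integrable_const _) i3).trans ?_
  rw [e1]
  simp

end Graphon

/-! ### Weak limits of `[0,1]`-valued functions -/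

/-- The functions are bounded in `L²`, so Banach–Alaoglu and the Riesz isomorphism give a weak
limit, tested here on indicators. The limit along an ultrafilter avoids subsequences. -/
theorem exists_weak_limit {α : Type*} [MeasurableSpace α] {μ : Measure α} [IsFiniteMeasure μ]
    (v : ℕ → α → ℝ) (hv : ∀ n, Measurable (v n)) (hv' : ∀ n a, v n a ∈ Icc (0 : ℝ) 1) :
    ∃ g : α → ℝ, Measurable g ∧ (∀ a, g a ∈ Icc (0 : ℝ) 1) ∧ ∀ R, MeasurableSet R →
      Filter.Tendsto (fun n => ∫ a in R, v n a ∂μ) (Filter.hyperfilter ℕ) (𝓝 (∫ a in R, g a ∂μ)) := by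
  have hmem : ∀ n, MemLp (v n) 2 μ := fun n => MemLp.of_bound (hv n).aestronglyMeasurable 1
    (Filter.Eventually.of_forall fun a => by
      rw [Real.norm_eq_abs, abs_of_nonneg (hv' n a).1]; exact (hv' n a).2)
  set u : ℕ → Lp ℝ 2 μ := fun n => (hmem n).toLp (v n) with hu
  have hbound : ∃ C : ℝ, ∀ n, ‖u n‖ ≤ C := by
    refine ⟨_, fun n => Lp.norm_le_of_ae_bound (C := 1) zero_le_one ?_⟩
    filter_upwards [(hmem n).coeFn_toLp] with a ha
    rw [ha, Real.norm_eq_abs, abs_of_nonneg (hv' n a).1]; exact (hv' n a).2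
  obtain ⟨C, hC⟩ := hbound
  set ℓ : ℕ → WeakDual ℝ (Lp ℝ 2 μ) := fun n =>
    StrongDual.toWeakDual (InnerProductSpace.toDual ℝ (Lp ℝ 2 μ) (u n)) with hℓ
  have hK := WeakDual.isCompact_closedBall (0 : StrongDual ℝ (Lp ℝ 2 μ)) C
  obtain ⟨L, -, hL⟩ := hK.ultrafilter_le_nhds ((Filter.hyperfilter ℕ).map ℓ) (by
    rw [Filter.le_principal_iff]
    refine Filter.mem_map.2 (Filter.univ_mem' fun n => ?_)
    simp only [mem_preimage, Metric.mem_closedBall, dist_zero_right]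
    change ‖InnerProductSpace.toDual ℝ (Lp ℝ 2 μ) (u n)‖ ≤ C
    rw [LinearIsometryEquiv.norm_map]
    exact hC n)
  have hL' : Filter.Tendsto ℓ (Filter.hyperfilter ℕ) (𝓝 L) := hL
  have hev : ∀ F : Lp ℝ 2 μ, Filter.Tendsto (fun n => ℓ n F) (Filter.hyperfilter ℕ) (𝓝 (L F)) :=
    fun F => ((WeakDual.eval_continuous F).tendsto L).comp hL'
  set w : Lp ℝ 2 μ := (InnerProductSpace.toDual ℝ (Lp ℝ 2 μ)).symm (WeakDual.toStrongDual L) with hw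
  have hconv : ∀ R, MeasurableSet R → Filter.Tendsto (fun n => ∫ a in R, v n a ∂μ)
      (Filter.hyperfilter ℕ) (𝓝 (∫ a in R, w a ∂μ)) := by
    intro R hR
    have h1 := hev (indicatorConstLp 2 hR (measure_ne_top μ R) (1 : ℝ))
    have h2 : ∀ n, ℓ n (indicatorConstLp 2 hR (measure_ne_top μ R) (1 : ℝ)) =
        ∫ a in R, v n a ∂μ := fun n => by
      change InnerProductSpace.toDual ℝ (Lp ℝ 2 μ) (u n) _ = _
      rw [InnerProductSpace.toDual_apply_apply, real_inner_comm, L2.inner_indicatorConstLp_one]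
      refine setIntegral_congr_ae hR ?_
      filter_upwards [(hmem n).coeFn_toLp] with a ha _ using ha
    have h3 : L (indicatorConstLp 2 hR (measure_ne_top μ R) (1 : ℝ)) = ∫ a in R, w a ∂μ := by
      rw [← L2.inner_indicatorConstLp_one (𝕜 := ℝ) hR (measure_ne_top μ R) w, real_inner_comm, hw,
        InnerProductSpace.toDual_symm_apply]
      rfl
    simpa only [h2, h3] using h1
  have hwi : Integrable w μ := (Lp.memLp w).integrable (by norm_num)
  have h0 : 0 ≤ᵐ[μ] w := ae_nonneg_of_forall_setIntegral_nonneg hwi fun s hs _ =>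
    ge_of_tendsto' (hconv s hs) fun n => integral_nonneg fun a => (hv' n a).1
  have h1 : 0 ≤ᵐ[μ] fun a => 1 - w a := by
    refine ae_nonneg_of_forall_setIntegral_nonneg ((integrable_const _).sub hwi) fun s hs _ => ?_
    rw [integral_sub (integrable_const _) hwi.integrableOn, sub_nonneg]
    refine le_of_tendsto' (hconv s hs) fun n => ?_
    refine integral_mono_of_nonneg (Filter.Eventually.of_forall fun a => (hv' n a).1)
      (integrable_const _) (Filter.Eventually.of_forall fun a => (hv' n a).2)
  -- `w` lies in `[0,1]` only almost everywhere; clamping makes this hold everywhere.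
  refine ⟨fun a => max 0 (min 1 (w a)), ?_, fun a => ⟨le_max_left _ _,
    max_le zero_le_one (min_le_left _ _)⟩, fun R hR => ?_⟩
  · exact measurable_const.max (measurable_const.min (Lp.stronglyMeasurable w).measurable)
  · convert hconv R hR using 2
    refine setIntegral_congr_ae hR ?_
    filter_upwards [h0, h1] with a ha0 ha1 _
    have h2 : 0 ≤ w a := ha0
    have h3 : 0 ≤ 1 - w a := ha1
    rw [min_eq_right (by linarith), max_eq_right h2]

namespace Graphon

variable {γ : ℝ}

theorem integrable (f : Graphon) : Integrable fun z : unitInterval × unitInterval => f z.1 z.2 :=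
  integrable_of_mem_Icc (f.measurable_comp measurable_fst measurable_snd) fun _ => f.mem_Icc' _ _

/-! ### The cut metric for side-preserving rearrangements -/

/-- The measure-preserving bijections that preserve `[0,γ]`. -/
abbrev SideBij (γ : ℝ) : Type := {φ : MPBij // ∀ x, φ.1 x ∈ leftPart γ ↔ x ∈ leftPart γ}

instance : Nonempty (SideBij γ) :=
  ⟨⟨⟨MeasurableEquiv.refl _, MeasurePreserving.id _⟩, fun _ => Iff.rfl⟩⟩

/-- The inverse of a side-preserving bijection. -/
def SideBij.inv (φ : SideBij γ) : SideBij γ := ⟨φ.1.inv, fun x => by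
  rw [← φ.2]
  exact iff_of_eq (congrArg (· ∈ leftPart γ) (φ.1.1.apply_symm_apply x))⟩

/-- The composition of side-preserving bijections. -/
def SideBij.comp (ψ φ : SideBij γ) : SideBij γ :=
  ⟨ψ.1.comp φ.1, fun x => (ψ.2 _).trans (φ.2 x)⟩

/-- The cut metric for side-preserving rearrangements. -/
def sideMetric (γ : ℝ) (f g : Graphon) : ℝ := ⨅ φ : SideBij γ, cutDist f (g.pullback φ.1)

theorem sideMetric_le (f g : Graphon) (φ : SideBij γ) :
    sideMetric γ f g ≤ cutDist f (g.pullback φ.1) :=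
  ciInf_le ⟨0, by rintro _ ⟨φ, rfl⟩; exact cutDist_nonneg _ _⟩ φ

theorem cutMetric_le_sideMetric (f g : Graphon) : cutMetric f g ≤ sideMetric γ f g :=
  le_ciInf fun φ => cutMetric_le f g φ.1

theorem sideMetric_self (f : Graphon) : sideMetric γ f f = 0 := by
  refine le_antisymm ?_ (le_ciInf fun φ => cutDist_nonneg _ _)
  exact (sideMetric_le f f ⟨⟨MeasurableEquiv.refl _, MeasurePreserving.id _⟩,
    fun _ => Iff.rfl⟩).trans (le_of_eq (cutDist_self f))

theorem sideMetric_comm (f g : Graphon) : sideMetric γ f g = sideMetric γ g f := by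
  have key : ∀ f g : Graphon, sideMetric γ f g ≤ sideMetric γ g f := fun f g =>
    le_ciInf fun φ => by
      refine (sideMetric_le f g φ.inv).trans ?_
      have h := cutDist_pullback_le (f.pullback φ.1) g φ.1.inv
      rw [pullback_inv_pullback] at h
      rw [cutDist_comm g]
      exact h
  exact le_antisymm (key f g) (key g f)

theorem sideMetric_triangle (f g h : Graphon) :
    sideMetric γ f h ≤ sideMetric γ f g + sideMetric γ g h :=
  le_ciInf_add_ciInf fun φ ψ => by
    refine (sideMetric_le f h (ψ.comp φ)).trans ?_
    exact (cutDist_triangle f (g.pullback φ.1) _).trans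
      (add_le_add le_rfl (cutDist_pullback_le g (h.pullback ψ.1) φ.1))

/-- The graphons with the cut metric for rearrangements that preserve `[0,γ]`. -/
structure SideGraphon (γ : ℝ) where
  /-- The underlying graphon. -/
  toGraphon : Graphon

instance : PseudoMetricSpace (SideGraphon γ) where
  dist f g := sideMetric γ f.toGraphon g.toGraphon
  dist_self _ := sideMetric_self _
  dist_comm _ _ := sideMetric_comm _ _
  dist_triangle _ _ _ := sideMetric_triangle _ _ _

theorem SideGraphon.dist_eq (f g : SideGraphon γ) :
    dist f g = sideMetric γ f.toGraphon g.toGraphon := rfl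

/-! ### Total boundedness -/

theorem exists_fin_discretization (B : ℝ) {δ : ℝ} (hδ : 0 < δ) :
    ∃ (M : ℕ) (q : ℝ → Fin M), ∀ s t, |s| ≤ B → |t| ≤ B → q s = q t → |s - t| ≤ δ := by
  -- Bins of width `δ`. The reduction modulo the number of bins has no effect when `|t| ≤ B`.
  refine ⟨⌊2 * B / δ⌋₊ + 1, fun t => Fin.ofNat _ ⌊(t + B) / δ⌋₊, fun s t hs ht h => ?_⟩
  have hlt : ∀ t, |t| ≤ B → ⌊(t + B) / δ⌋₊ < ⌊2 * B / δ⌋₊ + 1 := fun t ht =>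
    Nat.lt_succ_of_le (Nat.floor_le_floor (by gcongr; linarith [(abs_le.1 ht).2]))
  have h1 : ⌊(s + B) / δ⌋₊ = ⌊(t + B) / δ⌋₊ := by
    have := congrArg Fin.val h
    simpa only [Fin.ofNat, Nat.mod_eq_of_lt (hlt s hs), Nat.mod_eq_of_lt (hlt t ht)] using this
  have h0 : ∀ t, |t| ≤ B → 0 ≤ (t + B) / δ := fun t ht =>
    div_nonneg (by linarith [(abs_le.1 ht).1]) hδ.le
  have a1 := Nat.floor_le (h0 s hs)
  have a2 := Nat.lt_floor_add_one ((s + B) / δ)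
  have b1 := Nat.floor_le (h0 t ht)
  have b2 := Nat.lt_floor_add_one ((t + B) / δ)
  rw [h1] at a1 a2
  rw [le_div_iff₀ hδ] at a1 b1
  rw [div_lt_iff₀ hδ] at a2 b2
  rw [abs_le]
  constructor <;> linarith

/-- Three comparisons: `g` with its step kernel, that kernel with the rearranged step kernel of `f`,
and the latter with the rearranged `f`. The middle one is an `L¹` estimate. -/
theorem sideMetric_le_of_rectSum (hγ : γ ∈ Ioo (0 : ℝ) 1) {f g : Graphon} {e δ : ℝ} (hδ : 0 < δ)
    {k : ℕ} {c c' : Fin k → ℝ} {σ τ : unitInterval → Fin k → Bool × Bool}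
    (hc : ∀ j, |c j| ≤ 1) (hc' : ∀ j, |c' j| ≤ 1) (hσ : Measurable σ) (hτ : Measurable τ)
    (hf : CutBound (fun z => f z.1 z.2 - rectSum c σ z) e)
    (hg : CutBound (fun z => g z.1 z.2 - rectSum c' τ z) e)
    (hcc : ∀ j, |c' j - c j| ≤ δ)
    (hvol : ∀ b a, |volume.real (τ ⁻¹' {a} ∩ side γ b) - volume.real (σ ⁻¹' {a} ∩ side γ b)| ≤ δ) :
    sideMetric γ g f ≤
      2 * e + k * δ + 4 * k * (2 * Fintype.card (Fin k → Bool × Bool) * δ + δ) := by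
  obtain ⟨φ, hφ, hφ'⟩ := exists_rearrangement hγ hσ hτ (η := δ)
    (fun b a => by linarith [(abs_le.1 (hvol b a)).2]) hδ
  rw [abs_of_pos hδ] at hφ'
  have hσφ : Measurable fun x => σ (φ.1 x) := hσ.comp φ.1.measurable
  refine (sideMetric_le g f ⟨φ, hφ⟩).trans ?_
  have hmid : CutBound (fun z => rectSum c' τ z - rectSum c (fun x => σ (φ.1 x)) z)
      (k * δ + 4 * k * (2 * Fintype.card (Fin k → Bool × Bool) * δ + δ)) := by
    refine cutBound_of_integral_abs_le
      ((integrable_rectSum hc' hτ).sub (integrable_rectSum hc hσφ)) ?_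
    refine (integral_abs_rectSum_sub_le hc' hc hcc hτ hσφ).trans ?_
    simp only [ne_comm (a := τ _)]
    gcongr
  have hsum := (hg.add hmid (g.integrable.sub (integrable_rectSum hc' hτ))
    ((integrable_rectSum hc' hτ).sub (integrable_rectSum hc hσφ))).add (hf.comp φ).neg
    ((g.integrable.sub (integrable_rectSum hc' hτ)).add
      ((integrable_rectSum hc' hτ).sub (integrable_rectSum hc hσφ)))
    (((f.pullback φ).integrable.sub (integrable_rectSum hc hσφ)).neg)
  refine cutDist_le fun S T hS hT => ?_
  have := hsum S T hS hT
  refine (le_of_eq ?_).trans (this.trans (by linarith))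
  congr 2
  ext z
  change g z.1 z.2 - f (φ.1 z.1) (φ.1 z.2) = _ - (_ - rectSum c (fun x => σ (φ.1 x)) z)
  ring

/-- Up to `ε`, a graphon is determined by finitely many bounded numbers, rounded to `δ`: the
coefficients of a step kernel and the measures of its label sets on each side. Their number depends
on `ε` only. -/
theorem totallyBounded_sideGraphon (hγ : γ ∈ Ioo (0 : ℝ) 1) :
    TotallyBounded (univ : Set (SideGraphon γ)) := by
  refine Metric.totallyBounded_of_finite_discretization fun ε hε => ?_
  obtain ⟨k, hk⟩ := exists_nat_ge (1 / (ε / 4) ^ 2)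
  have hk1 : 1 ≤ k * (ε / 4) ^ 2 := by rwa [div_le_iff₀ (by positivity)] at hk
  choose c σ hc hσ hcut using fun f : Graphon => exists_rectSum f (by positivity : 0 < ε / 4) hk1
  set C := Fintype.card (Fin k → Bool × Bool)
  set D : ℝ := k + 4 * k * (2 * C + 1)
  have hD : 0 ≤ D := by positivity
  set δ : ℝ := ε / (4 * (D + 1)) with hδ
  have hδ0 : 0 < δ := by positivity
  have hDδ : D * δ ≤ ε / 4 := by
    rw [hδ, mul_div_assoc', div_le_div_iff₀ (by positivity) (by positivity)]
    nlinarith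
  obtain ⟨M, q, hq⟩ := exists_fin_discretization 1 hδ0
  refine ⟨(Fin k → Fin M) × (Bool → (Fin k → Bool × Bool) → Fin M), inferInstance,
    fun f => (fun j => q (c f.1.1 j),
      fun b a => q (volume.real (σ f.1.1 ⁻¹' {a} ∩ side γ b))), fun f g h => ?_⟩
  have h1 : ∀ j, |c f.1.1 j - c g.1.1 j| ≤ δ := fun j =>
    hq _ _ (hc _ j) (hc _ j) (congrFun (congrArg Prod.fst h) j)
  have hv : ∀ s : Set unitInterval, |volume.real s| ≤ 1 := fun s => by
    rw [abs_of_nonneg measureReal_nonneg]; exact measureReal_le_one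
  have h2 : ∀ b a, |volume.real (σ f.1.1 ⁻¹' {a} ∩ side γ b) -
      volume.real (σ g.1.1 ⁻¹' {a} ∩ side γ b)| ≤ δ := fun b a =>
    hq _ _ (hv _) (hv _) (congrFun (congrFun (congrArg Prod.snd h) b) a)
  have := sideMetric_le_of_rectSum hγ hδ0 (hc g.1.1) (hc f.1.1) (hσ g.1.1) (hσ f.1.1) (hcut g.1.1)
    (hcut f.1.1) h1 h2
  rw [SideGraphon.dist_eq]
  have e1 : 2 * (ε / 4) + k * δ + 4 * k * (2 * C * δ + δ) = 2 * (ε / 4) + D * δ := by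
    simp only [D]; ring
  linarith

/-! ### Completeness -/

/-- The integral over each fixed rectangle converges along the weak limit, so the cut bounds on the
tails pass to it. Averaging with the transpose makes the limit symmetric and changes none of these
integrals. -/
theorem exists_cut_limit (v : ℕ → Graphon)
    (hv : ∀ n, cutDist (v n) (v (n + 1)) ≤ (1 / 2) ^ n) :
    ∃ g : Graphon, ∀ n, cutDist (v n) g ≤ 2 * (1 / 2) ^ n := by
  obtain ⟨g, hgm, hg01, hg⟩ := exists_weak_limit (μ := (volume : Measure (unitInterval × unitInterval)))
    (fun n z => v n z.1 z.2) (fun n => (v n).measurable_comp measurable_fst measurable_snd)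
    fun n z => (v n).mem_Icc' _ _
  refine ⟨⟨fun x y => (g (x, y) + g (y, x)) / 2, fun x y => by rw [add_comm], fun x y => ?_, ?_⟩,
    fun n => ?_⟩
  · have h1 := hg01 (x, y); have h2 := hg01 (y, x)
    constructor <;> linarith [h1.1, h1.2, h2.1, h2.2]
  · exact (hgm.add (hgm.comp measurable_swap)).div_const 2
  have hgi : Integrable g := integrable_of_mem_Icc hgm hg01
  have hgi' : Integrable fun z : unitInterval × unitInterval => g z.swap :=
    integrable_of_mem_Icc (hgm.comp measurable_swap) fun z => hg01 z.swap
  refine cutDist_le fun S T hS hT => ?_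
  have hswap : ∀ F : unitInterval × unitInterval → ℝ,
      ∫ z in S ×ˢ T, F z.swap = ∫ z in T ×ˢ S, F z := fun F => by
    have h := (Measure.measurePreserving_swap (μ := (volume : Measure unitInterval))
      (ν := (volume : Measure unitInterval))).setIntegral_preimage_emb
      MeasurableEquiv.prodComm.measurableEmbedding F (T ×ˢ S)
    rw [preimage_swap_prod] at h
    exact h
  have hlim : Filter.Tendsto (fun m => ∫ z in S ×ˢ T, v m z.1 z.2) (Filter.hyperfilter ℕ)
      (𝓝 (∫ z in S ×ˢ T, (g (z.1, z.2) + g (z.2, z.1)) / 2)) := by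
    have h1 := hg _ (hS.prod hT)
    have h2 := hg _ (hT.prod hS)
    have h3 : ∀ m, ∫ z in T ×ˢ S, v m z.1 z.2 = ∫ z in S ×ˢ T, v m z.1 z.2 := fun m => by
      rw [← hswap]
      simp only [Prod.fst_swap, Prod.snd_swap, (v m).symm']
    simp only [h3] at h2
    have h4 : ∫ z in S ×ˢ T, (g (z.1, z.2) + g (z.2, z.1)) / 2 = ∫ z in S ×ˢ T, g z := by
      rw [integral_div]
      refine (congrArg (· / 2) (integral_add hgi.integrableOn hgi'.integrableOn)).trans ?_
      rw [hswap, ← tendsto_nhds_unique h1 h2, add_self_div_two]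
    rw [h4]; exact h1
  have hvm : ∀ m, cutDist (v n) (v (n + m)) ≤ 2 * (1 / 2) ^ n := by
    intro m
    have : ∀ m, cutDist (v n) (v (n + m)) ≤ 2 * (1 / 2) ^ n - 2 * (1 / 2) ^ (n + m) := by
      intro m
      induction m with
      | zero => simp [cutDist_self]
      | succ m ih =>
        refine (cutDist_triangle _ (v (n + m)) _).trans
          ((add_le_add ih (hv (n + m))).trans (le_of_eq ?_))
        rw [← add_assoc, pow_succ _ (n + m)]; ring
    exact (this m).trans (sub_le_self _ (by positivity))
  have hlim' := (tendsto_const_nhds (x := ∫ z in S ×ˢ T, v n z.1 z.2)).sub hlim |>.abs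
  rw [integral_sub (integrable _).integrableOn]
  · refine le_of_tendsto hlim' (Filter.Eventually.filter_mono Nat.hyperfilter_le_atTop ?_)
    filter_upwards [Filter.eventually_ge_atTop n] with m hm
    obtain ⟨i, rfl⟩ := Nat.exists_eq_add_of_le hm
    rw [← integral_sub (integrable _).integrableOn (integrable _).integrableOn]
    exact (le_cutDist _ _ hS hT).trans (hvm i)
  · exact ((hgi.add hgi').div_const 2).integrableOn

/-- Composing the almost optimal bijections between consecutive terms aligns the whole sequence,
which then is Cauchy for the cut distance itself. -/
instance completeSpace_sideGraphon : CompleteSpace (SideGraphon γ) := by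
  refine Metric.complete_of_convergent_controlled_sequences (fun n => (1 / 2) ^ n)
    (fun n => by positivity) fun u hu => ?_
  have h1 : ∀ n, ∃ φ : SideBij γ, cutDist (u n).1 ((u (n + 1)).1.pullback φ.1) < (1 / 2) ^ n := fun n =>
    exists_lt_of_ciInf_lt (hu n n (n + 1) le_rfl n.le_succ)
  choose ψ hψ using h1
  let Φ : ℕ → SideBij γ := fun n => Nat.rec
    ⟨⟨MeasurableEquiv.refl _, MeasurePreserving.id _⟩, fun _ => Iff.rfl⟩
    (fun n φ => (ψ n).comp φ) n
  obtain ⟨g, hg⟩ := exists_cut_limit (fun n => (u n).1.pullback (Φ n).1) fun n =>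
    (cutDist_pullback_le (u n).1 ((u (n + 1)).1.pullback (ψ n).1) (Φ n).1).trans (hψ n).le
  refine ⟨⟨g⟩, tendsto_iff_dist_tendsto_zero.2 (squeeze_zero (fun _ => dist_nonneg) (fun n => ?_)
    (g := fun n => 2 * (1 / 2) ^ n) ?_)⟩
  · rw [dist_comm]
    refine (sideMetric_le g (u n).1 (Φ n)).trans ?_
    rw [cutDist_comm]
    exact hg n
  · simpa using (tendsto_pow_atTop_nhds_zero_of_lt_one (r := (1 / 2 : ℝ)) (by norm_num)
      (by norm_num)).const_mul 2

theorem isCompact_univ_sideGraphon (hγ : γ ∈ Ioo (0 : ℝ) 1) :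
    IsCompact (univ : Set (SideGraphon γ)) :=
  isCompact_iff_totallyBounded_isComplete.2 ⟨totallyBounded_sideGraphon hγ, isComplete_univ⟩

/-! ### Compactness of the domain of the rate function -/

theorem measurableSet_side (γ : ℝ) (b : Bool) : MeasurableSet (side γ b) := by
  cases b
  · convert (measurableSet_leftPart γ).compl using 1
    ext x; simp [side]
  · convert measurableSet_leftPart γ using 1
    ext x; simp [side]

/-- A side-preserving bijection maps each diagonal block to itself. This continuity is the reason to
restrict the rearrangements. -/
theorem abs_integral_side_sub_le (b : Bool) (f g : Graphon) :
    |(∫ z in side γ b ×ˢ side γ b, f z.1 z.2) - ∫ z in side γ b ×ˢ side γ b, g z.1 z.2| ≤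
      sideMetric γ f g := by
  refine le_ciInf fun φ => ?_
  have h1 : ∫ z in side γ b ×ˢ side γ b, g.pullback φ.1 z.1 z.2 =
      ∫ z in side γ b ×ˢ side γ b, g z.1 z.2 := by
    have hmp : MeasurePreserving (φ.1.1.prodCongr φ.1.1) volume volume := φ.1.2.prod φ.1.2
    have h := hmp.setIntegral_preimage_emb (φ.1.1.prodCongr φ.1.1).measurableEmbedding
      (fun z => g z.1 z.2) (side γ b ×ˢ side γ b)
    have hpre : (φ.1.1.prodCongr φ.1.1) ⁻¹' (side γ b ×ˢ side γ b) = side γ b ×ˢ side γ b := by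
      ext z
      simp only [mem_preimage, mem_prod, side, mem_ofPred_eq]
      exact and_congr (iff_congr (φ.2 z.1) Iff.rfl) (iff_congr (φ.2 z.2) Iff.rfl)
    rw [hpre] at h
    exact h
  rw [← h1, ← integral_sub f.integrable.integrableOn (integrable _).integrableOn]
  exact le_cutDist f _ (measurableSet_side γ b) (measurableSet_side γ b)

theorem mem_supportedGraphons_iff_integral {p : ℝ} (hp : p ∈ Ioo (0 : ℝ) 1)
    {hp' : p ∈ Icc (0 : ℝ) 1}
    {f : Graphon} : f ∈ supportedGraphons (bipartiteGraphon γ p hp') ↔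
      ∀ b, ∫ z in side γ b ×ˢ side γ b, f z.1 z.2 = 0 := by
  have h1 : ∀ b, ∫ z in side γ b ×ˢ side γ b, f z.1 z.2 = 0 ↔
      ∀ᵐ z : unitInterval × unitInterval, z ∈ side γ b ×ˢ side γ b → f z.1 z.2 = 0 := fun b => by
    rw [setIntegral_eq_zero_iff_of_nonneg_ae (Filter.Eventually.of_forall fun z => f.nonneg _ _)
      f.integrable.integrableOn]
    exact ae_restrict_iff' ((measurableSet_side γ b).prod (measurableSet_side γ b))
  rw [mem_supportedGraphons_iff hp]
  simp only [h1, ← ae_all_iff]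
  refine Filter.eventually_congr (Filter.Eventually.of_forall fun z => ?_)
  simp only [Bool.forall_bool, mem_prod, side, mem_ofPred_eq, Bool.false_eq_true, iff_true, iff_false]
  tauto

theorem isCompact_supportedGraphons (hγ : γ ∈ Ioo (0 : ℝ) 1) {p : ℝ} (hp : p ∈ Ioo (0 : ℝ) 1)
    {hp' : p ∈ Icc (0 : ℝ) 1} :
    IsCompact {f : SideGraphon γ | f.toGraphon ∈ supportedGraphons (bipartiteGraphon γ p hp')} := by
  refine (isCompact_univ_sideGraphon hγ).of_isClosed_subset ?_ (subset_univ _)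
  have hcont : ∀ b, Continuous fun f : SideGraphon γ =>
      ∫ z in side γ b ×ˢ side γ b, f.toGraphon z.1 z.2 := fun b =>
    LipschitzWith.continuous (K := 1) (LipschitzWith.of_dist_le_mul fun f g => by
      rw [NNReal.coe_one, one_mul]
      exact abs_integral_side_sub_le b f.1 g.1)
  simp only [mem_supportedGraphons_iff_integral hp, ofPred_forall]
  exact isClosed_iInter fun b => isClosed_eq (hcont b) continuous_const

end Graphon

/-! ### Existence of minimizers -/

namespace GraphonSpace

variable {γ p : ℝ}

theorem isCompact_classesOf_supportedGraphons (hγ : γ ∈ Ioo (0 : ℝ) 1) (hp : p ∈ Ioo (0 : ℝ) 1)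
    {hp' : p ∈ Icc (0 : ℝ) 1} :
    IsCompact (classesOf (Graphon.supportedGraphons (Graphon.bipartiteGraphon γ p hp'))) := by
  have hcont : Continuous fun f : Graphon.SideGraphon γ => mk f.toGraphon :=
    LipschitzWith.continuous (K := 1) (LipschitzWith.of_dist_le_mul fun f g => by
      rw [NNReal.coe_one, one_mul]
      exact Graphon.cutMetric_le_sideMetric f.1 g.1)
  convert (Graphon.isCompact_supportedGraphons hγ hp (hp' := hp')).image hcont using 1
  ext F
  rw [mem_classesOf_iff]
  exact ⟨fun ⟨g, hg, h⟩ => ⟨⟨g⟩, hg, h.symm⟩, fun ⟨g, hg, h⟩ => ⟨g.1, hg, h.symm⟩⟩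

theorem continuous_homDensity {V : Type*} [Fintype V] [DecidableEq V] (H : SimpleGraph V)
    [DecidableRel H.Adj] : Continuous (homDensity H) :=
  LipschitzWith.continuous (K := H.edgeFinset.card) (LipschitzWith.of_dist_le_mul fun F G => by
    rw [NNReal.coe_natCast]
    exact abs_homDensity_sub_le H F G)

/-- If `G` is within `η/2` of `F`, the ball of radius `η/2` about `G` is inside the `η`-ball about
`F`, so its infimum is no smaller. -/
theorem lowerSemicontinuousOn_rateFunction (W₀ : Graphon) :
    LowerSemicontinuousOn (rateFunction W₀) (classesOf (Graphon.supportedGraphons W₀)) := by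
  intro F hF a ha
  rw [rateFunction, if_pos hF] at ha
  obtain ⟨⟨η, hη⟩, ha⟩ := lt_iSup_iff.1 ha
  rw [eventually_nhdsWithin_iff]
  filter_upwards [Metric.ball_mem_nhds F (half_pos hη)] with G hG hG'
  rw [rateFunction, if_pos hG']
  refine ha.trans_le (le_trans ?_ (le_iSup _ ⟨η / 2, half_pos hη⟩))
  refine le_iInf fun h => iInf_le_of_le ⟨h.1, ?_⟩ le_rfl
  have h1 := h.2
  have h2 := Metric.mem_ball'.1 hG
  simp only at h1 ⊢
  linarith [dist_triangle F G (mk h.1)]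

theorem exists_isMinimizer (hγ : γ ∈ Ioo (0 : ℝ) 1) (hp : p ∈ Ioo (0 : ℝ) 1)
    {hp' : p ∈ Icc (0 : ℝ) 1} {τ : GraphonSpace → ℝ} (hτ : Continuous τ) {t : ℝ}
    (h : ∃ F ∈ classesOf (Graphon.supportedGraphons (Graphon.bipartiteGraphon γ p hp')), t ≤ τ F) :
    ∃ G, IsMinimizer (Graphon.bipartiteGraphon γ p hp') τ t G := by
  set W₀ := Graphon.bipartiteGraphon γ p hp'
  set K := classesOf (Graphon.supportedGraphons W₀) ∩ {F | t ≤ τ F}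
  have hK : IsCompact K := (isCompact_classesOf_supportedGraphons hγ hp).inter_right
    (isClosed_le continuous_const hτ)
  obtain ⟨G, hG, hmin⟩ := ((lowerSemicontinuousOn_rateFunction W₀).mono
    inter_subset_left).exists_isMinOn (s := K) h hK
  refine ⟨G, hG.2, fun F hF => ?_⟩
  by_cases hFK : F ∈ classesOf (Graphon.supportedGraphons W₀)
  · exact hmin ⟨hFK, hF⟩
  · refine le_top.trans (le_of_eq ?_)
    rw [rateFunction, if_neg hFK]

end GraphonSpace

namespace Graphon

variable {γ p r : ℝ}

/-! ### Block graphons for the partition of `[0,1]` at `γ` -/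

theorem blockInterval_zero (γ : ℝ) : blockInterval ![γ, 1 - γ] 0 = leftPart γ := by
  ext x
  have h : Finset.Iic (0 : Fin 2) = {0} := by decide
  simp [blockInterval, h]

theorem blockInterval_one (γ : ℝ) : blockInterval ![γ, 1 - γ] 1 = (leftPart γ)ᶜ := by
  ext x
  have h : Finset.Iic (1 : Fin 2) = Finset.univ := by decide
  have h' : Finset.Iio (1 : Fin 2) = {0} := by decide
  simp [blockInterval, h, h', x.2.2]

theorem bipartiteGraphon_mem_blockGraphons (γ : ℝ) (hr : r ∈ Icc (0 : ℝ) 1) :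
    bipartiteGraphon γ r hr ∈ blockGraphons ![γ, 1 - γ] := by
  refine ⟨fun i j => if i = j then 0 else r, fun i j => by simp only [eq_comm], fun i j => ?_, ?_⟩
  · dsimp only
    split_ifs
    · simp
    · exact hr
  · simp only [Fin.forall_fin_two, blockInterval_zero, blockInterval_one]
    refine ⟨⟨fun x hx y hy => ?_, fun x hx y hy => ?_⟩, fun x hx y hy => ?_, fun x hx y hy => ?_⟩
    · exact bipartiteGraphon_isSplit γ hr x y (iff_of_true hx hy)
    · exact bipartiteGraphon_apply_off hr hx hy
    · exact bipartiteGraphon_apply_of_not hr fun h => hx (h.2 hy)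
    · exact bipartiteGraphon_isSplit γ hr x y (iff_of_false hx hy)

/-- Two of three points lie on the same side. The triangle density depends only on the class, so it
carries this information to any other representative. -/
theorem IsSplit.homDensity_triangle {f : Graphon} (hf : IsSplit γ f) :
    homDensity (⊤ : SimpleGraph (Fin 3)) f = 0 := by
  have h : ∀ x : Fin 3 → unitInterval,
      ∏ e ∈ (⊤ : SimpleGraph (Fin 3)).edgeFinset, f.edgeVal x e = 0 := by
    intro x
    have hedge : ∀ i j : Fin 3, i ≠ j → (x i ∈ leftPart γ ↔ x j ∈ leftPart γ) →
        ∏ e ∈ (⊤ : SimpleGraph (Fin 3)).edgeFinset, f.edgeVal x e = 0 := fun i j hij h =>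
      Finset.prod_eq_zero (i := s(i, j)) (by simpa using hij) (hf _ _ h)
    by_cases h01 : x 0 ∈ leftPart γ ↔ x 1 ∈ leftPart γ
    · exact hedge 0 1 (by decide) h01
    · by_cases h02 : x 0 ∈ leftPart γ ↔ x 2 ∈ leftPart γ
      · exact hedge 0 2 (by decide) h02
      · exact hedge 1 2 (by decide) (by tauto)
  simp only [homDensity, h, integral_zero]

/-- A graphon without triangles vanishes at some point of every square of positive measure. -/
theorem exists_eq_zero_of_homDensity_triangle {f : Graphon}
    (hf : homDensity (⊤ : SimpleGraph (Fin 3)) f = 0) {S : Set unitInterval}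
    (hS : volume S ≠ 0) : ∃ x ∈ S, ∃ y ∈ S, f x y = 0 := by
  have h0 := fun x => f.prod_edgeVal_mem_Icc (⊤ : SimpleGraph (Fin 3)).edgeFinset x
  rw [homDensity, integral_eq_zero_iff_of_nonneg (fun x => (h0 x).1)
    (integrable_of_mem_Icc (f.measurable_prod_edgeVal _) h0)] at hf
  have hpos : volume (univ.pi fun _ : Fin 3 => S) ≠ 0 := by
    rw [volume_pi, Measure.pi_pi, Finset.prod_const]
    exact pow_ne_zero _ hS
  obtain ⟨x, hx, hx0⟩ := ((frequently_ae_mem_iff.2 hpos).and_eventually hf).exists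
  obtain ⟨e, he, he0⟩ := Finset.prod_eq_zero_iff.1 hx0
  induction e with | _ i j => exact ⟨x i, hx i trivial, x j, hx j trivial, he0⟩

/-- A positive value on a diagonal block would produce triangles within that block. -/
theorem eq_bipartiteGraphon_of_homDensity_triangle (hγ : γ ∈ Ioo (0 : ℝ) 1) {f : Graphon}
    (hf : f ∈ blockGraphons ![γ, 1 - γ]) (h : homDensity (⊤ : SimpleGraph (Fin 3)) f = 0) :
    ∃ (b : ℝ) (hb : b ∈ Icc (0 : ℝ) 1), f = bipartiteGraphon γ b hb := by
  obtain ⟨P, hsymm, hP, hfP⟩ := hf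
  simp only [Fin.forall_fin_two, blockInterval_zero, blockInterval_one] at hfP
  obtain ⟨⟨h00, h01⟩, h10, h11⟩ := hfP
  have hP00 : P 0 0 = 0 := by
    obtain ⟨x, hx, y, hy, hxy⟩ := exists_eq_zero_of_homDensity_triangle h (S := leftPart γ) (by
      rw [volume_leftPart hγ]
      simpa using hγ.1)
    rw [← h00 x hx y hy, hxy]
  have hP11 : P 1 1 = 0 := by
    obtain ⟨x, hx, y, hy, hxy⟩ := exists_eq_zero_of_homDensity_triangle h (S := (leftPart γ)ᶜ) (by
      rw [volume_leftPart_compl hγ]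
      simpa using hγ.2)
    rw [← h11 x hx y hy, hxy]
  refine ⟨P 0 1, hP 0 1, ?_⟩
  have hfun : f.toFun = (bipartiteGraphon γ (P 0 1) (hP 0 1)).toFun := by
    funext x y
    by_cases hx : x ∈ leftPart γ <;> by_cases hy : y ∈ leftPart γ
    · rw [h00 x hx y hy, hP00, bipartiteGraphon_isSplit γ (hP 0 1) x y (iff_of_true hx hy)]
    · rw [h01 x hx y hy, bipartiteGraphon_apply_off (hP 0 1) hx hy]
    · rw [h10 x hx y hy, hsymm, bipartiteGraphon_apply_of_not (hP 0 1) fun h => hx (h.2 hy)]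
    · rw [h11 x hx y hy, hP11, bipartiteGraphon_isSplit γ (hP 0 1) x y (iff_of_false hx hy)]
  cases f
  simp only at hfun
  subst hfun
  rfl

/-! ### Split graphons with two kinds of rows -/

/-- The split graphon that is equal to `a` on `[0,c] × (γ,1]` and to `b` on `(c,γ] × (γ,1]`. -/
def rowGraphon (γ c a b : ℝ) (ha : a ∈ Icc (0 : ℝ) 1) (hb : b ∈ Icc (0 : ℝ) 1) : Graphon where
  toFun x y := if ((x : ℝ) ≤ γ ↔ (y : ℝ) ≤ γ) then 0 else if (min x y : ℝ) ≤ c then a else b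
  symm' x y := by simp only [iff_comm, min_comm]
  mem_Icc' x y := by
    split_ifs
    · simp
    · exact ha
    · exact hb
  measurable' := Measurable.ite (measurableSet_diagBlocks γ) measurable_const
    (Measurable.ite (measurableSet_le (by fun_prop) measurable_const) measurable_const
      measurable_const)

variable {c a b : ℝ} (ha : a ∈ Icc (0 : ℝ) 1) (hb : b ∈ Icc (0 : ℝ) 1)

theorem rowGraphon_isSplit (γ c : ℝ) : IsSplit γ (rowGraphon γ c a b ha hb) :=
  fun _ _ h => if_pos h

theorem rowGraphon_apply_off {x y : unitInterval} (hx : x ∈ leftPart γ) (hy : y ∉ leftPart γ) :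
    rowGraphon γ c a b ha hb x y = if (x : ℝ) ≤ c then a else b := by
  have h1 : ¬ ((x : ℝ) ≤ γ ↔ (y : ℝ) ≤ γ) := fun h => hy (h.1 hx)
  have h2 : (x : ℝ) ≤ y := (show (x : ℝ) ≤ γ from hx).trans (not_le.1 hy).le
  change (if ((x : ℝ) ≤ γ ↔ (y : ℝ) ≤ γ) then (0 : ℝ) else
    if (min x y : ℝ) ≤ c then a else b) = _
  rw [if_neg h1, min_eq_left h2]

theorem setIntegral_offBlock_rowGraphon (hγ : γ ∈ Ioo (0 : ℝ) 1) (hc : c ∈ Ioo (0 : ℝ) γ)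
    (φ : ℝ → ℝ) : ∫ z in offBlock γ, φ (rowGraphon γ c a b ha hb z.1 z.2) =
      (1 - γ) * (c * φ a + (γ - c) * φ b) := by
  have h1 : ∫ z in offBlock γ, φ (rowGraphon γ c a b ha hb z.1 z.2) =
      ∫ z in offBlock γ, (φ b + (offBlock γ ∩ leftPart c ×ˢ univ).indicator
        (fun _ => φ a - φ b) z) := by
    refine setIntegral_congr_fun (measurableSet_offBlock γ) fun z hz => ?_
    simp only [rowGraphon_apply_off ha hb hz.1 hz.2]
    by_cases h : (z.1 : ℝ) ≤ c
    · rw [if_pos h, indicator_of_mem (show z ∈ offBlock γ ∩ leftPart c ×ˢ univ from ⟨hz, h, trivial⟩)]; ring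
    · rw [if_neg h, indicator_of_notMem fun h' => h h'.2.1, add_zero]
  have hm : MeasurableSet (offBlock γ ∩ leftPart c ×ˢ univ) :=
    (measurableSet_offBlock γ).inter ((measurableSet_leftPart c).prod .univ)
  have hset : offBlock γ ∩ (offBlock γ ∩ leftPart c ×ˢ univ) = leftPart c ×ˢ (leftPart γ)ᶜ := by
    rw [← inter_assoc, inter_self, prod_inter_prod, inter_univ]
    congr 1
    exact inter_eq_self_of_subset_right fun x (hx : (x : ℝ) ≤ c) => hx.trans hc.2.le
  have hvol : volume.real (leftPart c ×ˢ (leftPart γ)ᶜ) = c * (1 - γ) := by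
    rw [Measure.real, Measure.volume_eq_prod, Measure.prod_prod,
      volume_leftPart ⟨hc.1, hc.2.trans hγ.2⟩, volume_leftPart_compl hγ, ENNReal.toReal_mul,
      ENNReal.toReal_ofReal hc.1.le, ENNReal.toReal_ofReal (by linarith [hγ.2])]
  rw [h1, integral_add (integrable_const _) ((integrable_const _).indicator hm),
    setIntegral_offBlock_const hγ, setIntegral_indicator hm, hset, setIntegral_const, hvol,
    smul_eq_mul]
  ring

end Graphon

/-! ### The two cases of the theorem -/

namespace GraphonSpace

open Graphon (bipartiteGraphon binRelEntropy rootEntropy offMoment offEntropy rowGraphon)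

variable {V : Type*} [Fintype V] [DecidableEq V] {H : SimpleGraph V}
  [DecidableRel H.Adj] {γ p r : ℝ} {d : ℕ}

theorem isMinimizer_iff [Nonempty V] (hd : 1 ≤ d) (hreg : H.IsRegularOfDegree d)
    (hbip : H.IsBipartite)
    (hγ : γ ∈ Ioo (0 : ℝ) 1) (hp : p ∈ Ioo (0 : ℝ) 1) {hp' : p ∈ Icc (0 : ℝ) 1}
    (hr : r ∈ Icc p 1) (hr' : r ∈ Icc (0 : ℝ) 1)
    (hcm : OnConvexMinorant (rootEntropy p d) (r ^ d) (binRelEntropy p r)) (G : GraphonSpace) :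
    IsMinimizer (bipartiteGraphon γ p hp') (homDensity H)
      (Graphon.homDensity H (bipartiteGraphon γ r hr')) G ↔ G = mk (bipartiteGraphon γ r hr') := by
  have hle : rateFunction (bipartiteGraphon γ p hp') (mk (bipartiteGraphon γ r hr')) ≤
      ENNReal.ofReal (γ * (1 - γ) * binRelEntropy p r) := by
    rw [← Graphon.offEntropy_bipartiteGraphon hγ hr']
    exact rateFunction_mk_le hp (Graphon.bipartiteGraphon_isSplit γ hr')
  constructor
  · rintro ⟨ht, hmin⟩
    exact eq_mk_of_rateFunction_le hd hreg hbip hγ hp hr hr' hcm ht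
      ((hmin _ (homDensity_mk H _).ge).trans hle)
  · rintro rfl
    exact ⟨(homDensity_mk H _).ge, fun F hF =>
      hle.trans (le_rateFunction hd hreg hbip hγ hp hr hr' hcm hF)⟩

/-- If `(r^d, h_p(r))` is not on the convex minorant, some split graphon with the density of `f_r`
has less entropy than `f_r`. -/
theorem exists_isSplit_offEntropy_lt (hd : 1 ≤ d) (hreg : H.IsRegularOfDegree d)
    (hγ : γ ∈ Ioo (0 : ℝ) 1) (hp : p ∈ Ioo (0 : ℝ) 1) (hr : r ∈ Icc p 1)
    (hr' : r ∈ Icc (0 : ℝ) 1)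
    (hcm : ¬ OnConvexMinorant (rootEntropy p d) (r ^ d) (binRelEntropy p r)) :
    ∃ f, Graphon.IsSplit γ f ∧
      Graphon.homDensity H f = Graphon.homDensity H (bipartiteGraphon γ r hr') ∧
      offEntropy γ p f < γ * (1 - γ) * binRelEntropy p r := by
  have hr0 : 0 < r := hp.1.trans_le hr.1
  rw [← Graphon.rootEntropy_pow p hd hr0.le] at hcm
  obtain ⟨x, hx, y, hy, hxr, hry, hlt⟩ := exists_chord_lt (Graphon.rootEntropy_nonneg hp d)
    ⟨pow_pos hr0 d, (Graphon.pow_mem_Icc hr' d).2⟩ hcm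
  rw [Graphon.rootEntropy_pow p hd hr0.le] at hlt
  have hxy : 0 < y - x := by linarith
  have hroot : ∀ u ∈ Icc (0 : ℝ) 1, u ^ (1 / (d : ℝ)) ∈ Icc (0 : ℝ) 1 := fun u hu =>
    ⟨Real.rpow_nonneg hu.1 _, Real.rpow_le_one hu.1 hu.2 (by positivity)⟩
  have hpow : ∀ u ∈ Icc (0 : ℝ) 1, (u ^ (1 / (d : ℝ))) ^ d = u := fun u hu => by
    rw [one_div, Real.rpow_inv_natCast_pow hu.1 (by omega)]
  -- The weight with `s x + (1 - s) y = r^d`, which gives the row graphon the moment of `f_r`.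
  set s := (y - r ^ d) / (y - x) with hs
  have hs0 : 0 < s := div_pos (by linarith) hxy
  have hs1 : s < 1 := (div_lt_one hxy).2 (by linarith)
  have hsy : s * (y - x) = y - r ^ d := div_mul_cancel₀ _ hxy.ne'
  have hc : s * γ ∈ Ioo 0 γ := ⟨mul_pos hs0 hγ.1, by nlinarith [hγ.1]⟩
  have hsplit := Graphon.rowGraphon_isSplit (hroot x hx) (hroot y hy) γ (s * γ)
  refine ⟨rowGraphon γ (s * γ) _ _ (hroot x hx) (hroot y hy), hsplit, ?_, ?_⟩
  · rw [Graphon.homDensity_bipartiteGraphon hd hreg hγ hr',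
      Graphon.homDensity_eq_of_rows hd hreg hsplit
        (fun u hu v hv => Graphon.rowGraphon_apply_off (hroot x hx) (hroot y hy) hu hv),
      offMoment, Graphon.setIntegral_offBlock_rowGraphon (hroot x hx) (hroot y hy) hγ hc (· ^ d),
      hpow x hx, hpow y hy]
    congr 2
    linear_combination -(1 - γ) * γ * hsy
  · rw [offEntropy, Graphon.setIntegral_offBlock_rowGraphon (hroot x hx) (hroot y hy) hγ hc]
    have h1 : s * rootEntropy p d x + (1 - s) * rootEntropy p d y < binRelEntropy p r := by
      refine lt_of_mul_lt_mul_left ?_ hxy.le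
      refine (le_of_eq ?_).trans_lt hlt
      linear_combination (rootEntropy p d x - rootEntropy p d y) * hsy
    have hw : 0 < γ * (1 - γ) := mul_pos hγ.1 (by linarith [hγ.2])
    have h2 := mul_lt_mul_of_pos_left h1 hw
    refine (le_of_eq ?_).trans_lt h2
    ring

/-- A block graphon of finite rate is some `f_b`. -/
theorem exists_eq_mk_bipartiteGraphon (hγ : γ ∈ Ioo (0 : ℝ) 1) (hp : p ∈ Ioo (0 : ℝ) 1)
    {hp' : p ∈ Icc (0 : ℝ) 1} {G : GraphonSpace}
    (hG : G ∈ classesOf (Graphon.blockGraphons ![γ, 1 - γ]))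
    (hJ : rateFunction (bipartiteGraphon γ p hp') G ≠ ∞) :
    ∃ (b : ℝ) (hb : b ∈ Icc (0 : ℝ) 1), G = mk (bipartiteGraphon γ b hb) := by
  obtain ⟨g, hg, rfl⟩ := mem_classesOf_iff.1 hG
  have hs : mk g ∈ classesOf (Graphon.supportedGraphons (bipartiteGraphon γ p hp')) := by
    by_contra h
    exact hJ (by rw [rateFunction, if_neg h])
  obtain ⟨f, hf, hfg⟩ := (mem_classesOf_supportedGraphons_iff hp).1 hs
  have h0 : Graphon.homDensity (⊤ : SimpleGraph (Fin 3)) g = 0 := by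
    rw [← homDensity_mk, hfg, homDensity_mk, hf.homDensity_triangle]
  obtain ⟨b, hb, rfl⟩ := Graphon.eq_bipartiteGraphon_of_homDensity_triangle hγ hg h0
  exact ⟨b, hb, rfl⟩

/-- The rate of `f_b` is at least its entropy. -/
theorem le_rateFunction_bipartiteGraphon (hγ : γ ∈ Ioo (0 : ℝ) 1) (hp : p ∈ Ioo (0 : ℝ) 1)
    {hp' : p ∈ Icc (0 : ℝ) 1} (hr : r ∈ Icc p 1) (hr' : r ∈ Icc (0 : ℝ) 1) :
    ENNReal.ofReal (γ * (1 - γ) * binRelEntropy p r) ≤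
      rateFunction (bipartiteGraphon γ p hp') (mk (bipartiteGraphon γ r hr')) := by
  have h1 : rootEntropy p 1 = binRelEntropy p := by
    funext x; simp [rootEntropy]
  -- For a single edge the exponent is `1`, and `h_p` is convex, so every point lies on the convex
  -- minorant.
  refine le_rateFunction (H := (⊤ : SimpleGraph (Fin 2))) (d := 1) le_rfl
    (fun v => by simp) (SimpleGraph.colorable_of_fintype _) hγ hp hr hr' ?_
    (homDensity_mk _ _).ge
  rw [pow_one, h1]
  exact onConvexMinorant_of_convexOn hr' (Graphon.strictConvexOn_binRelEntropy hp).convexOn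
    (fun _ _ => le_rfl) rfl

/-- A minimizer of block form would be some `f_b` with `b ≥ r`, whose rate exceeds the entropy of
the two-row competitor. -/
theorem not_inSymmetricRegime [Nonempty V] (hd : 1 ≤ d) (hreg : H.IsRegularOfDegree d)
    (hbip : H.IsBipartite)
    (hγ : γ ∈ Ioo (0 : ℝ) 1) (hp : p ∈ Ioo (0 : ℝ) 1) {hp' : p ∈ Icc (0 : ℝ) 1}
    (hr : r ∈ Icc p 1) (hr' : r ∈ Icc (0 : ℝ) 1)
    (hcm : ¬ OnConvexMinorant (rootEntropy p d) (r ^ d) (binRelEntropy p r)) :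
    ¬ InSymmetricRegime ![γ, 1 - γ] (bipartiteGraphon γ p hp') (homDensity H)
      (Graphon.homDensity H (bipartiteGraphon γ r hr')) := by
  intro hsym
  have hw : 0 < γ * (1 - γ) := mul_pos hγ.1 (by linarith [hγ.2])
  obtain ⟨f, hf, hft, hfE⟩ := exists_isSplit_offEntropy_lt (H := H) hd hreg hγ hp hr hr' hcm
  have htf : Graphon.homDensity H (bipartiteGraphon γ r hr') ≤ homDensity H (mk f) := by
    rw [homDensity_mk, hft]
  obtain ⟨G, hG⟩ := exists_isMinimizer hγ hp (hp' := hp') (continuous_homDensity H)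
    ⟨mk f, (mem_classesOf_supportedGraphons_iff hp).2 ⟨f, hf, rfl⟩, htf⟩
  have hJ := (hG.2 _ htf).trans (rateFunction_mk_le hp hf)
  obtain ⟨b, hb, rfl⟩ := exists_eq_mk_bipartiteGraphon hγ hp (hsym G hG)
    (hJ.trans_lt ENNReal.ofReal_lt_top).ne
  have hrb : r ≤ b := by
    by_contra! hlt
    have h := hG.1
    rw [homDensity_mk, Graphon.homDensity_bipartiteGraphon hd hreg hγ hr',
      Graphon.homDensity_bipartiteGraphon hd hreg hγ hb] at h
    exact (Graphon.strictMono_density hd hreg hbip (by have := hb.1; positivity)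
      (mul_lt_mul_of_pos_left (pow_lt_pow_left₀ hlt hb.1 (by omega)) hw)).not_ge h
  have hbp : b ∈ Icc p 1 := ⟨hr.1.trans hrb, hb.2⟩
  have h1 := (le_rateFunction_bipartiteGraphon hγ hp hbp hb).trans hJ
  have h2 := mul_le_mul_of_nonneg_left (Graphon.monotoneOn_binRelEntropy hp hr hbp hrb) hw.le
  have h3 : 0 ≤ offEntropy γ p f := integral_nonneg fun z =>
    Graphon.binRelEntropy_nonneg_of_mem hp (f.mem_Icc' _ _)
  rw [ENNReal.ofReal_le_ofReal_iff h3] at h1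
  linarith

end GraphonSpace

end

theorem theorem1p7 {V : Type*} [Fintype V] [DecidableEq V] [Nonempty V]
    (H : SimpleGraph V) [DecidableRel H.Adj] (d : ℕ) (hd : 1 ≤ d)
    (hreg : H.IsRegularOfDegree d) (hbip : H.IsBipartite)
    (γ : ℝ) (hγ : γ ∈ Set.Ioo (0 : ℝ) 1) (p r : ℝ) (hp : p ∈ Set.Ioo (0 : ℝ) 1)
    (hr : r ∈ Set.Icc p 1) :
    let W₀ : Graphon := Graphon.bipartiteGraphon γ p ⟨hp.1.le, hp.2.le⟩
    let f_r : Graphon := Graphon.bipartiteGraphon γ r ⟨hp.1.le.trans hr.1, hr.2⟩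
    let t_r : ℝ := Graphon.homDensity H f_r
    let ψ : ℝ → ℝ := fun x => Graphon.binRelEntropy p (x ^ (1 / (d : ℝ)))
    (OnConvexMinorant ψ (r ^ d) (Graphon.binRelEntropy p r) →
      GraphonSpace.InSymmetricRegime ![γ, 1 - γ] W₀ (GraphonSpace.homDensity H) t_r ∧
      ∀ G : GraphonSpace,
        GraphonSpace.IsMinimizer W₀ (GraphonSpace.homDensity H) t_r G ↔
          G = GraphonSpace.mk f_r) ∧
    (¬ OnConvexMinorant ψ (r ^ d) (Graphon.binRelEntropy p r) →
      ¬ GraphonSpace.InSymmetricRegime ![γ, 1 - γ] W₀ (GraphonSpace.homDensity H) t_r) := by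

  intro W₀ f_r t_r ψ
  have hr' : r ∈ Set.Icc (0 : ℝ) 1 := ⟨hp.1.le.trans hr.1, hr.2⟩
  refine ⟨fun hcm => ?_,
    fun hcm => GraphonSpace.not_inSymmetricRegime hd hreg hbip hγ hp hr hr' hcm⟩
  have hiff := GraphonSpace.isMinimizer_iff hd hreg hbip hγ hp
    (hp' := ⟨hp.1.le, hp.2.le⟩) hr hr' hcm
  refine ⟨fun G hG => ?_, hiff⟩
  rw [(hiff G).1 hG]
  exact GraphonSpace.mem_classesOf_iff.2
    ⟨_, Graphon.bipartiteGraphon_mem_blockGraphons γ hr', rfl⟩
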